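/- Let $1<p<\infty$ and let $L_p=L_p(0,1)$ be the complex Lebesgue space; let $L_0=L_0(0,1)$ be the space of (classes of) measurable functions. If $p\ne 2$ let $G$ be the group $\mathrm{Isom}(L_p)$ of all surjective linear isometries of $L_p$; if $p=2$ let $G$ be the group of surjective linear isometries of $L_2$ which, together with their inverses, preserve disjointness of functions. Let $\mathcal K:L_p\to L_0$, $\mathcal K(f)=f\log(|f|/\|f\|_p)$, be the Kalton--Peck map, and let $Z_p(0,1)=\{(x,y)\in L_0\times L_p: x-\mathcal K(y)\in L_p\}$ be the Kalton--Peck space, with the quasi-norm $\|x-\mathcal K(y)\|_p+\|y\|_p$. Then: (1) Each $g\in G$ extends uniquely to a linear map of $L_0$, still denoted $g$, continuous for convergence in measure, and these extensions form an action of $G$ on $L_0$. (2) For each $g\in G$ the commutator $[g,\mathcal K]=g\mathcal K-\mathcal K g:L_p\to L_0$ is linear, and $d(g)=-[g,\mathcal K]$ is a derivation: $d(gh)=g\,d(h)+d(g)\,h$. The action of $G$ is compatible with $\mathcal K$ through $d$, where an action is called compatible with a quasi-linear map $\Omega: L_p\to L_0$ if there is a derivation $g\mapsto d(g)$ with values in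 the linear maps $L_p\to L_0$ such that the maps $[g,\Omega]+d(g)$, $g\in G$, take values in $L_p$ and are uniformly bounded, i.e. $\|[g,\Omega]f+d(g)f\|_p\le C\|f\|_p$ for all $g\in G$, $f\in L_p$. (3) The action of $G$ is also compatible with the differential of the scale of Lebesgue spaces $(L_\infty,L_1)_\theta=L_p$, $\theta=1/p$, that is, with $f\mapsto (B_f)'(\theta)$, for every homogeneous bounded selection $f\mapsto B_f$ (with $B_f(\theta)=f$) of the evaluation at $\theta$ on the Calderón space of functions $F$, continuous and bounded from $\{0\le \mathrm{Re}\,z\le1\}$ to $L_\infty+L_1=L_1$, analytic in the interior, with $F(it)$ bounded in $L_\infty$ and $F(1+it)$ bounded in $L_1$, uniformly in $t\in\mathbb R$. (4) Consequently $g\mapsto\begin{pmatrix} g & d(g)\\ 0& g\end{pmatrix}$ is a bounded action of $G$ on $Z_p(0,1)$, extending the action of $G$ on $L_p$. (5) However, $\mathcal K$ is not a linear perturbation of a $G$-centralizer: for every dense $G$-invariant linear subspace $Y_0$ of $L_p$ there is no linear map $L:Y_0\to L_0$ such that $\mathcal K+L$ is a $G$-centralizer on $Y_0$, i.e. is quasi-linear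 and satisfies $\|[g,\mathcal K+L]y\|_p\le C\|y\|_p$ for some $C$ and all $g\in G$, $y\in Y_0$. -/

import Mathlib

open MeasureTheory Filter
open scoped ENNReal Topology

noncomputable section

/-! ## Quasi-linear maps, centralizers and compatible actions

Throughout, `X` and `Y` are normed spaces, `E` is a vector space containing `X` through a linear
map `ι : X → E` (injective in all uses), and maps `Ω : Y → E` play the role of quasi-linear maps
from `Y` to `X`. A monoid `G` acts on `Y` by `v`, and on `E` by `U`; the action on `X` is the
restriction of `U`. A map defined only on a dense invariant subspace `Y₀` of a space is
covered by using `Y₀` itself, with the induced norm and action, in place of `Y`. -/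

section Abstract

variable {G : Type*} [Monoid G]
  {X : Type*} [NormedAddCommGroup X] [NormedSpace ℂ X]
  {Y : Type*} [NormedAddCommGroup Y] [NormedSpace ℂ Y]
  {E : Type*} [AddCommGroup E] [Module ℂ E]

/-- The vector `e` of the ambient space belongs to `X`, with norm at most `r`. -/
def NormLE (ι : X →ₗ[ℂ] E) (e : E) (r : ℝ) : Prop :=
  ∃ x : X, ι x = e ∧ ‖x‖ ≤ r

/-- Homogeneous, and additive up to an error in `X` controlled by the norms. -/
def IsQuasiLinear (ι : X →ₗ[ℂ] E) (Ω : Y → E) : Prop :=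
  (∀ (c : ℂ) (y : Y), Ω (c • y) = c • Ω y) ∧
    ∃ C : ℝ, ∀ y y' : Y, NormLE ι (Ω (y + y') - Ω y - Ω y') (C * (‖y‖ + ‖y'‖))

/-- The commutator `[U g, Ω, v g] = (U g) ∘ Ω - Ω ∘ (v g)`. -/
def actionCommutator (U : G →* Module.End ℂ E) (v : G →* Module.End ℂ Y) (Ω : Y → E)
    (g : G) (y : Y) : E :=
  U g (Ω y) - Ω (v g y)

/-- `Ω` is a `G`-centralizer: it is quasi-linear and its commutators with the elements of `G` are
uniformly bounded maps into `X`. -/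
def IsCentralizer (ι : X →ₗ[ℂ] E) (U : G →* Module.End ℂ E) (v : G →* Module.End ℂ Y)
    (Ω : Y → E) : Prop :=
  IsQuasiLinear ι Ω ∧
    ∃ C : ℝ, ∀ (g : G) (y : Y), NormLE ι (actionCommutator U v Ω g y) (C * ‖y‖)

/-- `Ω` becomes a `G`-centralizer after adding some linear map. -/
def IsLinearPerturbationOfCentralizer (ι : X →ₗ[ℂ] E) (U : G →* Module.End ℂ E)
    (v : G →* Module.End ℂ Y) (Ω : Y → E) : Prop :=
  ∃ L : Y →ₗ[ℂ] E, IsCentralizer ι U v (fun y => Ω y + L y)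

/-- Derivations: `d (g h) = U g ∘ d h + d g ∘ v h`, the `d g` being linear maps, with no
continuity required. -/
def IsActionDerivation (U : G →* Module.End ℂ E) (v : G →* Module.End ℂ Y)
    (d : G → (Y →ₗ[ℂ] E)) : Prop :=
  ∀ g h : G, d (g * h) = (U g).comp (d h) + (d g).comp (v h)

/-- The action is compatible with the quasi-linear map `Ω`, as witnessed by the derivation `d`:
the maps `[U g, Ω, v g] + d g` are uniformly bounded from `Y` into `X`. -/
def IsCompatibleVia (ι : X →ₗ[ℂ] E) (U : G →* Module.End ℂ E) (v : G →* Module.End ℂ Y)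
    (Ω : Y → E) (d : G → (Y →ₗ[ℂ] E)) : Prop :=
  IsQuasiLinear ι Ω ∧ IsActionDerivation U v d ∧
    ∃ C : ℝ, ∀ (g : G) (y : Y), NormLE ι (actionCommutator U v Ω g y + d g y) (C * ‖y‖)

/-- The action is compatible with `Ω`. -/
def IsCompatible (ι : X →ₗ[ℂ] E) (U : G →* Module.End ℂ E) (v : G →* Module.End ℂ Y)
    (Ω : Y → E) : Prop :=
  ∃ d : G → (Y →ₗ[ℂ] E), IsCompatibleVia ι U v Ω d

/-- The twisted sum `{(e, y) : e - Ω y ∈ X}`. (If `X` and `Y` are complete and `Ω` is defined on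
all of `Y`, it is already complete for its quasi-norm.) -/
def twistedSum (ι : X →ₗ[ℂ] E) (Ω : Y → E) (hΩ : IsQuasiLinear ι Ω) :
    Submodule ℂ (E × Y) where
  carrier := {z | z.1 - Ω z.2 ∈ LinearMap.range ι}
  zero_mem' := by
    have h : Ω 0 = 0 := by simpa using hΩ.1 0 0
    exact ⟨0, by simp [h]⟩
  add_mem' := by
    rintro ⟨e, y⟩ ⟨e', y'⟩ h h'
    obtain ⟨C, hC⟩ := hΩ.2
    obtain ⟨x, hx, -⟩ := hC y y'
    have hx' : Ω (y + y') - Ω y - Ω y' ∈ LinearMap.range ι := ⟨x, hx⟩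
    have := Submodule.sub_mem _ (Submodule.add_mem _ h h') hx'
    change e + e' - Ω (y + y') ∈ LinearMap.range ι
    convert this using 1
    dsimp only
    abel
  smul_mem' := by
    rintro c ⟨e, y⟩ h
    have h' : e - Ω y ∈ LinearMap.range ι := h
    change c • e - Ω (c • y) ∈ LinearMap.range ι
    rw [hΩ.1, ← smul_sub]
    exact Submodule.smul_mem _ c h'

/-- The quasi-norm `‖(e, y)‖ = ‖e - Ω y‖_X + ‖y‖_Y` of the twisted sum; the set under the infimum
is the singleton `{‖e - Ω y‖_X}` when `ι` is injective and `(e, y)` is in the twisted sum. -/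
def twistedNorm (ι : X →ₗ[ℂ] E) (Ω : Y → E) (z : E × Y) : ℝ :=
  sInf {r : ℝ | ∃ x : X, ι x = z.1 - Ω z.2 ∧ r = ‖x‖} + ‖z.2‖

/-- The action of `G` on an invariant subspace. -/
def restrictAction (v : G →* Module.End ℂ Y) (Y₀ : Submodule ℂ Y)
    (h : ∀ g : G, ∀ y ∈ Y₀, v g y ∈ Y₀) : G →* Module.End ℂ Y₀ where
  toFun g := (v g).restrict (h g)
  map_one' := by ext y; simp
  map_mul' g g' := by ext y; simp

end Abstract

/-! ## Lebesgue spaces on the unit interval and their isometries -/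

/-- Lebesgue measure on `(0, 1)`. -/
abbrev leb01 : Measure ℝ := volume.restrict (Set.Ioo (0 : ℝ) 1)

/-- The space `L₀(0, 1)` of classes of complex measurable functions. -/
abbrev L0 : Type := ℝ →ₘ[leb01] ℂ

/-- The complex space `L_p(0, 1)`. -/
abbrev LpI (p : ℝ≥0∞) : Type := Lp ℂ p leb01

/-- The inclusion of `L_p(0, 1)` in `L₀(0, 1)`. -/
def toL0 (p : ℝ≥0∞) : LpI p →ₗ[ℂ] L0 where
  toFun f := (f : L0)
  map_add' _ _ := rfl
  map_smul' _ _ := rfl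

/-- The group of surjective linear isometries of `L_p(0, 1)`. -/
abbrev IsomLp (p : ℝ≥0∞) [Fact (1 ≤ p)] : Type := LpI p ≃ₗᵢ[ℂ] LpI p

/-- Two functions are disjoint if their product vanishes almost everywhere. -/
def DisjointLp {p : ℝ≥0∞} (f g : LpI p) : Prop := ∀ᵐ x ∂leb01, f x * g x = 0

/-- The group of isometries `T` such that both `T` and its inverse preserve disjointness. -/
def disjointnessPreserving (p : ℝ≥0∞) [Fact (1 ≤ p)] : Subgroup (IsomLp p) where
  carrier := {T | ∀ f g : LpI p, DisjointLp (T f) (T g) ↔ DisjointLp f g}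
  one_mem' := fun _ _ => Iff.rfl
  mul_mem' := fun {S T} hS hT f g => (hS (T f) (T g)).trans (hT f g)
  inv_mem' := fun {T} hT f g => by
    have h := hT (T⁻¹ f) (T⁻¹ g)
    have e : ∀ k : LpI p, T (T⁻¹ k) = k := fun k => T.apply_symm_apply k
    rw [e, e] at h
    exact h.symm

/-- The natural action of a group of isometries on `L_p(0, 1)`. -/
def naturalAction {p : ℝ≥0∞} [Fact (1 ≤ p)] (G : Subgroup (IsomLp p)) :
    G →* Module.End ℂ (LpI p) where
  toFun g := (g : IsomLp p).toLinearEquiv.toLinearMap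
  map_one' := rfl
  map_mul' _ _ := rfl

/-- `V` is a linear extension of the isometry `T` to `L₀(0, 1)` which is continuous for convergence
in measure. -/
def IsContinuousExtension {p : ℝ≥0∞} [Fact (1 ≤ p)] (T : IsomLp p) (V : Module.End ℂ L0) :
    Prop :=
  (∀ f : LpI p, V (toL0 p f) = toL0 p (T f)) ∧
    ∀ (h : ℕ → L0) (k : L0), TendstoInMeasure leb01 (fun n x => h n x) atTop (fun x => k x) →
      TendstoInMeasure leb01 (fun n x => V (h n) x) atTop (fun x => V k x)

/-! ## The Kalton-Peck map and the Kalton-Peck space -/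

/-- The Kalton-Peck map `f ↦ f log (|f| / ‖f‖)` (with `0 log 0 = 0`), from `L_p` to `L₀`. -/
def kaltonPeck (p : ℝ≥0∞) (f : LpI p) : L0 :=
  AEEqFun.mk (fun x => f x * (Real.log (‖f x‖ / ‖f‖) : ℂ)) (by
    have h : Measurable f := (Lp.stronglyMeasurable f).measurable
    exact Measurable.aestronglyMeasurable (by fun_prop))

theorem abs_log_div_mul_le {N t : ℝ} (hN : 0 < N) (ht : 0 ≤ t) (htN : t ≤ N) :
    |Real.log (t / N)| * t ≤ N := by
  rcases ht.eq_or_lt with rfl | h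
  · simpa using hN.le
  · have h1 := Real.abs_log_mul_self_lt (t / N) (by positivity) ((div_le_one hN).2 htN)
    rw [abs_mul, abs_of_pos (show 0 < t / N by positivity)] at h1
    have h2 : |Real.log (t / N)| * t = |Real.log (t / N)| * (t / N) * N := by field_simp
    rw [h2]
    nlinarith

theorem mul_log_div_eq {M N : ℝ} (hM : 0 < M) (hN : 0 < N) (s : ℂ) :
    s * (Real.log (‖s‖ / N) : ℂ) =
      s * (Real.log (‖s‖ / M) : ℂ) + s * (Real.log (M / N) : ℂ) := by
  by_cases hs : s = 0
  · simp [hs]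
  · have hs' : 0 < ‖s‖ := norm_pos_iff.2 hs
    have : ‖s‖ / N = ‖s‖ / M * (M / N) := by field_simp
    rw [this, Real.log_mul (by positivity) (by positivity)]
    push_cast
    ring

theorem norm_mul_log_sub_le {N : ℝ} (hN : 0 < N) (s t : ℂ) :
    ‖(s + t) * (Real.log (‖s + t‖ / N) : ℂ) - s * (Real.log (‖s‖ / N) : ℂ)
      - t * (Real.log (‖t‖ / N) : ℂ)‖ ≤ 3 * (‖s‖ + ‖t‖) := by
  rcases (show 0 ≤ ‖s‖ + ‖t‖ by positivity).eq_or_lt with h | hM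
  · have hs : s = 0 := norm_eq_zero.1 (by linarith [norm_nonneg s, norm_nonneg t])
    have ht : t = 0 := norm_eq_zero.1 (by linarith [norm_nonneg s, norm_nonneg t])
    simp [hs, ht]
  set M := ‖s‖ + ‖t‖ with hMdef
  have key : ∀ r : ℂ, ‖r‖ ≤ M → ‖r * (Real.log (‖r‖ / M) : ℂ)‖ ≤ M := fun r hr => by
    rw [norm_mul, Complex.norm_real, Real.norm_eq_abs, mul_comm]
    exact abs_log_div_mul_le hM (norm_nonneg _) hr
  have e : (s + t) * (Real.log (‖s + t‖ / N) : ℂ) - s * (Real.log (‖s‖ / N) : ℂ)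
      - t * (Real.log (‖t‖ / N) : ℂ) =
      (s + t) * (Real.log (‖s + t‖ / M) : ℂ) - s * (Real.log (‖s‖ / M) : ℂ)
      - t * (Real.log (‖t‖ / M) : ℂ) := by
    rw [mul_log_div_eq hM hN (s + t), mul_log_div_eq hM hN s, mul_log_div_eq hM hN t]
    ring
  rw [e]
  have h1 := key (s + t) (norm_add_le _ _)
  have h2 := key s (by linarith [norm_nonneg t])
  have h3 := key t (by linarith [norm_nonneg s])
  have h4 := norm_sub_le ((s + t) * (Real.log (‖s + t‖ / M) : ℂ) - s * (Real.log (‖s‖ / M) : ℂ))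
    (t * (Real.log (‖t‖ / M) : ℂ))
  have h5 := norm_sub_le ((s + t) * (Real.log (‖s + t‖ / M) : ℂ)) (s * (Real.log (‖s‖ / M) : ℂ))
  linarith

/-- The Kalton-Peck map in terms of a normalization by another constant. -/
theorem kaltonPeck_ae {p : ℝ≥0∞} [Fact (1 ≤ p)] {N : ℝ} (hN : 0 < N) (f : LpI p) :
    ∀ᵐ x ∂leb01, kaltonPeck p f x =
      f x * (Real.log (‖f x‖ / N) : ℂ) - (Real.log (‖f‖ / N) : ℂ) * f x := by
  have h0 : ∀ᵐ x ∂leb01, ‖f‖ = 0 → f x = 0 := by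
    by_cases h : ‖f‖ = 0
    · have hf : f = 0 := norm_eq_zero.1 h
      subst hf
      filter_upwards [Lp.coeFn_zero ℂ p leb01] with x hx _
      simpa using hx
    · exact Eventually.of_forall fun x hx => absurd hx h
  have h1 : kaltonPeck p f =ᵐ[leb01] fun x => f x * (Real.log (‖f x‖ / ‖f‖) : ℂ) :=
    AEEqFun.coeFn_mk _ _
  filter_upwards [h0, h1] with x hx h1x
  rw [h1x]
  rcases (norm_nonneg f).eq_or_lt with h | h
  · simp [hx h.symm]
  · rw [mul_log_div_eq h hN (f x)]
    ring

theorem kaltonPeck_isQuasiLinear (p : ℝ≥0∞) [Fact (1 ≤ p)] :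
    IsQuasiLinear (toL0 p) (kaltonPeck p) := by
  refine ⟨fun c f => ?_, 6, fun f g => ?_⟩
  · apply AEEqFun.ext
    have h1 : kaltonPeck p (c • f) =ᵐ[leb01]
      fun x => (c • f : LpI p) x * (Real.log (‖(c • f : LpI p) x‖ / ‖c • f‖) : ℂ) :=
        AEEqFun.coeFn_mk _ _
    have h2 : kaltonPeck p f =ᵐ[leb01] fun x => f x * (Real.log (‖f x‖ / ‖f‖) : ℂ) :=
      AEEqFun.coeFn_mk _ _
    filter_upwards [h1, h2, AEEqFun.coeFn_smul c (kaltonPeck p f), Lp.coeFn_smul c f]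
      with x h1 h2 h3 h4
    rw [h1, h3, h4]
    simp only [Pi.smul_apply, smul_eq_mul, h2, norm_mul, norm_smul]
    by_cases hc : c = 0
    · simp [hc]
    · rw [mul_div_mul_left _ _ (norm_ne_zero_iff.2 hc), mul_assoc]
  · rcases (show 0 ≤ ‖f‖ + ‖g‖ by positivity).eq_or_lt with h | hN
    · have hf : f = 0 := norm_eq_zero.1 (by linarith [norm_nonneg f, norm_nonneg g])
      have hg : g = 0 := norm_eq_zero.1 (by linarith [norm_nonneg f, norm_nonneg g])
      have hz : kaltonPeck p (0 : LpI p) = 0 := by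
        apply AEEqFun.ext
        have h2 : kaltonPeck p (0 : LpI p) =ᵐ[leb01] fun x =>
            (0 : LpI p) x * (Real.log (‖(0 : LpI p) x‖ / ‖(0 : LpI p)‖) : ℂ) :=
          AEEqFun.coeFn_mk _ _
        filter_upwards [h2, AEEqFun.coeFn_zero (β := ℂ) (μ := leb01)] with x h2 h3
        rw [h2, h3]
        simp
      refine ⟨0, ?_, by simp [hf, hg]⟩
      simp [hf, hg, hz]
    set N := ‖f‖ + ‖g‖ with hNdef
    set P : ℝ → ℂ := fun x => (f x + g x) * (Real.log (‖f x + g x‖ / N) : ℂ)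
      - f x * (Real.log (‖f x‖ / N) : ℂ) - g x * (Real.log (‖g x‖ / N) : ℂ) with hP
    have mf : Measurable f := (Lp.stronglyMeasurable f).measurable
    have mg : Measurable g := (Lp.stronglyMeasurable g).measurable
    have hPm : AEStronglyMeasurable P leb01 := Measurable.aestronglyMeasurable (by fun_prop)
    have hR : MemLp (fun x => ‖f x‖ + ‖g x‖) p leb01 := (Lp.memLp f).norm.add (Lp.memLp g).norm
    have hle : ∀ᵐ x ∂leb01, ‖P x‖ ≤ 3 * ‖‖f x‖ + ‖g x‖‖ := Eventually.of_forall fun x => by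
      rw [Real.norm_of_nonneg (by positivity)]
      exact norm_mul_log_sub_le hN (f x) (g x)
    have hPL : MemLp P p leb01 := hR.of_le_mul hPm hle
    have hPn : ‖hPL.toLp P‖ ≤ 3 * N := by
      have h1 : ‖hPL.toLp P‖ ≤ 3 * ‖hR.toLp _‖ := by
        apply Lp.norm_le_mul_norm_of_ae_le_mul
        filter_upwards [hPL.coeFn_toLp, hR.coeFn_toLp, hle] with x h1 h2 h3
        rw [h1, h2]
        exact h3
      have h2 : hR.toLp _ = (Lp.memLp f).norm.toLp _ + (Lp.memLp g).norm.toLp _ := rfl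
      have h3 : ‖hR.toLp _‖ ≤ N := by
        rw [h2]
        refine (norm_add_le _ _).trans ?_
        rw [Lp.norm_toLp, Lp.norm_toLp, eLpNorm_norm, eLpNorm_norm]
        exact le_of_eq rfl
      linarith
    set c₁ : ℂ := (Real.log (‖f + g‖ / N) : ℂ)
    set c₂ : ℂ := (Real.log (‖f‖ / N) : ℂ)
    set c₃ : ℂ := (Real.log (‖g‖ / N) : ℂ)
    have hc : ∀ k : LpI p, ‖k‖ ≤ N → ‖(Real.log (‖k‖ / N) : ℂ) • k‖ ≤ N := fun k hk => by
      rw [norm_smul, Complex.norm_real, Real.norm_eq_abs]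
      exact abs_log_div_mul_le hN (norm_nonneg _) hk
    refine ⟨hPL.toLp P - c₁ • (f + g) + c₂ • f + c₃ • g, ?_, ?_⟩
    · apply AEEqFun.ext
      change ((hPL.toLp P - c₁ • (f + g) + c₂ • f + c₃ • g : LpI p) : ℝ → ℂ) =ᵐ[leb01] _
      filter_upwards [hPL.coeFn_toLp, Lp.coeFn_add (hPL.toLp P - c₁ • (f + g) + c₂ • f) (c₃ • g),
        Lp.coeFn_add (hPL.toLp P - c₁ • (f + g)) (c₂ • f), Lp.coeFn_sub (hPL.toLp P) (c₁ • (f + g)),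
        Lp.coeFn_smul c₁ (f + g), Lp.coeFn_smul c₂ f, Lp.coeFn_smul c₃ g, Lp.coeFn_add f g,
        AEEqFun.coeFn_sub (kaltonPeck p (f + g) - kaltonPeck p f) (kaltonPeck p g),
        AEEqFun.coeFn_sub (kaltonPeck p (f + g)) (kaltonPeck p f),
        kaltonPeck_ae hN (f + g), kaltonPeck_ae hN f, kaltonPeck_ae hN g]
        with x a1 a2 a3 a4 a5 a6 a7 a8 a9 a10 a11 a12 a13
      rw [a2, Pi.add_apply, a3, Pi.add_apply, a4, Pi.sub_apply, a5, a6, a7, a1, a9, Pi.sub_apply,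
        a10, Pi.sub_apply, a11, a12, a13]
      simp only [Pi.smul_apply, a8, Pi.add_apply, smul_eq_mul, hP]
      ring
    · have b1 := hc (f + g) (norm_add_le _ _)
      have b2 := hc f (by linarith [norm_nonneg g])
      have b3 := hc g (by linarith [norm_nonneg f])
      have d1 := norm_add_le (hPL.toLp P - c₁ • (f + g) + c₂ • f) (c₃ • g)
      have d2 := norm_add_le (hPL.toLp P - c₁ • (f + g)) (c₂ • f)
      have d3 := norm_sub_le (hPL.toLp P) (c₁ • (f + g))
      linarith

/-- The Kalton-Peck space `Z_p(0, 1)`, the twisted sum of `L_p` with itself defined by the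
Kalton-Peck map. -/
def KaltonPeckSpace (p : ℝ≥0∞) [Fact (1 ≤ p)] : Submodule ℂ (L0 × LpI p) :=
  twistedSum (toL0 p) (kaltonPeck p) (kaltonPeck_isQuasiLinear p)

/-! ## The differential of the scale of Lebesgue spaces

On `(0, 1)` one has `L_∞ + L_1 = L_1`, with the same norm. -/

/-- The closed unit strip. -/
def closedStrip : Set ℂ := {z | 0 ≤ z.re ∧ z.re ≤ 1}

/-- The open unit strip. -/
def openStrip : Set ℂ := {z | 0 < z.re ∧ z.re < 1}

/-- `F` (only its values on the closed strip matter) belongs to the Calderón space of the pair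
`(L_∞, L_1)` and has norm at most `r` there: it is continuous and bounded from the closed strip to
`L_∞ + L_1 = L_1`, analytic inside, bounded by `r` in `L_∞` on the line `Re z = 0`, and by
`r` in `L_1` on the line `Re z = 1`. Continuity of `t ↦ F (i t)` for the norm of `L_∞` is not
demanded, so that the class contains both the functions for which this is demanded and the
extremal functions `z ↦ f |f| ^ (p z - 1)`. -/
def CalderonNormLE (F : ℂ → LpI 1) (r : ℝ) : Prop :=
  ContinuousOn F closedStrip ∧ DifferentiableOn ℂ F openStrip ∧
    (∃ M : ℝ, ∀ z ∈ closedStrip, ‖F z‖ ≤ M) ∧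
    (∀ t : ℝ, ∀ᵐ x ∂leb01, ‖F (t * Complex.I) x‖ ≤ r) ∧
    (∀ t : ℝ, ‖F (1 + t * Complex.I)‖ ≤ r)

/-- A homogeneous bounded selection for the evaluation at `θ = 1 / p`, where the interpolation
space is `L_p`. -/
def IsCalderonSelection (p : ℝ≥0∞) (B : LpI p → ℂ → LpI 1) : Prop :=
  (∀ f : LpI p, toL0 1 (B f (1 / p.toReal : ℝ)) = toL0 p f) ∧
    (∀ (c : ℂ) (f : LpI p), ∀ z ∈ closedStrip, B (c • f) z = c • B f z) ∧
    ∃ C : ℝ, ∀ f : LpI p, CalderonNormLE (B f) (C * ‖f‖)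

/-- The differential `f ↦ (B f)' (θ)`, `θ = 1 / p`, defined by the selection `B`. -/
def scaleDifferential (p : ℝ≥0∞) (B : LpI p → ℂ → LpI 1) (f : LpI p) : L0 :=
  toL0 1 (deriv (B f) ((1 / p.toReal : ℝ) : ℂ))

end

noncomputable section

/-! Everything rests on Lamperti's description of the isometries. For `p ≠ 2`, equality in the `L_p`
parallelogram inequality characterizes disjointness (`disjointLp_iff_defect`), so every surjective
isometry preserves disjointness. A disjointness preserving isometry has the form `T f = W · (f ∘ Θ)`
with `W = T 1` (`isWeightedComp_of_disjointnessPreserving`). This formula makes sense on all of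
`L₀`, is continuous in measure, and is the only such extension because `L_p` is dense in measure.
The logarithm of a product splits and `‖T f‖ = ‖f‖`, so `[T, 𝒦] f = -log |W| · T f`, which is linear
in `f`. Taking `d = -[·, 𝒦]` gives a derivation by pure algebra, compatibility with constant `0`,
and a triangular action on the twisted sum that does not increase the quasi-norm.

For the scale, compare a Calderón function `F` with `F(θ) = f` to the extremal `z ↦ f (|f| / ‖f‖) ^
(p z - 1)`, whose derivative at `θ` is `p 𝒦 f`. Their difference vanishes at `θ` and is bounded in
`L_∞` and in `L_1` on the two boundary lines, so its derivative at `θ` lies in `L_p` with a norm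
estimate (`normLE_deriv_sub_kaltonPeck`). The differential is thus a bounded perturbation of `p 𝒦`,
and `p d` serves as derivation.

For the negative part, suppose that `𝒦 + L` is a centralizer. Then `W · (L y ∘ Θ) - L (T y) - log
|W| · T y` has norm at most `C ‖y‖`. A dense invariant `Y₀` is stable under bounded multipliers and
contains the indicator of some `(0, m)`. Cut `(0, m)` into `n + 1` intervals of length `δ`; let `v =
L 1` for the first of them and let `B` be the union of the others. Exchanging the first interval
with `B` gives `L 1_B ≈ v ∘ stretch + (1/p) log n` on `B`. Exchanging it with a single piece of `B`
shows that `L` of the indicator of that piece is a translate of `v` there. Averaging over powers of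
a unimodular step function shows that on each piece `L 1_B` agrees with `L` of the indicator of the
piece. All errors have mean modulus at most `C`. Hence `v ∘ stretch - v ∘ cut + (1/p) log n` has
mean modulus at most `3 C` on `B`. Stretching and cutting have the same distribution, so the first
two terms cancel in mean, and `log n ≤ 3 p C` fails for large `n`. -/

/-! ## Weighted composition operators on `L₀` -/

/-- The weighted composition operator `h ↦ W · (h ∘ Θ)` on `L₀`. -/
def weightedComp (W : ℝ → ℂ) (hW : Measurable W) (Θ : ℝ → ℝ)
    (hΘ : Measure.QuasiMeasurePreserving Θ leb01 leb01) : Module.End ℂ L0 where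
  toFun h := AEEqFun.mk W hW.aestronglyMeasurable * h.compQuasiMeasurePreserving Θ hΘ
  map_add' h k := by
    apply AEEqFun.ext
    filter_upwards [AEEqFun.coeFn_mul (AEEqFun.mk W hW.aestronglyMeasurable)
        ((h + k).compQuasiMeasurePreserving Θ hΘ),
      AEEqFun.coeFn_add (AEEqFun.mk W hW.aestronglyMeasurable * h.compQuasiMeasurePreserving Θ hΘ)
        (AEEqFun.mk W hW.aestronglyMeasurable * k.compQuasiMeasurePreserving Θ hΘ),
      AEEqFun.coeFn_mul (AEEqFun.mk W hW.aestronglyMeasurable) (h.compQuasiMeasurePreserving Θ hΘ),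
      AEEqFun.coeFn_mul (AEEqFun.mk W hW.aestronglyMeasurable) (k.compQuasiMeasurePreserving Θ hΘ),
      AEEqFun.coeFn_compQuasiMeasurePreserving (h + k) hΘ,
      AEEqFun.coeFn_compQuasiMeasurePreserving h hΘ,
      AEEqFun.coeFn_compQuasiMeasurePreserving k hΘ,
      hΘ.ae (AEEqFun.coeFn_add h k)] with x a1 a2 a3 a4 a5 a6 a7 a8
    rw [a1, a2]
    simp only [Pi.mul_apply, Pi.add_apply, a3, a4, a5, a6, a7, Function.comp_apply, a8]
    ring
  map_smul' c h := by
    apply AEEqFun.ext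
    filter_upwards [AEEqFun.coeFn_mul (AEEqFun.mk W hW.aestronglyMeasurable)
        ((c • h).compQuasiMeasurePreserving Θ hΘ),
      AEEqFun.coeFn_smul c
        (AEEqFun.mk W hW.aestronglyMeasurable * h.compQuasiMeasurePreserving Θ hΘ),
      AEEqFun.coeFn_mul (AEEqFun.mk W hW.aestronglyMeasurable) (h.compQuasiMeasurePreserving Θ hΘ),
      AEEqFun.coeFn_compQuasiMeasurePreserving (c • h) hΘ,
      AEEqFun.coeFn_compQuasiMeasurePreserving h hΘ,
      hΘ.ae (AEEqFun.coeFn_smul c h)] with x a1 a2 a3 a5 a6 a8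
    rw [a1, RingHom.id_apply, a2]
    simp only [Pi.mul_apply, Pi.smul_apply, a3, a5, a6, Function.comp_apply, a8, smul_eq_mul]
    ring

theorem weightedComp_ae (W : ℝ → ℂ) (hW : Measurable W) (Θ : ℝ → ℝ)
    (hΘ : Measure.QuasiMeasurePreserving Θ leb01 leb01) (h : L0) :
    ∀ᵐ x ∂leb01, weightedComp W hW Θ hΘ h x = W x * h (Θ x) := by
  filter_upwards [AEEqFun.coeFn_mul (AEEqFun.mk W hW.aestronglyMeasurable)
      (h.compQuasiMeasurePreserving Θ hΘ),
    AEEqFun.coeFn_compQuasiMeasurePreserving h hΘ,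
    AEEqFun.coeFn_mk W hW.aestronglyMeasurable] with x a1 a2 a3
  change (AEEqFun.mk W hW.aestronglyMeasurable * h.compQuasiMeasurePreserving Θ hΘ : L0) x = _
  rw [a1, Pi.mul_apply, a2, a3, Function.comp_apply]

/-- On a finite measure space, convergence in measure means that every subsequence has a further
subsequence converging almost everywhere. The latter survives composition with `Θ`, which pulls null
sets back to null sets, and multiplication by a fixed function. -/
theorem weightedComp_tendstoInMeasure (W : ℝ → ℂ) (hW : Measurable W) (Θ : ℝ → ℝ)
    (hΘ : Measure.QuasiMeasurePreserving Θ leb01 leb01) (h : ℕ → L0) (k : L0)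
    (hk : TendstoInMeasure leb01 (fun n x => h n x) atTop (fun x => k x)) :
    TendstoInMeasure leb01 (fun n x => weightedComp W hW Θ hΘ (h n) x) atTop
      (fun x => weightedComp W hW Θ hΘ k x) := by
  rw [exists_seq_tendstoInMeasure_atTop_iff (fun n => AEEqFun.aestronglyMeasurable _)]
  intro ns hns
  obtain ⟨ms, hms, hlim⟩ := (exists_seq_tendstoInMeasure_atTop_iff
    (fun n => AEEqFun.aestronglyMeasurable (h n))).1 hk ns hns
  refine ⟨ms, hms, ?_⟩
  filter_upwards [hΘ.ae hlim, weightedComp_ae W hW Θ hΘ k,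
    ae_all_iff.2 fun n => weightedComp_ae W hW Θ hΘ (h n)] with x h1 h2 h3
  rw [h2]
  simp only [h3]
  exact h1.const_mul _

/-- The isometry `T` is given by the weight `W` and the point map `Θ`. -/
def IsWeightedComp {p : ℝ≥0∞} [Fact (1 ≤ p)] (T : IsomLp p) (W : ℝ → ℂ) (Θ : ℝ → ℝ) : Prop :=
  Measurable W ∧ Measure.QuasiMeasurePreserving Θ leb01 leb01 ∧
    ∀ f : LpI p, ∀ᵐ x ∂leb01, T f x = W x * f (Θ x)

theorem toL0_coe {p : ℝ≥0∞} (f : LpI p) : ((toL0 p f : L0) : ℝ → ℂ) = f := rfl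

theorem toL0_injective (p : ℝ≥0∞) : Function.Injective (toL0 p) := Subtype.val_injective

theorem IsWeightedComp.isContinuousExtension {p : ℝ≥0∞} [Fact (1 ≤ p)] {T : IsomLp p} {W : ℝ → ℂ}
    {Θ : ℝ → ℝ} (h : IsWeightedComp T W Θ) :
    IsContinuousExtension T (weightedComp W h.1 Θ h.2.1) := by
  refine ⟨fun f => ?_, weightedComp_tendstoInMeasure W h.1 Θ h.2.1⟩
  apply AEEqFun.ext
  filter_upwards [weightedComp_ae W h.1 Θ h.2.1 (toL0 p f), h.2.2 f] with x h1 h2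
  rw [h1, toL0_coe, toL0_coe, h2]

/-- Every element of `L₀` is the limit in measure of a sequence in `L_p`. -/
theorem exists_seq_toL0_tendstoInMeasure (p : ℝ≥0∞) (k : L0) :
    ∃ f : ℕ → LpI p, TendstoInMeasure leb01 (fun n x => toL0 p (f n) x) atTop (fun x => k x) := by
  have hk : StronglyMeasurable k := AEEqFun.stronglyMeasurable k
  have hset : ∀ n : ℕ, MeasurableSet {x | ‖k x‖ ≤ n} := fun n =>
    measurableSet_le hk.measurable.norm measurable_const
  have hmem : ∀ n : ℕ, MemLp (Set.indicator {x | ‖k x‖ ≤ n} k) p leb01 := fun n => by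
    refine MemLp.of_bound (hk.indicator (hset n)).aestronglyMeasurable n
      (Eventually.of_forall fun x => ?_)
    by_cases hx : x ∈ {x | ‖k x‖ ≤ n}
    · rw [Set.indicator_of_mem hx]; exact hx
    · rw [Set.indicator_of_notMem hx]; simp
  refine ⟨fun n => (hmem n).toLp _, tendstoInMeasure_of_tendsto_ae
    (fun n => AEEqFun.aestronglyMeasurable _) ?_⟩
  filter_upwards [ae_all_iff.2 fun n => (hmem n).coeFn_toLp] with x hx
  obtain ⟨N, hN⟩ := exists_nat_ge ‖k x‖
  refine tendsto_const_nhds.congr' ?_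
  filter_upwards [eventually_ge_atTop N] with n hn
  rw [toL0_coe, hx]
  refine (Set.indicator_of_mem (s := {x | ‖k x‖ ≤ (n : ℝ)}) ?_ _).symm
  exact hN.trans (by exact_mod_cast hn)

/-- Truncations show that `L_p` is sequentially dense in `L₀` for convergence in measure, and limits
in measure are unique. -/
theorem IsContinuousExtension.unique {p : ℝ≥0∞} [Fact (1 ≤ p)] {T : IsomLp p}
    {V V' : Module.End ℂ L0} (h : IsContinuousExtension T V) (h' : IsContinuousExtension T V') :
    V = V' := by
  ext1 k
  obtain ⟨f, hf⟩ := exists_seq_toL0_tendstoInMeasure p k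
  have h1 := h.2 _ _ hf
  have h2 := h'.2 _ _ hf
  simp only [h.1, h'.1] at h1 h2
  exact AEEqFun.ext (tendstoInMeasure_ae_unique h1 h2)

theorem IsContinuousExtension.one {p : ℝ≥0∞} [Fact (1 ≤ p)] :
    IsContinuousExtension (1 : IsomLp p) 1 :=
  ⟨fun _ => rfl, fun _ _ h => h⟩

theorem IsContinuousExtension.mul {p : ℝ≥0∞} [Fact (1 ≤ p)] {S T : IsomLp p}
    {V V' : Module.End ℂ L0} (h : IsContinuousExtension S V) (h' : IsContinuousExtension T V') :
    IsContinuousExtension (S * T) (V * V') :=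
  ⟨fun f => by
    change V (V' (toL0 p f)) = toL0 p (S (T f))
    rw [h'.1, h.1], fun _ _ hk => h.2 _ _ (h'.2 _ _ hk)⟩

theorem kaltonPeck_coe (p : ℝ≥0∞) (f : LpI p) :
    ∀ᵐ x ∂leb01, kaltonPeck p f x = f x * (Real.log (‖f x‖ / ‖f‖) : ℂ) :=
  AEEqFun.coeFn_mk _ _

/-- The commutator of a weighted composition isometry with the Kalton-Peck map. -/
theorem IsWeightedComp.commutator_ae {p : ℝ≥0∞} [Fact (1 ≤ p)] {T : IsomLp p} {W : ℝ → ℂ}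
    {Θ : ℝ → ℝ} (h : IsWeightedComp T W Θ) {V : Module.End ℂ L0} (hV : IsContinuousExtension T V)
    (f : LpI p) :
    ∀ᵐ x ∂leb01, (V (kaltonPeck p f) - kaltonPeck p (T f) : L0) x =
      -((Real.log ‖W x‖ : ℂ) * T f x) := by
  rw [hV.unique h.isContinuousExtension]
  have h0 : ∀ᵐ x ∂leb01, ‖f‖ = 0 → f x = 0 := by
    by_cases h : ‖f‖ = 0
    · have hf : f = 0 := norm_eq_zero.1 h
      subst hf
      filter_upwards [Lp.coeFn_zero ℂ p leb01] with x hx _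
      simpa using hx
    · exact Eventually.of_forall fun x hx => absurd hx h
  filter_upwards [AEEqFun.coeFn_sub (weightedComp W h.1 Θ h.2.1 (kaltonPeck p f))
      (kaltonPeck p (T f)), weightedComp_ae W h.1 Θ h.2.1 (kaltonPeck p f),
    kaltonPeck_coe p (T f), h.2.1.ae (kaltonPeck_coe p f), h.2.2 f, h.2.1.ae h0]
    with x a1 a2 a3 a4 a5 a6
  rw [a1, Pi.sub_apply, a2, a3, a4, a5, T.norm_map]
  -- The splitting of the logarithm needs all factors to be nonzero; where `W` or `f ∘ Θ` vanishes
  -- both sides are zero. Since `T` is isometric both terms carry the same normalization, so only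
  -- `log |W|` is left over.
  by_cases hW : W x = 0
  · simp [hW]
  by_cases hf : f (Θ x) = 0
  · simp [hf]
  have hn : ‖f‖ ≠ 0 := fun hn => hf (a6 hn)
  rw [norm_mul, mul_div_assoc, Real.log_mul (norm_ne_zero_iff.2 hW)
    (div_ne_zero (norm_ne_zero_iff.2 hf) hn)]
  push_cast
  ring

/-! ## Isometries of `L_p`, `p ≠ 2`, preserve disjointness -/

theorem one_lt_toReal {p : ℝ≥0∞} (hp₁ : 1 < p) (hp₂ : p ≠ ∞) : 1 < p.toReal := by
  rw [← ENNReal.toReal_one]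
  exact (ENNReal.toReal_lt_toReal (by simp) hp₂).2 hp₁

theorem Lp_norm_rpow {p : ℝ≥0∞} (hp₁ : 1 < p) (hp₂ : p ≠ ∞) (f : LpI p) :
    ‖f‖ ^ p.toReal = ∫ x, ‖f x‖ ^ p.toReal ∂leb01 := by
  have hp := one_lt_toReal hp₁ hp₂
  have h0 : 0 ≤ ∫ x, ‖f x‖ ^ p.toReal ∂leb01 := integral_nonneg fun x => by positivity
  rw [Lp.norm_def, (Lp.memLp f).eLpNorm_eq_integral_rpow_norm (by positivity) hp₂,
    ENNReal.toReal_ofReal (by positivity), Real.rpow_inv_rpow h0 (by positivity)]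

theorem Lp_integrable_rpow {p : ℝ≥0∞} (hp₁ : 1 < p) (hp₂ : p ≠ ∞) (f : LpI p) :
    Integrable (fun x => ‖f x‖ ^ p.toReal) leb01 :=
  (Lp.memLp f).integrable_norm_rpow (by positivity) hp₂

theorem rpow_add_rpow_lt {r a b : ℝ} (hr : 1 < r) (ha : 0 < a) (hb : 0 < b) :
    a ^ r + b ^ r < (a + b) ^ r := by
  have e : ∀ c : ℝ, 0 < c → c ^ r = c * c ^ (r - 1) := fun c hc => by
    rw [← Real.rpow_one_add' hc.le (by linarith)]; congr 1; ring
  rw [e a ha, e b hb, e (a + b) (by positivity), add_mul]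
  have h1 : a ^ (r - 1) < (a + b) ^ (r - 1) :=
    Real.rpow_lt_rpow ha.le (by linarith) (by linarith)
  have h2 : b ^ (r - 1) < (a + b) ^ (r - 1) :=
    Real.rpow_lt_rpow hb.le (by linarith) (by linarith)
  nlinarith

theorem rpow_add_lt {r a b : ℝ} (hr : 0 < r) (hr₁ : r < 1) (ha : 0 < a) (hb : 0 < b) :
    (a + b) ^ r < a ^ r + b ^ r := by
  have e : ∀ c : ℝ, 0 < c → c ^ r = c * c ^ (r - 1) := fun c hc => by
    rw [← Real.rpow_one_add' hc.le (by linarith)]; congr 1; ring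
  rw [e a ha, e b hb, e (a + b) (by positivity), add_mul]
  have h1 : (a + b) ^ (r - 1) < a ^ (r - 1) :=
    Real.rpow_lt_rpow_of_neg ha (by linarith) (by linarith)
  have h2 : (a + b) ^ (r - 1) < b ^ (r - 1) :=
    Real.rpow_lt_rpow_of_neg hb (by linarith) (by linarith)
  nlinarith

theorem norm_rpow_eq_sq_rpow (q : ℝ) (z : ℂ) : ‖z‖ ^ q = (‖z‖ ^ 2) ^ (q / 2) := by
  rw [← Real.rpow_natCast, ← Real.rpow_mul (norm_nonneg _)]
  congr 1
  push_cast
  ring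

/-- The defect of the parallelogram identity for the exponent `q`. -/
def parallelogramDefect (q : ℝ) (a b : ℂ) : ℝ :=
  ‖a + b‖ ^ q + ‖a - b‖ ^ q - 2 * (‖a‖ ^ q + ‖b‖ ^ q)

theorem parallelogramDefect_eq_zero {q : ℝ} (hq : 0 < q) {a b : ℂ} (h : a * b = 0) :
    parallelogramDefect q a b = 0 := by
  rcases mul_eq_zero.1 h with h | h <;>
    simp [parallelogramDefect, h, Real.zero_rpow hq.ne'] <;> ring

/-- Convexity of `t ↦ t ^ (q / 2)`, applied to the squares `|a + b|²` and `|a - b|²`, together with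
the parallelogram law, bounds the first two terms below by `2 (|a|² + |b|²) ^ (q / 2)`.
Superadditivity of the same power finishes, and it is strict when both numbers are nonzero. For `q <
2` concavity and subadditivity reverse every inequality. -/
theorem parallelogramDefect_of_two_lt {q : ℝ} (hq : 2 < q) (a b : ℂ) :
    0 ≤ parallelogramDefect q a b ∧ (a * b ≠ 0 → 0 < parallelogramDefect q a b) := by
  have hr : 1 < q / 2 := by linarith
  have hx : ‖a + b‖ ^ 2 ∈ Set.Ici (0 : ℝ) := Set.mem_Ici.2 (by positivity)
  have hy : ‖a - b‖ ^ 2 ∈ Set.Ici (0 : ℝ) := Set.mem_Ici.2 (by positivity)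
  have hc := (convexOn_rpow hr.le).2 hx hy (show (0 : ℝ) ≤ 1 / 2 by norm_num)
    (show (0 : ℝ) ≤ 1 / 2 by norm_num) (by norm_num)
  have hl := parallelogram_law_with_norm ℂ a b
  simp only [smul_eq_mul] at hc
  have e : 1 / 2 * ‖a + b‖ ^ 2 + 1 / 2 * ‖a - b‖ ^ 2 = ‖a‖ ^ 2 + ‖b‖ ^ 2 := by linarith
  rw [e] at hc
  simp only [parallelogramDefect, norm_rpow_eq_sq_rpow q]
  constructor
  · have := Real.add_rpow_le_rpow_add (sq_nonneg ‖a‖) (sq_nonneg ‖b‖) hr.le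
    linarith
  · intro hab
    have ha : a ≠ 0 := left_ne_zero_of_mul hab
    have hb : b ≠ 0 := right_ne_zero_of_mul hab
    have := rpow_add_rpow_lt hr (a := ‖a‖ ^ 2) (b := ‖b‖ ^ 2) (by positivity) (by positivity)
    linarith

theorem parallelogramDefect_of_lt_two {q : ℝ} (hq₀ : 0 < q) (hq : q < 2) (a b : ℂ) :
    parallelogramDefect q a b ≤ 0 ∧ (a * b ≠ 0 → parallelogramDefect q a b < 0) := by
  have hr : q / 2 < 1 := by linarith
  have hr₀ : 0 < q / 2 := by linarith
  have hx : ‖a + b‖ ^ 2 ∈ Set.Ici (0 : ℝ) := Set.mem_Ici.2 (by positivity)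
  have hy : ‖a - b‖ ^ 2 ∈ Set.Ici (0 : ℝ) := Set.mem_Ici.2 (by positivity)
  have hc := (Real.concaveOn_rpow hr₀.le hr.le).2 hx hy (show (0 : ℝ) ≤ 1 / 2 by norm_num)
    (show (0 : ℝ) ≤ 1 / 2 by norm_num) (by norm_num)
  have hl := parallelogram_law_with_norm ℂ a b
  simp only [smul_eq_mul] at hc
  have e : 1 / 2 * ‖a + b‖ ^ 2 + 1 / 2 * ‖a - b‖ ^ 2 = ‖a‖ ^ 2 + ‖b‖ ^ 2 := by linarith
  rw [e] at hc
  simp only [parallelogramDefect, norm_rpow_eq_sq_rpow q]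
  constructor
  · have := Real.rpow_add_le_add_rpow (sq_nonneg ‖a‖) (sq_nonneg ‖b‖) hr₀.le hr.le
    linarith
  · intro hab
    have ha : a ≠ 0 := left_ne_zero_of_mul hab
    have hb : b ≠ 0 := right_ne_zero_of_mul hab
    have := rpow_add_lt hr₀ hr (a := ‖a‖ ^ 2) (b := ‖b‖ ^ 2) (by positivity) (by positivity)
    linarith

theorem Lp_parallelogramDefect {p : ℝ≥0∞} [Fact (1 ≤ p)] (hp₁ : 1 < p) (hp₂ : p ≠ ∞)
    (f g : LpI p) :
    Integrable (fun x => parallelogramDefect p.toReal (f x) (g x)) leb01 ∧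
      ∫ x, parallelogramDefect p.toReal (f x) (g x) ∂leb01 =
        ‖f + g‖ ^ p.toReal + ‖f - g‖ ^ p.toReal - 2 * (‖f‖ ^ p.toReal + ‖g‖ ^ p.toReal) := by
  have ia : Integrable (fun x => ‖f x + g x‖ ^ p.toReal) leb01 := by
    refine (Lp_integrable_rpow hp₁ hp₂ (f + g)).congr ?_
    filter_upwards [Lp.coeFn_add f g] with x hx
    rw [hx, Pi.add_apply]
  have is : Integrable (fun x => ‖f x - g x‖ ^ p.toReal) leb01 := by
    refine (Lp_integrable_rpow hp₁ hp₂ (f - g)).congr ?_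
    filter_upwards [Lp.coeFn_sub f g] with x hx
    rw [hx, Pi.sub_apply]
  have i1 := Lp_integrable_rpow hp₁ hp₂ f
  have i2 := Lp_integrable_rpow hp₁ hp₂ g
  refine ⟨(ia.add is).sub ((i1.add i2).const_mul 2), ?_⟩
  have ea : ∫ x, ‖(f + g) x‖ ^ p.toReal ∂leb01 = ∫ x, ‖f x + g x‖ ^ p.toReal ∂leb01 := by
    apply integral_congr_ae
    filter_upwards [Lp.coeFn_add f g] with x hx
    rw [hx, Pi.add_apply]
  have es : ∫ x, ‖(f - g) x‖ ^ p.toReal ∂leb01 = ∫ x, ‖f x - g x‖ ^ p.toReal ∂leb01 := by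
    apply integral_congr_ae
    filter_upwards [Lp.coeFn_sub f g] with x hx
    rw [hx, Pi.sub_apply]
  rw [Lp_norm_rpow hp₁ hp₂, Lp_norm_rpow hp₁ hp₂, Lp_norm_rpow hp₁ hp₂, Lp_norm_rpow hp₁ hp₂,
    ea, es, ← integral_add ia is, ← integral_add i1 i2, ← integral_const_mul]
  exact integral_sub (ia.add is) ((i1.add i2).const_mul 2)

/-- The pointwise defect has a constant sign and vanishes only where one of the functions does, so
its integral is zero exactly for disjoint functions. Since that integral is an expression in norms,
isometries preserve disjointness. -/
theorem disjointLp_iff_defect {p : ℝ≥0∞} [Fact (1 ≤ p)] (hp₁ : 1 < p) (hp₂ : p ≠ ∞)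
    (h2 : p ≠ 2) (f g : LpI p) :
    DisjointLp f g ↔
      ‖f + g‖ ^ p.toReal + ‖f - g‖ ^ p.toReal - 2 * (‖f‖ ^ p.toReal + ‖g‖ ^ p.toReal) = 0 := by
  have hp := one_lt_toReal hp₁ hp₂
  obtain ⟨hi, he⟩ := Lp_parallelogramDefect hp₁ hp₂ f g
  rw [← he]
  constructor
  · intro h
    rw [integral_eq_zero_of_ae]
    filter_upwards [h] with x hx
    exact parallelogramDefect_eq_zero (by linarith) hx
  · intro h
    have h2' : p.toReal ≠ 2 := fun h => h2 (by
      rw [← ENNReal.ofReal_toReal hp₂, h]; simp)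
    rcases lt_or_gt_of_ne h2' with h2' | h2'
    · have hd := parallelogramDefect_of_lt_two (q := p.toReal) (by linarith) h2'
      have hz : ∫ x, -parallelogramDefect p.toReal (f x) (g x) ∂leb01 = 0 := by
        rw [integral_neg, h, neg_zero]
      rw [integral_eq_zero_iff_of_nonneg (fun x => neg_nonneg.2 (hd _ _).1) hi.neg] at hz
      filter_upwards [hz] with x hx
      by_contra hne
      have := (hd _ _).2 hne
      simp only [Pi.zero_apply] at hx
      linarith
    · have hd := parallelogramDefect_of_two_lt h2'
      rw [integral_eq_zero_iff_of_nonneg (fun x => (hd _ _).1) hi] at h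
      filter_upwards [h] with x hx
      by_contra hne
      exact ((hd _ _).2 hne).ne' hx

/-- For `p ≠ 2` all isometries of `L_p` preserve disjointness. -/
theorem disjointnessPreserving_eq_top {p : ℝ≥0∞} [Fact (1 ≤ p)] (hp₁ : 1 < p) (hp₂ : p ≠ ∞)
    (h2 : p ≠ 2) : disjointnessPreserving p = ⊤ := by
  refine eq_top_iff.2 fun T _ f g => ?_
  rw [disjointLp_iff_defect hp₁ hp₂ h2, disjointLp_iff_defect hp₁ hp₂ h2, ← map_add, ← map_sub,
    T.norm_map, T.norm_map, T.norm_map, T.norm_map]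

/-! ## Disjointness preserving isometries are weighted composition operators -/

/-- The indicator function of a measurable set, as an element of `L_p`. -/
abbrev indLp (p : ℝ≥0∞) {A : Set ℝ} (hA : MeasurableSet A) : LpI p :=
  indicatorConstLp p hA (measure_ne_top leb01 A) (1 : ℂ)

theorem indLp_ae (p : ℝ≥0∞) {A : Set ℝ} (hA : MeasurableSet A) :
    ∀ᵐ x ∂leb01, indLp p hA x = A.indicator (fun _ => (1 : ℂ)) x :=
  indicatorConstLp_coeFn

theorem indLp_add (p : ℝ≥0∞) {A B C : Set ℝ} (hA : MeasurableSet A) (hB : MeasurableSet B)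
    (hC : MeasurableSet C) (hd : Disjoint A B) (hu : ∀ᵐ x ∂leb01, x ∈ C ↔ x ∈ A ∪ B) :
    indLp p hC = indLp p hA + indLp p hB := by
  apply Lp.ext
  filter_upwards [indLp_ae p hA, indLp_ae p hB, indLp_ae p hC,
    Lp.coeFn_add (indLp p hA) (indLp p hB), hu] with x h1 h2 h3 h4 h5
  rw [h4, Pi.add_apply, h1, h2, h3]
  by_cases hxA : x ∈ A
  · have hxB : x ∉ B := Set.disjoint_left.1 hd hxA
    simp [hxA, hxB, h5]
  · by_cases hxB : x ∈ B <;> simp [hxA, hxB, h5]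

theorem indLp_disjoint (p : ℝ≥0∞) {A B : Set ℝ} (hA : MeasurableSet A) (hB : MeasurableSet B)
    (hd : Disjoint A B) : DisjointLp (indLp p hA) (indLp p hB) := by
  unfold DisjointLp
  filter_upwards [indLp_ae p hA, indLp_ae p hB] with x h1 h2
  rw [h1, h2]
  by_cases hxA : x ∈ A
  · have hxB : x ∉ B := Set.disjoint_left.1 hd hxA
    simp [hxB]
  · simp [hxA]

theorem indLp_eq_zero (p : ℝ≥0∞) {A : Set ℝ} (hA : MeasurableSet A) (h : leb01 A = 0) :
    indLp p hA = 0 := by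
  apply Lp.ext
  filter_upwards [indLp_ae p hA, Lp.coeFn_zero ℂ p leb01, measure_eq_zero_iff_ae_notMem.1 h]
    with x h1 h2 h3
  rw [h1, h2]
  simp [h3]

theorem exists_subseq_tendsto_ae {p : ℝ≥0∞} [Fact (1 ≤ p)] {f : ℕ → LpI p} {g : LpI p}
    (h : Tendsto f atTop (𝓝 g)) :
    ∃ ns : ℕ → ℕ, StrictMono ns ∧
      ∀ᵐ x ∂leb01, Tendsto (fun i => f (ns i) x) atTop (𝓝 (g x)) :=
  (tendstoInMeasure_of_tendsto_Lp h).exists_seq_tendsto_ae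

theorem tendsto_indLp {p : ℝ≥0∞} [Fact (1 ≤ p)] (hp₂ : p ≠ ∞)
    {A : ℕ → Set ℝ} (hA : ∀ n, MeasurableSet (A n)) {B : Set ℝ} (hB : MeasurableSet B)
    (h : Tendsto (fun n => leb01 (symmDiff (A n) B)) atTop (𝓝 0)) :
    Tendsto (fun n => indLp p (hA n)) atTop (𝓝 (indLp p hB)) :=
  tendsto_indicatorConstLp_set hp₂ h

theorem exists_subseq_map_tendsto_ae {p : ℝ≥0∞} [Fact (1 ≤ p)] (T : IsomLp p) {f : ℕ → LpI p}
    {g : LpI p} (h : Tendsto f atTop (𝓝 g)) :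
    ∃ ns : ℕ → ℕ, StrictMono ns ∧
      ∀ᵐ x ∂leb01, Tendsto (fun i => T (f (ns i)) x) atTop (𝓝 (T g x)) :=
  exists_subseq_tendsto_ae (f := fun n => T (f n)) ((T.continuous.tendsto g).comp h)

/-- If `A n → B` in measure, the images of the indicators converge a.e. along a subsequence. -/
theorem exists_subseq_map_indLp {p : ℝ≥0∞} [Fact (1 ≤ p)] (hp₂ : p ≠ ∞) (T : IsomLp p)
    {A : ℕ → Set ℝ} (hA : ∀ n, MeasurableSet (A n)) {B : Set ℝ} (hB : MeasurableSet B)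
    (h : Tendsto (fun n => leb01 (symmDiff (A n) B)) atTop (𝓝 0)) :
    ∃ ns : ℕ → ℕ, StrictMono ns ∧
      ∀ᵐ x ∂leb01, Tendsto (fun i => T (indLp p (hA (ns i))) x) atTop (𝓝 (T (indLp p hB) x)) :=
  exists_subseq_map_tendsto_ae (f := fun n => indLp p (hA n)) T (tendsto_indLp hp₂ hA hB h)

section Representation

variable {p : ℝ≥0∞} [Fact (1 ≤ p)] {T : IsomLp p}

/-- `T 1_B` is the sum of `T 1_A` and a function disjoint from it, so nothing can cancel on the
support of `T 1_A`. -/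
theorem map_indLp_mono (hT : T ∈ disjointnessPreserving p) {A B : Set ℝ} (hA : MeasurableSet A)
    (hB : MeasurableSet B) (hAB : A ⊆ B) :
    ∀ᵐ x ∂leb01, T (indLp p hA) x ≠ 0 → T (indLp p hB) x ≠ 0 := by
  have e := indLp_add p hA (hB.diff hA) hB Set.disjoint_sdiff_right
    (Eventually.of_forall fun x => by rw [Set.union_sdiff_cancel hAB])
  have hd := (hT _ _).2 (indLp_disjoint p hA (hB.diff hA) Set.disjoint_sdiff_right)
  rw [e, map_add]
  filter_upwards [Lp.coeFn_add (T (indLp p hA)) (T (indLp p (hB.diff hA))), hd] with x h1 h2 h3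
  rw [h1, Pi.add_apply]
  have := (mul_eq_zero.1 h2).resolve_left h3
  rwa [this, add_zero]

theorem map_indLp_union (hT : T ∈ disjointnessPreserving p) {A B C : Set ℝ} (hA : MeasurableSet A)
    (hB : MeasurableSet B) (hC : MeasurableSet C) (h : C = A ∪ B) :
    ∀ᵐ x ∂leb01, T (indLp p hC) x ≠ 0 → T (indLp p hA) x ≠ 0 ∨ T (indLp p hB) x ≠ 0 := by
  have e := indLp_add p hA (hB.diff hA) hC Set.disjoint_sdiff_right
    (Eventually.of_forall fun x => by rw [Set.union_sdiff_self, h])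
  rw [e, map_add]
  filter_upwards [Lp.coeFn_add (T (indLp p hA)) (T (indLp p (hB.diff hA))),
    map_indLp_mono hT (hB.diff hA) hB Set.sdiff_subset] with x h1 h2 h3
  rw [h1, Pi.add_apply] at h3
  by_cases h : T (indLp p hA) x = 0
  · rw [h, zero_add] at h3
    exact Or.inr (h2 h3)
  · exact Or.inl h

theorem map_indLp_compl (hT : T ∈ disjointnessPreserving p) {A : Set ℝ} (hA : MeasurableSet A) :
    ∀ᵐ x ∂leb01, T (indLp p hA) x * T (indLp p hA.compl) x = 0 ∧
      T (indLp p hA) x + T (indLp p hA.compl) x = T (indLp p MeasurableSet.univ) x := by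
  have e := indLp_add p hA hA.compl MeasurableSet.univ disjoint_compl_right
    (Eventually.of_forall fun x => by rw [Set.union_compl_self])
  have hd := (hT _ _).2 (indLp_disjoint p hA hA.compl disjoint_compl_right)
  rw [e, map_add]
  filter_upwards [Lp.coeFn_add (T (indLp p hA)) (T (indLp p hA.compl)), hd] with x h1 h2
  rw [h1, Pi.add_apply]
  exact ⟨h2, rfl⟩

/-- The images of `1_A` and of its complement are disjoint with sum `T 1`, so each is a restriction
of `T 1` to a set. The weight will therefore be `T 1`, and only the set remains to be identified. -/
theorem map_indLp_eq (hT : T ∈ disjointnessPreserving p) {A : Set ℝ} (hA : MeasurableSet A) :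
    ∀ᵐ x ∂leb01, T (indLp p hA) x = 0 ∨
      T (indLp p hA) x = T (indLp p MeasurableSet.univ) x := by
  filter_upwards [map_indLp_compl hT hA] with x hx
  rcases mul_eq_zero.1 hx.1 with h | h
  · exact Or.inl h
  · right
    rw [← hx.2, h, add_zero]

theorem indicatorConst_eq_smul (p : ℝ≥0∞) {A : Set ℝ} (hA : MeasurableSet A)
    (hμ : leb01 A ≠ ∞) (c : ℂ) : indicatorConstLp p hA hμ c = c • indLp p hA := by
  apply Lp.ext
  filter_upwards [indicatorConstLp_coeFn (p := p) (hs := hA) (hμs := hμ) (c := c),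
    indLp_ae p hA, Lp.coeFn_smul c (indLp p hA)] with x h1 h2 h3
  rw [h1, h3, Pi.smul_apply, h2]
  by_cases hx : x ∈ A <;> simp [hx]

/-- Two-step induction: a closed linear condition on `L_p` that holds for indicators. -/
theorem Lp_induction_indLp (hp₂ : p ≠ ∞) (P : LpI p → Prop)
    (hind : ∀ {A : Set ℝ} (hA : MeasurableSet A), P (indLp p hA))
    (hsmul : ∀ (c : ℂ) f, P f → P (c • f)) (hadd : ∀ f g, P f → P g → P (f + g))
    (hclosed : ∀ (f : ℕ → LpI p) (g : LpI p), Tendsto f atTop (𝓝 g) → (∀ n, P (f n)) → P g)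
    (f : LpI p) : P f := by
  refine Lp.induction hp₂ P (fun c A hA hμ => ?_) (fun f g hf hg _ h1 h2 => hadd _ _ h1 h2) ?_ f
  · rw [Lp.simpleFunc.coe_indicatorConst, indicatorConst_eq_smul]
    exact hsmul c _ (hind hA)
  · exact IsSeqClosed.isClosed fun u g hu hg => hclosed u g hg hu

/-- Wherever `T 1` vanishes so does every `T f`, by density of simple functions. Surjectivity then
excludes this: `f = T⁻¹ 1` has an image that vanishes nowhere. -/
theorem map_indLp_univ_ne_zero (hp₂ : p ≠ ∞) (hT : T ∈ disjointnessPreserving p) :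
    ∀ᵐ x ∂leb01, T (indLp p MeasurableSet.univ) x ≠ 0 := by
  have key : ∀ f : LpI p, ∀ᵐ x ∂leb01, T (indLp p MeasurableSet.univ) x = 0 → T f x = 0 := by
    intro f
    refine Lp_induction_indLp hp₂
      (fun f => ∀ᵐ x ∂leb01, T (indLp p MeasurableSet.univ) x = 0 → T f x = 0) ?_ ?_ ?_ ?_ f
    · intro A hA
      filter_upwards [map_indLp_eq hT hA] with x h1 h2
      rw [h2] at h1
      exact h1.elim id id
    · intro c f hf
      rw [map_smul]
      filter_upwards [hf, Lp.coeFn_smul c (T f)] with x h1 h2 h3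
      simp [h2, h1 h3]
    · intro f g hf hg
      rw [map_add]
      filter_upwards [hf, hg, Lp.coeFn_add (T f) (T g)] with x h1 h1' h2 h3
      rw [h2, Pi.add_apply, h1 h3, h1' h3, add_zero]
    · intro f g hfg hf
      obtain ⟨ns, -, h⟩ := exists_subseq_tendsto_ae ((T.continuous.tendsto _).comp hfg)
      filter_upwards [h, ae_all_iff.2 hf] with x h1 h2 h3
      refine tendsto_nhds_unique h1 (tendsto_const_nhds.congr fun i => ?_)
      exact (h2 _ h3).symm
  filter_upwards [key (T.symm (indLp p MeasurableSet.univ)), indLp_ae p MeasurableSet.univ]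
    with x h1 h2 h3
  have := h1 h3
  rw [T.apply_symm_apply, h2] at this
  simp at this

/-! ### The point map recovered from the images of half-lines -/

/-- The point map inducing a disjointness preserving isometry. -/
def pointMap (T : IsomLp p) (x : ℝ) : ℝ :=
  open Classical in
  -- A nonzero value of `T 1_{(-∞, q)}` at `x` should mean that the image of `x` is below `q`. The
  -- default `2` lies to the right of `(0, 1)` and does not affect comparisons with thresholds `c ≤
  -- 2`; rational `q` keep the exceptional sets countable in number.
  ⨅ q : ℚ, if 0 ≤ q ∧ T (indLp p (measurableSet_Iio (a := (q : ℝ)))) x ≠ 0 then (q : ℝ) else 2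

theorem pointMap_bddBelow (T : IsomLp p) (x : ℝ) : BddBelow (Set.range fun q : ℚ =>
    open Classical in
    if 0 ≤ q ∧ T (indLp p (measurableSet_Iio (a := (q : ℝ)))) x ≠ 0 then (q : ℝ) else 2) := by
  refine ⟨0, ?_⟩
  rintro _ ⟨q, rfl⟩
  dsimp only
  split_ifs with h
  · exact_mod_cast h.1
  · norm_num

theorem pointMap_nonneg (T : IsomLp p) (x : ℝ) : 0 ≤ pointMap T x := by
  refine le_ciInf fun q => ?_
  split_ifs with h
  · exact_mod_cast h.1
  · norm_num

theorem pointMap_le (T : IsomLp p) (x : ℝ) : pointMap T x ≤ 2 := by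
  refine (ciInf_le (pointMap_bddBelow T x) (-1)).trans ?_
  norm_num

theorem pointMap_lt_iff (T : IsomLp p) (x : ℝ) {c : ℝ} (hc : c ≤ 2) :
    pointMap T x < c ↔
      ∃ q : ℚ, 0 ≤ q ∧ (q : ℝ) < c ∧ T (indLp p (measurableSet_Iio (a := (q : ℝ)))) x ≠ 0 := by
  rw [pointMap, ciInf_lt_iff (pointMap_bddBelow T x)]
  refine exists_congr fun q => ?_
  split_ifs with h
  · exact ⟨fun hq => ⟨h.1, hq, h.2⟩, fun hq => hq.2.1⟩
  · exact ⟨fun hq => absurd hq (not_lt.2 hc), fun hq => absurd ⟨hq.1, hq.2.2⟩ h⟩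

theorem measurable_pointMap (T : IsomLp p) : Measurable (pointMap T) := by
  classical
  refine Measurable.iInf fun q => ?_
  refine Measurable.ite ?_ measurable_const measurable_const
  have hm : Measurable (T (indLp p (measurableSet_Iio (a := (q : ℝ))))) :=
    (Lp.stronglyMeasurable _).measurable
  exact (MeasurableSet.const _).inter (hm (measurableSet_singleton 0).compl)

/-- For `0 < c ≤ 2`, take rationals increasing to `c`: the images of their half-line indicators
converge almost everywhere along a subsequence, so a nonzero limit forces a nonzero term. The
converse is monotonicity of supports. The other `c` are trivial because the point map takes values
in `[0, 2]`. -/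
theorem pointMap_Iio (hp₂ : p ≠ ∞) (hT : T ∈ disjointnessPreserving p) (c : ℝ) :
    ∀ᵐ x ∂leb01, T (indLp p (measurableSet_Iio (a := c))) x ≠ 0 ↔ pointMap T x ∈ Set.Iio c := by
  rcases le_or_gt c 0 with hc | hc
  · have h0 : leb01 (Set.Iio c) = 0 := by
      rw [Measure.restrict_apply measurableSet_Iio]
      convert measure_empty (μ := (volume : Measure ℝ))
      ext x
      simp only [Set.mem_inter_iff, Set.mem_Iio, Set.mem_Ioo, Set.mem_empty_iff_false, iff_false]
      intro h
      linarith [h.1, h.2.1]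
    rw [indLp_eq_zero p _ h0, map_zero]
    filter_upwards [Lp.coeFn_zero ℂ p leb01] with x hx
    have := pointMap_nonneg T x
    simp only [hx, Pi.zero_apply, ne_eq, not_true_eq_false, Set.mem_Iio, false_iff]
    linarith
  rcases lt_or_ge 2 c with hc' | hc'
  · have e : indLp p (measurableSet_Iio (a := c)) = indLp p MeasurableSet.univ := by
      apply Lp.ext
      filter_upwards [indLp_ae p (measurableSet_Iio (a := c)), indLp_ae p MeasurableSet.univ,
        ae_restrict_mem measurableSet_Ioo] with x h1 h2 h3
      have : x ∈ Set.Iio c := by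
        have := h3.2
        simp only [Set.mem_Iio]; linarith
      rw [h1, h2]
      simp only [this, Set.indicator_of_mem, Set.mem_univ]
    rw [e]
    filter_upwards [map_indLp_univ_ne_zero hp₂ hT] with x hx
    have := pointMap_le T x
    simp only [ne_eq, hx, not_false_eq_true, Set.mem_Iio, true_iff]
    linarith
  obtain ⟨q, hq, hqc, hqlim⟩ := Real.exists_seq_rat_strictMono_tendsto c
  have hlim : Tendsto (fun n => leb01 (symmDiff (Set.Iio (q n : ℝ)) (Set.Iio c))) atTop (𝓝 0) := by
    have h1 : Tendsto (fun n => ENNReal.ofReal (c - q n)) atTop (𝓝 0) := by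
      have := (tendsto_const_nhds (x := c)).sub hqlim
      rw [sub_self] at this
      simpa using ENNReal.tendsto_ofReal this
    refine tendsto_of_tendsto_of_tendsto_of_le_of_le tendsto_const_nhds h1
      (fun _ => zero_le) fun n => ?_
    refine (Measure.restrict_apply_le _ _).trans ?_
    rw [← Real.volume_Ico]
    refine measure_mono ?_
    rintro x (⟨h1, h2⟩ | ⟨h1, h2⟩)
    · exact absurd (lt_trans h1 (hqc n)) h2
    · exact ⟨not_lt.1 h2, h1⟩
  obtain ⟨ns, hns, hns'⟩ := exists_subseq_map_indLp hp₂ T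
    (fun n => measurableSet_Iio (a := (q n : ℝ))) measurableSet_Iio hlim
  have hmono : ∀ᵐ x ∂leb01, ∀ r : ℚ, (r : ℝ) < c →
      T (indLp p (measurableSet_Iio (a := (r : ℝ)))) x ≠ 0 →
        T (indLp p (measurableSet_Iio (a := c))) x ≠ 0 := by
    rw [ae_all_iff]
    intro r
    by_cases hr : (r : ℝ) < c
    · filter_upwards [map_indLp_mono hT (measurableSet_Iio (a := (r : ℝ)))
        (measurableSet_Iio (a := c)) (Set.Iio_subset_Iio hr.le)] with x hx _
      exact hx
    · exact Eventually.of_forall fun x h => absurd h hr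
  filter_upwards [hns', hmono] with x h1 h2
  rw [Set.mem_Iio, pointMap_lt_iff T x hc']
  constructor
  · intro h
    have hev := h1.eventually_ne h
    have hpos : ∀ᶠ i in atTop, (0 : ℝ) < q (ns i) :=
      (hqlim.comp hns.tendsto_atTop).eventually (lt_mem_nhds hc)
    obtain ⟨i, hi, hi'⟩ := (hev.and hpos).exists
    exact ⟨q (ns i), by exact_mod_cast hi'.le, hqc _, hi⟩
  · rintro ⟨r, -, hr, hr'⟩
    exact h2 r hr hr'

/-- The sets satisfying the equivalence include the π-system of half-lines and are closed under
complements and disjoint countable unions. Complements use that `T 1` vanishes almost nowhere;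
unions use that the finite partial unions converge in measure to the whole. -/
theorem pointMap_spec (hp₂ : p ≠ ∞) (hT : T ∈ disjointnessPreserving p) {A : Set ℝ}
    (hA : MeasurableSet A) :
    ∀ᵐ x ∂leb01, T (indLp p hA) x ≠ 0 ↔ pointMap T x ∈ A := by
  induction A, hA using MeasurableSpace.induction_on_inter (borel_eq_generateFrom_Iio ℝ)
    isPiSystem_Iio with
  | empty =>
    rw [indLp_eq_zero p _ measure_empty, map_zero]
    filter_upwards [Lp.coeFn_zero ℂ p leb01] with x hx
    simpa using hx
  | basic t ht =>
    obtain ⟨c, rfl⟩ := ht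
    exact pointMap_Iio hp₂ hT c
  | compl t ht ih =>
    filter_upwards [ih, map_indLp_compl hT ht, map_indLp_univ_ne_zero hp₂ hT] with x h1 h2 h3
    rw [Set.mem_compl_iff, ← h1, not_not]
    constructor
    · intro h
      exact (mul_eq_zero.1 h2.1).resolve_right h
    · intro h
      rw [h, zero_add] at h2
      rw [h2.2]
      exact h3
  | iUnion f hd hf ih =>
    have hfin : ∀ n : ℕ, MeasurableSet (⋃ i < n, f i) := fun n =>
      MeasurableSet.biUnion (Set.to_countable _) fun i _ => hf i
    have hind : ∀ n : ℕ, ∀ᵐ x ∂leb01, T (indLp p (hfin n)) x ≠ 0 →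
        ∃ i, T (indLp p (hf i)) x ≠ 0 := by
      intro n
      induction n with
      | zero =>
        have : leb01 (⋃ i < 0, f i) = 0 := by simp
        rw [indLp_eq_zero p _ this, map_zero]
        filter_upwards [Lp.coeFn_zero ℂ p leb01] with x hx h
        exact absurd hx h
      | succ n ihn =>
        filter_upwards [ihn, map_indLp_union hT (hfin n) (hf n) (hfin (n + 1))
          (Set.biUnion_lt_succ f n)] with x h1 h2 h3
        exact (h2 h3).elim h1 fun h => ⟨n, h⟩
    have hlim : Tendsto (fun n => leb01 (symmDiff (⋃ i < n, f i) (⋃ i, f i))) atTop (𝓝 0) := by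
      have h1 := tendsto_measure_biUnion_Ici_zero_of_pairwise_disjoint (μ := leb01)
        (fun i => (hf i).nullMeasurableSet) hd
      refine tendsto_of_tendsto_of_tendsto_of_le_of_le tendsto_const_nhds h1
        (fun _ => zero_le) fun n => measure_mono ?_
      rintro x (⟨h1, h2⟩ | ⟨h1, h2⟩)
      · simp only [Set.mem_iUnion] at h1 h2
        obtain ⟨i, -, hi⟩ := h1
        exact absurd ⟨i, hi⟩ h2
      · simp only [Set.mem_iUnion] at h1 h2 ⊢
        obtain ⟨i, hi⟩ := h1
        refine ⟨i, ?_, hi⟩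
        by_contra hlt
        exact h2 ⟨i, not_le.1 hlt, hi⟩
    obtain ⟨ns, hns, hns'⟩ := exists_subseq_map_indLp hp₂ T hfin (MeasurableSet.iUnion hf) hlim
    filter_upwards [ae_all_iff.2 ih, ae_all_iff.2 hind, hns', ae_all_iff.2 fun i =>
      map_indLp_mono hT (hf i) (MeasurableSet.iUnion hf) (Set.subset_iUnion f i)]
      with x h1 h2 h3 h4
    rw [Set.mem_iUnion]
    constructor
    · intro h
      obtain ⟨i, hi⟩ := (h3.eventually_ne h).exists
      obtain ⟨j, hj⟩ := h2 _ hi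
      exact ⟨j, (h1 j).1 hj⟩
    · rintro ⟨i, hi⟩
      exact h4 i ((h1 i).2 hi)

/-- If `A` is null then `T 1_A = 0`, so the preimage of `A`, which is the support of `T 1_A`, is
null. -/
theorem pointMap_quasiMeasurePreserving (hp₂ : p ≠ ∞) (hT : T ∈ disjointnessPreserving p) :
    Measure.QuasiMeasurePreserving (pointMap T) leb01 leb01 := by
  refine ⟨measurable_pointMap T, Measure.AbsolutelyContinuous.mk fun A hA h0 => ?_⟩
  rw [Measure.map_apply (measurable_pointMap T) hA, measure_eq_zero_iff_ae_notMem]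
  have h := pointMap_spec hp₂ hT hA
  rw [indLp_eq_zero p hA h0, map_zero] at h
  filter_upwards [h, Lp.coeFn_zero ℂ p leb01] with x h1 h2 h3
  exact h1.2 h3 h2

/-- Disjointness preserving isometries are weighted composition operators. -/
theorem isWeightedComp_of_disjointnessPreserving (hp₂ : p ≠ ∞)
    (hT : T ∈ disjointnessPreserving p) :
    IsWeightedComp T (T (indLp p MeasurableSet.univ)) (pointMap T) := by
  have hq := pointMap_quasiMeasurePreserving hp₂ hT
  refine ⟨(Lp.stronglyMeasurable _).measurable, hq, fun f => ?_⟩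
  refine Lp_induction_indLp hp₂ (fun f => ∀ᵐ x ∂leb01,
    T f x = T (indLp p MeasurableSet.univ) x * f (pointMap T x)) ?_ ?_ ?_ ?_ f
  · intro A hA
    filter_upwards [pointMap_spec hp₂ hT hA, map_indLp_eq hT hA, hq.ae (indLp_ae p hA)]
      with x h1 h2 h3
    rw [h3]
    by_cases hx : pointMap T x ∈ A
    · rw [Set.indicator_of_mem hx, mul_one]
      exact h2.resolve_left (h1.2 hx)
    · rw [Set.indicator_of_notMem hx, mul_zero]
      by_contra h
      exact hx (h1.1 h)
  · intro c f hf
    rw [map_smul]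
    filter_upwards [hf, Lp.coeFn_smul c (T f), hq.ae (Lp.coeFn_smul c f)] with x h1 h2 h3
    rw [h2, h3, Pi.smul_apply, Pi.smul_apply, h1, smul_eq_mul, smul_eq_mul]
    ring
  · intro f g hf hg
    rw [map_add]
    filter_upwards [hf, hg, Lp.coeFn_add (T f) (T g), hq.ae (Lp.coeFn_add f g)]
      with x h1 h1' h2 h3
    rw [h2, h3, Pi.add_apply, Pi.add_apply, h1, h1']
    ring
  · intro f g hfg hf
    obtain ⟨ns, hns, h1⟩ := exists_subseq_tendsto_ae hfg
    obtain ⟨ms, hms, h2⟩ := exists_subseq_tendsto_ae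
      ((T.continuous.tendsto _).comp (hfg.comp hns.tendsto_atTop))
    filter_upwards [hq.ae h1, h2, ae_all_iff.2 hf] with x a1 a2 a3
    refine tendsto_nhds_unique a2 ?_
    refine (((a1.comp hms.tendsto_atTop).const_mul _).congr fun i => ?_)
    exact (a3 _).symm

end Representation

/-! ## The extended action and its derivation -/

theorem twistedNorm_eq {X Y E : Type*} [NormedAddCommGroup X] [NormedSpace ℂ X]
    [NormedAddCommGroup Y] [AddCommGroup E] [Module ℂ E] {ι : X →ₗ[ℂ] E}
    (hι : Function.Injective ι) (Ω : Y → E) {z : E × Y} {x : X}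
    (hx : ι x = z.1 - Ω z.2) : twistedNorm ι Ω z = ‖x‖ + ‖z.2‖ := by
  have : {r : ℝ | ∃ x : X, ι x = z.1 - Ω z.2 ∧ r = ‖x‖} = {‖x‖} := by
    ext r
    constructor
    · rintro ⟨x', hx', rfl⟩
      rw [hι (hx'.trans hx.symm)]
      rfl
    · rintro rfl
      exact ⟨x, hx, rfl⟩
  rw [twistedNorm, this, csInf_singleton]

section Abstract

variable {G : Type*} [Monoid G]
  {X : Type*} [NormedAddCommGroup X] [NormedSpace ℂ X]
  {Y : Type*} [NormedAddCommGroup Y] [NormedSpace ℂ Y]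
  {E : Type*} [AddCommGroup E] [Module ℂ E] {ι : X →ₗ[ℂ] E}

theorem NormLE.add {e e' : E} {r r' : ℝ} (h : NormLE ι e r) (h' : NormLE ι e' r') :
    NormLE ι (e + e') (r + r') := by
  obtain ⟨x, rfl, hx⟩ := h
  obtain ⟨x', rfl, hx'⟩ := h'
  exact ⟨x + x', map_add _ _ _, (norm_add_le _ _).trans (add_le_add hx hx')⟩

theorem NormLE.smul {e : E} {r : ℝ} (c : ℂ) (h : NormLE ι e r) :
    NormLE ι (c • e) (‖c‖ * r) := by
  obtain ⟨x, rfl, hx⟩ := h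
  exact ⟨c • x, map_smul _ _ _, by rw [norm_smul]; gcongr⟩

theorem NormLE.neg {e : E} {r : ℝ} (h : NormLE ι e r) : NormLE ι (-e) r := by
  obtain ⟨x, rfl, hx⟩ := h
  exact ⟨-x, map_neg _ _, by rwa [norm_neg]⟩

theorem NormLE.sub {e e' : E} {r r' : ℝ} (h : NormLE ι e r) (h' : NormLE ι e' r') :
    NormLE ι (e - e') (r + r') := by
  rw [sub_eq_add_neg]
  exact h.add h'.neg

theorem NormLE.mono {e : E} {r r' : ℝ} (h : NormLE ι e r) (hr : r ≤ r') : NormLE ι e r' := by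
  obtain ⟨x, hx, hx'⟩ := h
  exact ⟨x, hx, hx'.trans hr⟩

/-- Linear maps equal to minus the commutators form a derivation. -/
theorem isActionDerivation_of_eq_neg_commutator {U : G →* Module.End ℂ E}
    {v : G →* Module.End ℂ Y} {Ω : Y → E} {d : G → (Y →ₗ[ℂ] E)}
    (h : ∀ g y, d g y = -actionCommutator U v Ω g y) : IsActionDerivation U v d := by
  intro g g'
  ext1 y
  simp only [LinearMap.add_apply, LinearMap.comp_apply, h, actionCommutator, map_mul, map_neg,
    map_sub, Module.End.mul_apply]
  abel

theorem isCompatibleVia_of_eq_neg_commutator {U : G →* Module.End ℂ E}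
    {v : G →* Module.End ℂ Y} {Ω : Y → E} (hΩ : IsQuasiLinear ι Ω) {d : G → (Y →ₗ[ℂ] E)}
    (h : ∀ g y, d g y = -actionCommutator U v Ω g y) : IsCompatibleVia ι U v Ω d := by
  refine ⟨hΩ, isActionDerivation_of_eq_neg_commutator h, 0, fun g y => ⟨0, ?_, by simp⟩⟩
  rw [h]
  simp

theorem IsActionDerivation.smul {U : G →* Module.End ℂ E} {v : G →* Module.End ℂ Y}
    {d : G → (Y →ₗ[ℂ] E)} (h : IsActionDerivation U v d) (c : ℂ) :
    IsActionDerivation U v (fun g => c • d g) := by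
  intro g g'
  ext1 y
  simp [h g g']

/-- The action is compatible with the bounded perturbations of the multiples of a
quasi-linear map whose commutators are linear. -/
theorem isCompatible_of_bounded_perturbation {U : G →* Module.End ℂ E}
    {v : G →* Module.End ℂ Y} {u : G → X → X} (hu : ∀ g x, U g (ι x) = ι (u g x))
    (hun : ∀ g x, ‖u g x‖ ≤ ‖x‖) (hv : ∀ g y, ‖v g y‖ ≤ ‖y‖)
    {Ω Ω' : Y → E} (hΩ : IsQuasiLinear ι Ω) {d : G → (Y →ₗ[ℂ] E)}
    (hd : ∀ g y, d g y = -actionCommutator U v Ω g y)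
    (hΩ' : ∀ (c : ℂ) (y : Y), Ω' (c • y) = c • Ω' y) (c : ℂ) {K : ℝ} (hK : 0 ≤ K)
    (hb : ∀ y, NormLE ι (Ω' y - c • Ω y) (K * ‖y‖)) : IsCompatible ι U v Ω' := by
  -- The multiple `c • d` cancels the commutator with `c • Ω` exactly. What remains is the
  -- commutator with the bounded map `Ω' - c • Ω`, which costs its bound `K` twice.
  refine ⟨fun g => c • d g, ⟨hΩ', ?_⟩,
    (isActionDerivation_of_eq_neg_commutator hd).smul c, 2 * K, fun g y => ?_⟩
  · obtain ⟨C, hC⟩ := hΩ.2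
    refine ⟨‖c‖ * C + 2 * K, fun y y' => ?_⟩
    have h := ((((hC y y').smul c).add (hb (y + y'))).sub (hb y)).sub (hb y')
    convert h.mono (r' := (‖c‖ * C + 2 * K) * (‖y‖ + ‖y'‖)) ?_ using 1
    · simp only [smul_sub]; abel
    · nlinarith [norm_add_le y y']
  · have h1 : NormLE ι (U g (Ω' y - c • Ω y)) (K * ‖y‖) := by
      obtain ⟨x, hx, hx'⟩ := hb y
      exact ⟨u g x, by rw [← hx, hu], (hun g x).trans hx'⟩
    have h := h1.sub (hb (v g y))
    convert h.mono (r' := 2 * K * ‖y‖) ?_ using 1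
    · simp only [LinearMap.smul_apply, hd, actionCommutator, map_sub, map_smul, smul_neg, smul_sub]
      abel
    · nlinarith [hv g y]

/-- The triangular action on a twisted sum defined by a derivation. -/
theorem exists_triangularAction {U : G →* Module.End ℂ E} {v : G →* Module.End ℂ Y}
    {u : G → X → X} (hι : Function.Injective ι) (hu : ∀ g x, U g (ι x) = ι (u g x))
    (hun : ∀ g x, ‖u g x‖ ≤ ‖x‖) (hv : ∀ g y, ‖v g y‖ ≤ ‖y‖)
    {Ω : Y → E} (hΩ : IsQuasiLinear ι Ω) {d : G → (Y →ₗ[ℂ] E)}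
    (hd : ∀ g y, d g y = -actionCommutator U v Ω g y) :
    ∃ Λ : G →* Module.End ℂ (twistedSum ι Ω hΩ),
      (∀ (g : G) (z : twistedSum ι Ω hΩ),
        (Λ g z : E × Y) = (U g (z : E × Y).1 + d g (z : E × Y).2, v g (z : E × Y).2)) ∧
      ∀ (g : G) (z : twistedSum ι Ω hΩ),
        twistedNorm ι Ω (Λ g z : E × Y) ≤ 1 * twistedNorm ι Ω (z : E × Y) := by
  have hder := isActionDerivation_of_eq_neg_commutator hd
  -- The triangular operator acts on the coordinate `e - Ω y` simply as `U g`, because `d` is minus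
  -- the commutator. Hence invariance of the twisted sum and the estimate of its quasi-norm both
  -- reduce to facts about `U` and `v`.
  have key : ∀ (g : G) (e : E) (y : Y), U g e + d g y - Ω (v g y) = U g (e - Ω y) := by
    intro g e y
    rw [hd, actionCommutator, map_sub]
    abel
  let M : G → E × Y →ₗ[ℂ] E × Y := fun g =>
    (((U g).comp (LinearMap.fst ℂ E Y)) + (d g).comp (LinearMap.snd ℂ E Y)).prod
      ((v g).comp (LinearMap.snd ℂ E Y))
  have hM : ∀ (g : G) (z : E × Y), M g z = (U g z.1 + d g z.2, v g z.2) := fun g z => rfl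
  have hmem : ∀ (g : G), ∀ z ∈ twistedSum ι Ω hΩ, M g z ∈ twistedSum ι Ω hΩ := by
    intro g z hz
    obtain ⟨x, hx⟩ := (show z.1 - Ω z.2 ∈ LinearMap.range ι from hz)
    refine ⟨u g x, ?_⟩
    rw [hM, key, ← hx, hu]
  have hd1 : d 1 = 0 := by
    have := hder 1 1
    rw [mul_one, map_one, map_one] at this
    ext1 y
    have h := LinearMap.congr_fun this y
    simpa using h
  refine ⟨⟨⟨fun g => (M g).restrict (hmem g), ?_⟩, ?_⟩, fun g z => rfl, fun g z => ?_⟩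
  · ext1 z
    apply Subtype.ext
    change M 1 z = z
    rw [hM, hd1]
    simp
  · intro g g'
    ext1 z
    apply Subtype.ext
    change M (g * g') z = M g (M g' z)
    simp only [hM, hder g g', map_mul, LinearMap.add_apply, LinearMap.comp_apply, map_add,
      Module.End.mul_apply, Prod.mk.injEq, and_true]
    abel
  · obtain ⟨x, hx⟩ := (show (z : E × Y).1 - Ω (z : E × Y).2 ∈ LinearMap.range ι from z.2)
    change twistedNorm ι Ω (M g z) ≤ _
    have h : ι (u g x) = (M g z).1 - Ω (M g z).2 := by
      rw [hM, key, ← hx, hu]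
    rw [twistedNorm_eq hι Ω hx, twistedNorm_eq hι Ω h, one_mul]
    exact add_le_add (hun g x) (hv g _)

end Abstract

/-- Multiplication by a measurable function, from `L_p` to `L₀`. -/
def mulToL0 (p : ℝ≥0∞) (a : ℝ → ℂ) (ha : Measurable a) : LpI p →ₗ[ℂ] L0 :=
  (weightedComp a ha id (Measure.QuasiMeasurePreserving.id leb01)).comp (toL0 p)

theorem mulToL0_ae {p : ℝ≥0∞} (a : ℝ → ℂ) (ha : Measurable a) (f : LpI p) :
    ∀ᵐ x ∂leb01, mulToL0 p a ha f x = a x * f x :=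
  weightedComp_ae a ha id (Measure.QuasiMeasurePreserving.id leb01) (toL0 p f)

section Action

variable {p : ℝ≥0∞} [Fact (1 ≤ p)]

/-- The continuous extensions to `L₀` of the disjointness preserving isometries form an action. -/
theorem exists_extendedAction (hp₂ : p ≠ ∞) {G : Subgroup (IsomLp p)}
    (hG : G ≤ disjointnessPreserving p) :
    ∃ U : G →* Module.End ℂ L0, ∀ g : G, IsContinuousExtension (g : IsomLp p) (U g) := by
  have h : ∀ g : G, ∃ V : Module.End ℂ L0, IsContinuousExtension (g : IsomLp p) V := fun g =>
    ⟨_, (isWeightedComp_of_disjointnessPreserving hp₂ (hG g.2)).isContinuousExtension⟩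
  choose V hV using h
  -- The extensions are chosen one isometry at a time; uniqueness of continuous extensions makes the
  -- choice multiplicative.
  exact ⟨⟨⟨V, (hV 1).unique .one⟩, fun g g' => (hV (g * g')).unique ((hV g).mul (hV g'))⟩, hV⟩

/-- The commutators with the Kalton-Peck map are linear. -/
theorem exists_derivation (hp₂ : p ≠ ∞) {G : Subgroup (IsomLp p)}
    (hG : G ≤ disjointnessPreserving p) (U : G →* Module.End ℂ L0)
    (hU : ∀ g : G, IsContinuousExtension (g : IsomLp p) (U g)) :
    ∃ d : G → (LpI p →ₗ[ℂ] L0), ∀ (g : G) (f : LpI p),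
      d g f = -actionCommutator U (naturalAction G) (kaltonPeck p) g f := by
  have h : ∀ g : G, ∃ d : LpI p →ₗ[ℂ] L0, ∀ f : LpI p,
      d f = -actionCommutator U (naturalAction G) (kaltonPeck p) g f := by
    intro g
    have hg := isWeightedComp_of_disjointnessPreserving hp₂ (hG g.2)
    have hm := hg.1
    set W := (g : IsomLp p) (indLp p MeasurableSet.univ)
    have ha : Measurable fun x => (Real.log ‖W x‖ : ℂ) :=
      Complex.measurable_ofReal.comp (Real.measurable_log.comp hm.norm)
    -- The explicit derivation is `d g f = log |W| · g f` with `W = g 1`.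
    refine ⟨(mulToL0 p _ ha).comp (naturalAction G g), fun f => ?_⟩
    apply AEEqFun.ext
    filter_upwards [mulToL0_ae _ ha ((g : IsomLp p) f), hg.commutator_ae (hU g) f,
      AEEqFun.coeFn_neg (U g (kaltonPeck p f) - kaltonPeck p ((g : IsomLp p) f))] with x h1 h2 h3
    change mulToL0 p _ ha ((g : IsomLp p) f) x =
      (-(U g (kaltonPeck p f) - kaltonPeck p ((g : IsomLp p) f)) : L0) x
    rw [h1, h3, Pi.neg_apply, h2, neg_neg]
  choose d hd using h
  exact ⟨d, hd⟩

end Action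

/-! ## The differential of the scale of Lebesgue spaces -/

/-- Three lines theorem combined with the Cauchy estimate. -/
theorem norm_deriv_le_of_strip {Φ : ℂ → ℂ} {θ a R : ℝ} (hθ : 0 < θ) (hθ₁ : θ < 1) (ha : 0 < a)
    (hR : 0 < R) (hc : ContinuousOn Φ closedStrip) (hd : DifferentiableOn ℂ Φ openStrip)
    (hb : ∃ M, ∀ z ∈ closedStrip, ‖Φ z‖ ≤ M)
    (h0 : ∀ t : ℝ, ‖Φ (t * Complex.I)‖ ≤ R * a) (h1 : ∀ t : ℝ, ‖Φ (1 + t * Complex.I)‖ ≤ R)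
    (hz : Φ θ = 0) :
    ‖deriv Φ θ‖ ≤ R / (min θ (1 - θ) / 2) * a ^ (1 - θ) := by
  open Complex.HadamardThreeLines in
  have hstrip : openStrip = verticalStrip 0 1 := by
    ext z; simp [openStrip, verticalStrip]
  have hcstrip : closedStrip = verticalClosedStrip 0 1 := by
    ext z; simp [closedStrip, verticalClosedStrip]
  have hopen : IsOpen openStrip := by
    rw [hstrip, verticalStrip]
    exact isOpen_Ioo.preimage Complex.continuous_re
  have hcl : closure (verticalStrip 0 1) = closedStrip := by
    rw [hcstrip, verticalStrip, verticalClosedStrip, Complex.closure_preimage_re,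
      closure_Ioo zero_ne_one]
  have hdc : DiffContOnCl ℂ Φ (verticalStrip 0 1) := by
    refine ⟨hstrip ▸ hd, ?_⟩
    rw [hcl]; exact hc
  -- The boundary constants `R a` and `R` interpolate to `(R a) ^ (1 - Re z) R ^ (Re z)`, in which
  -- the powers of `R` recombine.
  have three : ∀ z ∈ openStrip, ‖Φ z‖ ≤ R * a ^ (1 - z.re) := by
    intro z hz
    have h := norm_le_interp_of_mem_verticalClosedStrip₀₁' Φ (z := z) (a := R * a) (b := R)
      ⟨hz.1.le, hz.2.le⟩ hdc ?_ ?_ ?_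
    · refine h.trans (le_of_eq ?_)
      rw [Real.mul_rpow hR.le ha.le, mul_right_comm, ← Real.rpow_add hR]
      simp
    · obtain ⟨M, hM⟩ := hb
      refine ⟨M, ?_⟩
      rintro _ ⟨w, hw, rfl⟩
      exact hM w (hcstrip ▸ hw)
    · intro w hw
      have : w = (w.im : ℂ) * Complex.I := by
        apply Complex.ext <;> simp [show w.re = 0 from hw]
      rw [this]; exact h0 _
    · intro w hw
      have : w = 1 + (w.im : ℂ) * Complex.I := by
        apply Complex.ext <;> simp [show w.re = 1 from hw]
      rw [this]; exact h1 _
  -- Half the distance from `θ` to the boundary, so that the closed disc of the Cauchy estimate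
  -- stays inside the open strip.
  set ρ := min θ (1 - θ) / 2 with hρ
  have hm : 0 < min θ (1 - θ) := lt_min hθ (by linarith)
  have hρ0 : 0 < ρ := by positivity
  have hball : ∀ z ∈ Metric.closedBall (θ : ℂ) ρ, z ∈ openStrip := by
    intro z hz
    rw [Metric.mem_closedBall, dist_eq_norm] at hz
    have h2 := (Complex.abs_re_le_norm (z - θ)).trans hz
    rw [Complex.sub_re, Complex.ofReal_re, abs_le] at h2
    have h3 := min_le_left θ (1 - θ)
    have h4 := min_le_right θ (1 - θ)
    exact ⟨by linarith [h2.1], by linarith [h2.2]⟩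
  have hA : (a : ℂ) ≠ 0 := by exact_mod_cast ha.ne'
  have hθs : (θ : ℂ) ∈ openStrip := by simp [openStrip, hθ, hθ₁]
  have hE : Differentiable ℂ fun z : ℂ => (a : ℂ) ^ (z - 1) := by
    intro z
    exact (differentiableAt_id.sub_const 1).const_cpow (Or.inl hA)
  -- The factor `a ^ (z - 1)` has modulus inverse to the three lines bound, so the product is
  -- bounded by `R` on the whole disc and the Cauchy estimate loses no power of `a`.
  have hΨd : DifferentiableOn ℂ (fun z => Φ z * (a : ℂ) ^ (z - 1)) openStrip :=
    hd.mul hE.differentiableOn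
  have hΨ : ‖deriv (fun z => Φ z * (a : ℂ) ^ (z - 1)) θ‖ ≤ R / ρ := by
    refine Complex.norm_deriv_le_of_forall_mem_sphere_norm_le hρ0 ?_ ?_
    · refine DifferentiableOn.diffContOnCl ?_
      rw [closure_ball _ hρ0.ne']
      exact hΨd.mono hball
    · intro z hz
      have hzs := hball z (Metric.sphere_subset_closedBall hz)
      rw [norm_mul, Complex.norm_cpow_eq_rpow_re_of_pos ha]
      calc ‖Φ z‖ * a ^ (z - 1).re ≤ R * a ^ (1 - z.re) * a ^ (z - 1).re := by
            gcongr
            exact three z hzs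
        _ = R := by
            rw [mul_assoc, ← Real.rpow_add ha]
            simp
  have hderiv : deriv (fun z => Φ z * (a : ℂ) ^ (z - 1)) θ =
      deriv Φ θ * (a : ℂ) ^ ((θ : ℂ) - 1) := by
    have hf := (hd.differentiableAt (hopen.mem_nhds hθs)).hasDerivAt
    have := (hf.mul (hE θ).hasDerivAt).deriv
    -- The hypothesis `Φ θ = 0` removes the term of the product rule in which the power is
    -- differentiated.
    rw [hz, zero_mul, add_zero] at this
    exact this
  rw [hderiv, norm_mul, Complex.norm_cpow_eq_rpow_re_of_pos ha] at hΨ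
  have hre : ((θ : ℂ) - 1).re = θ - 1 := by simp
  rw [hre] at hΨ
  calc ‖deriv Φ θ‖ = ‖deriv Φ θ‖ * a ^ (θ - 1) * a ^ (1 - θ) := by
        rw [mul_assoc, ← Real.rpow_add ha]; simp
    _ ≤ R / ρ * a ^ (1 - θ) := by gcongr

/-! ### The extremal functions -/

/-- The extremal function `z ↦ a (|a| / N) ^ (q z - 1)`. -/
def extremal (q N : ℝ) (a z : ℂ) : ℂ :=
  a * Complex.exp ((q * z - 1) * (Real.log (‖a‖ / N) : ℂ))

theorem norm_extremal {q N : ℝ} (hN : 0 < N) {a : ℂ} (ha : a ≠ 0) (z : ℂ) :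
    ‖extremal q N a z‖ = N * (‖a‖ / N) ^ (q * z.re) := by
  have hu : 0 < ‖a‖ / N := by have := norm_pos_iff.2 ha; positivity
  have hre : ((q * z - 1) * (Real.log (‖a‖ / N) : ℂ)).re =
      Real.log (‖a‖ / N) * (q * z.re - 1) := by
    simp [mul_comm]
  rw [extremal, norm_mul, Complex.norm_exp, hre, ← Real.rpow_def_of_pos hu,
    Real.rpow_sub_one hu.ne']
  field_simp

theorem extremal_theta {q : ℝ} (hq : q ≠ 0) (N : ℝ) (a : ℂ) :
    extremal q N a ((1 / q : ℝ) : ℂ) = a := by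
  have : (q : ℂ) ≠ 0 := by exact_mod_cast hq
  simp [extremal, this]

/-- Supplies a majorant independent of the point of the strip: all exponents `q Re z` lie between
`0` and `q`. -/
theorem rpow_le_one_add {u s t : ℝ} (hu : 0 < u) (hs : 0 ≤ s) (hst : s ≤ t) :
    u ^ s ≤ 1 + u ^ t := by
  rcases le_total u 1 with h | h
  · have := Real.rpow_le_one hu.le h hs
    have := Real.rpow_nonneg hu.le t
    linarith
  · have := Real.rpow_le_rpow_of_exponent_le h hst
    linarith

theorem norm_extremal_le {q N : ℝ} (hq : 0 < q) (hN : 0 < N) (a : ℂ) {z : ℂ}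
    (hz : z ∈ closedStrip) : ‖extremal q N a z‖ ≤ N * (1 + (‖a‖ / N) ^ q) := by
  by_cases ha : a = 0
  · simp [extremal, ha]; positivity
  have hu : 0 < ‖a‖ / N := by have := norm_pos_iff.2 ha; positivity
  rw [norm_extremal hN ha]
  have := rpow_le_one_add hu (mul_nonneg hq.le hz.1) (t := q) (by nlinarith [hz.2])
  gcongr

theorem norm_extremal_zero_le {q N : ℝ} (hN : 0 < N) (a : ℂ) (t : ℝ) :
    ‖extremal q N a (t * Complex.I)‖ ≤ N := by
  by_cases ha : a = 0
  · simp [extremal, ha, hN.le]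
  rw [norm_extremal hN ha]
  simp

theorem norm_extremal_one {q N : ℝ} (hq : 0 < q) (hN : 0 < N) (a : ℂ) (t : ℝ) :
    ‖extremal q N a (1 + t * Complex.I)‖ = N * (‖a‖ / N) ^ q := by
  by_cases ha : a = 0
  · simp [extremal, ha, Real.zero_rpow hq.ne']
  rw [norm_extremal hN ha]
  simp

theorem hasDerivAt_extremal (q N : ℝ) (a z : ℂ) :
    HasDerivAt (extremal q N a) (q * (Real.log (‖a‖ / N) : ℂ) * extremal q N a z) z := by
  have h1 : HasDerivAt (fun z : ℂ => (q * z - 1) * (Real.log (‖a‖ / N) : ℂ))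
      (q * (Real.log (‖a‖ / N) : ℂ)) z := by
    have := (((hasDerivAt_id z).const_mul (q : ℂ)).sub_const 1).mul_const
      (Real.log (‖a‖ / N) : ℂ)
    simpa using this
  have h2 := (h1.cexp).const_mul a
  have h3 : q * (Real.log (‖a‖ / N) : ℂ) * extremal q N a z =
      a * (Complex.exp ((q * z - 1) * (Real.log (‖a‖ / N) : ℂ)) *
        (q * (Real.log (‖a‖ / N) : ℂ))) := by
    unfold extremal
    ring
  rw [h3]
  exact h2

theorem abs_log_le_rpow_add {u δ : ℝ} (hu : 0 < u) (hδ : 0 < δ) :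
    |Real.log u| ≤ (u ^ δ + u ^ (-δ)) / δ := by
  have h1 := Real.log_le_rpow_div hu.le hδ
  have h2 := Real.log_le_rpow_div (inv_pos.2 hu).le hδ
  rw [Real.log_inv, Real.inv_rpow hu.le, ← Real.rpow_neg hu.le] at h2
  have h3 := Real.rpow_nonneg hu.le δ
  have h4 := Real.rpow_nonneg hu.le (-δ)
  rw [add_div]
  have h5 : 0 ≤ u ^ δ / δ := by positivity
  have h6 : 0 ≤ u ^ (-δ) / δ := by positivity
  rw [abs_le]
  constructor <;> linarith

/-- At distance `ε` from the boundary lines the logarithm can be traded for the powers `u ^ (± q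
ε)`: the total exponents still lie in `[0, q]`, so the majorant of the function itself dominates the
derivative up to a constant. -/
theorem norm_deriv_extremal_le {q N ε : ℝ} (hq : 0 < q) (hN : 0 < N) (hε : 0 < ε) (a : ℂ) {z : ℂ}
    (h0 : ε ≤ z.re) (h1 : z.re ≤ 1 - ε) :
    ‖q * (Real.log (‖a‖ / N) : ℂ) * extremal q N a z‖ ≤
      2 / ε * (N * (1 + (‖a‖ / N) ^ q)) := by
  by_cases ha : a = 0
  · simp [extremal, ha]; positivity
  have hu : 0 < ‖a‖ / N := by have := norm_pos_iff.2 ha; positivity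
  rw [norm_mul, norm_extremal hN ha, norm_mul, Complex.norm_real, Complex.norm_real,
    Real.norm_of_nonneg hq.le, Real.norm_eq_abs]
  set u := ‖a‖ / N
  have hl := abs_log_le_rpow_add hu (δ := q * ε) (by positivity)
  have e1 : u ^ (q * ε) * u ^ (q * z.re) ≤ 1 + u ^ q := by
    rw [← Real.rpow_add hu]
    exact rpow_le_one_add hu (by nlinarith) (by nlinarith)
  have e2 : u ^ (-(q * ε)) * u ^ (q * z.re) ≤ 1 + u ^ q := by
    rw [← Real.rpow_add hu]
    exact rpow_le_one_add hu (by nlinarith) (by nlinarith)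
  calc q * |Real.log u| * (N * u ^ (q * z.re))
      ≤ q * ((u ^ (q * ε) + u ^ (-(q * ε))) / (q * ε)) * (N * u ^ (q * z.re)) := by gcongr
    _ = 1 / ε * N * (u ^ (q * ε) * u ^ (q * z.re) + u ^ (-(q * ε)) * u ^ (q * z.re)) := by
        field_simp
    _ ≤ 1 / ε * N * ((1 + u ^ q) + (1 + u ^ q)) := by gcongr
    _ = _ := by ring

theorem measurable_extremal (q N : ℝ) (z : ℂ) : Measurable fun a => extremal q N a z := by
  unfold extremal
  fun_prop

/-! ### Pairings with bounded functions along the strip -/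

/-- The functional `F ↦ ∫ σ F` on `L₁`, for `|σ| ≤ 1`. -/
def pairing (σ : ℝ → ℂ) (hσ : Measurable σ) (hσ₁ : ∀ x, ‖σ x‖ ≤ 1) : LpI 1 →L[ℂ] ℂ :=
  LinearMap.mkContinuous
    { toFun := fun F => ∫ x, σ x * F x ∂leb01
      map_add' := fun F H => by
        have hi : ∀ F : LpI 1, Integrable (fun x => σ x * F x) leb01 := fun F =>
          (L1.integrable_coeFn F).bdd_mul hσ.aestronglyMeasurable (Eventually.of_forall hσ₁)
        rw [← integral_add (hi F) (hi H)]
        apply integral_congr_ae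
        filter_upwards [Lp.coeFn_add F H] with x hx
        rw [hx, Pi.add_apply, mul_add]
      map_smul' := fun c F => by
        rw [RingHom.id_apply, smul_eq_mul, ← integral_const_mul]
        apply integral_congr_ae
        filter_upwards [Lp.coeFn_smul c F] with x hx
        rw [hx, Pi.smul_apply, smul_eq_mul]
        ring } 1 (fun F => by
      rw [one_mul, L1.norm_eq_integral_norm]
      refine norm_integral_le_of_norm_le (L1.integrable_coeFn F).norm
        (Eventually.of_forall fun x => ?_)
      rw [norm_mul]
      exact mul_le_of_le_one_left (norm_nonneg _) (hσ₁ x))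

theorem pairing_apply (σ : ℝ → ℂ) (hσ : Measurable σ) (hσ₁ : ∀ x, ‖σ x‖ ≤ 1) (F : LpI 1) :
    pairing σ hσ hσ₁ F = ∫ x, σ x * F x ∂leb01 := rfl

theorem isOpen_openStrip : IsOpen openStrip :=
  isOpen_Ioo.preimage Complex.continuous_re

theorem openStrip_subset_closedStrip : openStrip ⊆ closedStrip := fun _ hz => ⟨hz.1.le, hz.2.le⟩

section

variable {p : ℝ≥0∞}

theorem integrable_extremal_bound (hp₁ : 1 < p) (hp₂ : p ≠ ∞) {N : ℝ} (hN : 0 < N) (f : LpI p) :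
    Integrable (fun x => N * (1 + (‖f x‖ / N) ^ p.toReal)) leb01 := by
  have h : MemLp (fun x => ‖f x‖ / N) p leb01 := by
    simpa [div_eq_inv_mul] using (Lp.memLp f).norm.const_mul N⁻¹
  have h2 := h.integrable_norm_rpow (by positivity) hp₂
  refine ((integrable_const (1 : ℝ)).add ?_).const_mul N
  refine h2.congr (Eventually.of_forall fun x => ?_)
  dsimp only
  rw [Real.norm_of_nonneg (by positivity)]

theorem integrable_extremal (hp₁ : 1 < p) (hp₂ : p ≠ ∞) {N : ℝ} (hN : 0 < N) (f : LpI p) {z : ℂ}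
    (hz : z ∈ closedStrip) : Integrable (fun x => extremal p.toReal N (f x) z) leb01 := by
  have hp := one_lt_toReal hp₁ hp₂
  have hm : Measurable f := (Lp.stronglyMeasurable f).measurable
  exact (integrable_extremal_bound hp₁ hp₂ hN f).mono'
    ((measurable_extremal _ _ z).comp hm).aestronglyMeasurable
    (Eventually.of_forall fun x => norm_extremal_le (by linarith) hN _ hz)

theorem continuousOn_extremal_pairing (hp₁ : 1 < p) (hp₂ : p ≠ ∞) {N : ℝ} (hN : 0 < N)
    (f : LpI p) {σ : ℝ → ℂ} (hσ : Measurable σ) (hσ₁ : ∀ x, ‖σ x‖ ≤ 1) :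
    ContinuousOn (fun z => ∫ x, σ x * extremal p.toReal N (f x) z ∂leb01) closedStrip := by
  have hp := one_lt_toReal hp₁ hp₂
  have hm : Measurable f := (Lp.stronglyMeasurable f).measurable
  refine continuousOn_of_dominated (bound := fun x => N * (1 + (‖f x‖ / N) ^ p.toReal))
    (fun z _ => (hσ.mul ((measurable_extremal _ _ z).comp hm)).aestronglyMeasurable)
    (fun z hz => Eventually.of_forall fun x => ?_) (integrable_extremal_bound hp₁ hp₂ hN f)
    (Eventually.of_forall fun x z _ => ?_)
  · rw [norm_mul]
    exact (mul_le_of_le_one_left (norm_nonneg _) (hσ₁ x)).trans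
      (norm_extremal_le (by linarith) hN _ hz)
  · exact ((hasDerivAt_extremal _ _ _ z).continuousAt.const_mul _).continuousWithinAt

/-- Differentiation under the integral sign, with the majorant available on a vertical substrip
around `z`. Only scalar pairings of the extremal function are needed, so its analyticity as an
`L_1`-valued map never has to be established. -/
theorem hasDerivAt_extremal_pairing (hp₁ : 1 < p) (hp₂ : p ≠ ∞) {N : ℝ} (hN : 0 < N)
    (f : LpI p) {σ : ℝ → ℂ} (hσ : Measurable σ) (hσ₁ : ∀ x, ‖σ x‖ ≤ 1) {z : ℂ}
    (hz : z ∈ openStrip) :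
    Integrable (fun x => σ x * (p.toReal * (Real.log (‖f x‖ / N) : ℂ) *
        extremal p.toReal N (f x) z)) leb01 ∧
      HasDerivAt (fun z => ∫ x, σ x * extremal p.toReal N (f x) z ∂leb01)
        (∫ x, σ x * (p.toReal * (Real.log (‖f x‖ / N) : ℂ) *
          extremal p.toReal N (f x) z) ∂leb01) z := by
  have hp := one_lt_toReal hp₁ hp₂
  have hm : Measurable f := (Lp.stronglyMeasurable f).measurable
  have hm' : ∀ z, Measurable fun x => extremal p.toReal N (f x) z := fun z =>
    (measurable_extremal _ _ z).comp hm
  have hlog : Measurable fun x => (Real.log (‖f x‖ / N) : ℂ) :=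
    Complex.measurable_ofReal.comp (Real.measurable_log.comp (hm.norm.div_const N))
  set ε := min z.re (1 - z.re) / 2 with hε
  have h3 := min_le_left z.re (1 - z.re)
  have h4 := min_le_right z.re (1 - z.re)
  have h5 : 0 < min z.re (1 - z.re) := lt_min hz.1 (by linarith [hz.2])
  have hε0 : 0 < ε := by positivity
  have hs : {w : ℂ | ε < w.re ∧ w.re < 1 - ε} ∈ 𝓝 z := by
    refine (isOpen_Ioo.preimage Complex.continuous_re).mem_nhds ?_
    constructor <;> linarith
  refine hasDerivAt_integral_of_dominated_loc_of_deriv_le (s := {w : ℂ | ε < w.re ∧ w.re < 1 - ε})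
    (bound := fun x => 2 / ε * (N * (1 + (‖f x‖ / N) ^ p.toReal)))
    (F' := fun z x => σ x * (p.toReal * (Real.log (‖f x‖ / N) : ℂ) *
        extremal p.toReal N (f x) z)) hs
    (Eventually.of_forall fun w => (hσ.mul (hm' w)).aestronglyMeasurable)
    ((integrable_extremal hp₁ hp₂ hN f (openStrip_subset_closedStrip hz)).bdd_mul
      hσ.aestronglyMeasurable (Eventually.of_forall hσ₁))
    (hσ.mul ((hlog.const_mul _).mul (hm' z))).aestronglyMeasurable
    (Eventually.of_forall fun x w hw => ?_)
    ((integrable_extremal_bound hp₁ hp₂ hN f).const_mul _)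
    (Eventually.of_forall fun x w hw => (hasDerivAt_extremal _ _ _ w).const_mul _)
  rw [norm_mul]
  exact (mul_le_of_le_one_left (norm_nonneg _) (hσ₁ x)).trans
    (norm_deriv_extremal_le (by linarith) hN hε0 _ hw.1.le hw.2.le)

end

/-! ### The `L_p` bound on the derivative at `θ`, by duality -/

/-- The signum of the conjugate: `conjSign w * w = |w|`. -/
def conjSign (w : ℂ) : ℂ := (starRingEnd ℂ) w / ‖w‖

theorem conjSign_mul (w : ℂ) : conjSign w * w = ‖w‖ := by
  by_cases hw : w = 0
  · simp [hw]
  have : (‖w‖ : ℂ) ≠ 0 := by exact_mod_cast norm_ne_zero_iff.2 hw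
  rw [conjSign, div_mul_eq_mul_div, Complex.conj_mul', div_eq_iff this, sq]

theorem norm_conjSign_le (w : ℂ) : ‖conjSign w‖ ≤ 1 := by
  rw [conjSign, norm_div, Complex.norm_conj, Complex.norm_real, norm_norm]
  exact div_self_le_one _

theorem measurable_conjSign : Measurable conjSign := by
  unfold conjSign
  exact (Complex.continuous_conj.measurable).div (Complex.measurable_ofReal.comp measurable_norm)

/-- A simple function below `|h| ^ q` has small integral if suitable pairings do. -/
theorem memLp_of_simpleFunc_le {p : ℝ≥0∞} (hp₁ : 1 < p) (hp₂ : p ≠ ∞) {h : ℝ → ℂ}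
    (hh : Measurable h) {M : ℝ} (hM : 0 ≤ M)
    (H : ∀ φ : SimpleFunc ℝ NNReal, (∀ x, (φ x : ℝ) ≤ ‖h x‖ ^ p.toReal) →
      ∑ c ∈ φ.range, (c : ℝ) * leb01.real (φ ⁻¹' {c}) ≤ M ^ p.toReal) :
    ∃ hL : MemLp h p leb01, ‖hL.toLp h‖ ≤ M := by
  have hp := one_lt_toReal hp₁ hp₂
  have key : ∫⁻ x, ‖h x‖ₑ ^ p.toReal ∂leb01 ≤ ENNReal.ofReal M ^ p.toReal := by
    rw [lintegral_eq_nnreal]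
    refine iSup₂_le fun φ hφ => ?_
    have h1 : ∀ x, (φ x : ℝ) ≤ ‖h x‖ ^ p.toReal := by
      intro x
      have := hφ x
      rw [← ofReal_norm, ENNReal.ofReal_rpow_of_nonneg (norm_nonneg _) (by linarith),
        ← ENNReal.ofReal_coe_nnreal] at this
      exact (ENNReal.ofReal_le_ofReal_iff (by positivity)).1 this
    have h2 := H φ h1
    rw [SimpleFunc.map_lintegral, ENNReal.ofReal_rpow_of_nonneg hM (by linarith)]
    refine le_trans (le_of_eq ?_) (ENNReal.ofReal_le_ofReal h2)
    rw [ENNReal.ofReal_sum_of_nonneg fun c _ => by positivity]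
    refine Finset.sum_congr rfl fun c _ => ?_
    rw [ENNReal.ofReal_mul c.coe_nonneg, ENNReal.ofReal_coe_nnreal, ofReal_measureReal]
  have hnorm : eLpNorm h p leb01 ≤ ENNReal.ofReal M := by
    rw [eLpNorm_eq_lintegral_rpow_enorm_toReal (by positivity) hp₂]
    calc _ ≤ (ENNReal.ofReal M ^ p.toReal) ^ (1 / p.toReal) := by gcongr
      _ = ENNReal.ofReal M := by
        rw [← ENNReal.rpow_mul, mul_one_div_cancel (by linarith), ENNReal.rpow_one]
  have hL : MemLp h p leb01 := ⟨hh.aestronglyMeasurable, hnorm.trans_lt ENNReal.ofReal_lt_top⟩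
  refine ⟨hL, ?_⟩
  rw [Lp.norm_toLp]
  exact ENNReal.toReal_le_of_le_ofReal hM hnorm

/-- Dividing by a power of `a` is legitimate because `a` is a finite positive number. This is the
reason for testing with simple functions: the integral of `|h| ^ q` itself is not yet known to be
finite. -/
theorem le_rpow_of_le_mul_rpow {a M q : ℝ} (hq : 1 < q) (ha : 0 < a)
    (h : a ≤ M * a ^ (1 - 1 / q)) : a ≤ M ^ q := by
  have h1 : a ^ (1 / q) ≤ M := by
    have e : a = a ^ (1 / q) * a ^ (1 - 1 / q) := by
      rw [← Real.rpow_add ha]; simp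
    have hpos : 0 < a ^ (1 - 1 / q) := Real.rpow_pos_of_pos ha _
    by_contra hlt
    have := mul_lt_mul_of_pos_right (not_le.1 hlt) hpos
    linarith
  calc a = (a ^ (1 / q)) ^ q := by
        rw [← Real.rpow_mul ha.le, one_div_mul_cancel (by linarith), Real.rpow_one]
    _ ≤ M ^ q := Real.rpow_le_rpow (by positivity) h1 (by linarith)

section

variable {p : ℝ≥0∞}

/-- A function of the Calderón space taking the value `f` at `θ`, paired with `σ` and compared
with the extremal function. -/
def gap (p : ℝ≥0∞) (F : ℂ → LpI 1) (f : LpI p) (σ : ℝ → ℂ) (z : ℂ) : ℂ :=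
  ∫ x, σ x * F z x ∂leb01 - ∫ x, σ x * extremal p.toReal ‖f‖ (f x) z ∂leb01

variable {F : ℂ → LpI 1} {f : LpI p} {σ : ℝ → ℂ}

theorem gap_continuousOn (hp₁ : 1 < p) (hp₂ : p ≠ ∞) (hf : 0 < ‖f‖)
    (hF : ContinuousOn F closedStrip) (hσ : Measurable σ) (hσ₁ : ∀ x, ‖σ x‖ ≤ 1) :
    ContinuousOn (gap p F f σ) closedStrip :=
  ((pairing σ hσ hσ₁).continuous.comp_continuousOn hF).sub
    (continuousOn_extremal_pairing hp₁ hp₂ hf f hσ hσ₁)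

theorem gap_hasDerivAt (hp₁ : 1 < p) (hp₂ : p ≠ ∞) (hf : 0 < ‖f‖)
    (hF : DifferentiableOn ℂ F openStrip) (hσ : Measurable σ) (hσ₁ : ∀ x, ‖σ x‖ ≤ 1) {z : ℂ}
    (hz : z ∈ openStrip) :
    HasDerivAt (gap p F f σ) (∫ x, σ x * (deriv F z x -
      p.toReal * (Real.log (‖f x‖ / ‖f‖) : ℂ) * extremal p.toReal ‖f‖ (f x) z) ∂leb01) z := by
  have h1 := (hF.differentiableAt (isOpen_openStrip.mem_nhds hz)).hasDerivAt
  have h2 := (pairing σ hσ hσ₁).hasFDerivAt.comp_hasDerivAt z h1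
  obtain ⟨hi, h3⟩ := hasDerivAt_extremal_pairing hp₁ hp₂ hf f hσ hσ₁ hz
  have hi' : Integrable (fun x => σ x * deriv F z x) leb01 :=
    (L1.integrable_coeFn (deriv F z)).bdd_mul hσ.aestronglyMeasurable (Eventually.of_forall hσ₁)
  have h4 := h2.sub h3
  rw [pairing_apply, ← integral_sub hi' hi] at h4
  simp only [mul_sub]
  exact h4

/-- Both functions compared take the value `f` at `θ`. -/
theorem gap_theta (hp₁ : 1 < p) (hp₂ : p ≠ ∞)
    (hθ : toL0 1 (F (1 / p.toReal : ℝ)) = toL0 p f) : gap p F f σ (1 / p.toReal : ℝ) = 0 := by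
  have hp := one_lt_toReal hp₁ hp₂
  have e : (F (1 / p.toReal : ℝ) : ℝ → ℂ) = f := by
    rw [← toL0_coe, hθ, toL0_coe]
  rw [gap, e, sub_eq_zero]
  simp only [extremal_theta (show p.toReal ≠ 0 by linarith)]

theorem norm_gap_le (hp₁ : 1 < p) (hp₂ : p ≠ ∞) (hf : 0 < ‖f‖) (hσ : Measurable σ)
    {A : Set ℝ} (hA : MeasurableSet A) (hσ₁ : ∀ x, ‖σ x‖ ≤ 1) {z : ℂ} (hz : z ∈ closedStrip) :
    ‖gap p F f (A.indicator σ) z‖ ≤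
      ∫ x in A, (‖F z x‖ + ‖extremal p.toReal ‖f‖ (f x) z‖) ∂leb01 := by
  have hi := L1.integrable_coeFn (F z)
  have hi' := integrable_extremal hp₁ hp₂ hf f hz
  have hb : ∀ x, ‖A.indicator σ x‖ ≤ 1 := fun x => by
    rw [norm_indicator_eq_indicator_norm]
    exact Set.indicator_le' (fun x _ => hσ₁ x) (fun x _ => zero_le_one) x
  rw [gap, ← integral_sub
    (hi.bdd_mul (hσ.indicator hA).aestronglyMeasurable (Eventually.of_forall hb))
    (hi'.bdd_mul (hσ.indicator hA).aestronglyMeasurable (Eventually.of_forall hb)),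
    ← integral_indicator hA]
  refine norm_integral_le_of_norm_le ((hi.norm.add hi'.norm).indicator hA)
    (Eventually.of_forall fun x => ?_)
  rw [← mul_sub, norm_mul]
  by_cases hx : x ∈ A
  · rw [Set.indicator_of_mem hx, Set.indicator_of_mem hx]
    exact (mul_le_of_le_one_left (norm_nonneg _) (hσ₁ x)).trans (norm_sub_le _ _)
  · rw [Set.indicator_of_notMem hx, Set.indicator_of_notMem hx]
    simp

theorem integral_norm_extremal_one (hp₁ : 1 < p) (hp₂ : p ≠ ∞) (hf : 0 < ‖f‖) (t : ℝ) :
    ∫ x, ‖extremal p.toReal ‖f‖ (f x) (1 + t * Complex.I)‖ ∂leb01 = ‖f‖ := by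
  have hp := one_lt_toReal hp₁ hp₂
  simp only [norm_extremal_one (show 0 < p.toReal by linarith) hf]
  rw [integral_const_mul]
  simp only [Real.div_rpow (norm_nonneg _) hf.le]
  rw [integral_div, ← Lp_norm_rpow hp₁ hp₂, div_self (by positivity), mul_one]

/-- The differential of a function of the Calderón space differs from the multiple `p 𝒦 f` of the
Kalton-Peck map by a bounded term. -/
theorem normLE_deriv_sub_kaltonPeck [Fact (1 ≤ p)] (hp₁ : 1 < p) (hp₂ : p ≠ ∞) {r : ℝ}
    (hF : CalderonNormLE F r) (hf : 0 < ‖f‖)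
    (hθ : toL0 1 (F (1 / p.toReal : ℝ)) = toL0 p f) :
    NormLE (toL0 p) (toL0 1 (deriv F (1 / p.toReal : ℝ)) - (p.toReal : ℂ) • kaltonPeck p f)
      ((r + ‖f‖) / (min (1 / p.toReal) (1 - 1 / p.toReal) / 2)) := by
  have hp := one_lt_toReal hp₁ hp₂
  obtain ⟨hFc, hFd, ⟨MF, hMF⟩, hF0, hF1⟩ := hF
  set q := p.toReal with hq
  set θ : ℝ := 1 / q with hθdef
  have hθ0 : 0 < θ := by positivity
  have hθ1 : θ < 1 := by rw [hθdef, div_lt_one (by linarith)]; exact hp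
  have hθs : (θ : ℂ) ∈ openStrip := by simp [openStrip, hθ0, hθ1]
  have hr : 0 ≤ r := (norm_nonneg _).trans (hF1 0)
  have hR : 0 < r + ‖f‖ := by linarith
  have hmin : 0 < min θ (1 - θ) := lt_min hθ0 (by linarith)
  have hmf : Measurable f := (Lp.stronglyMeasurable f).measurable
  have hlog : Measurable fun x => (Real.log (‖f x‖ / ‖f‖) : ℂ) :=
    Complex.measurable_ofReal.comp (Real.measurable_log.comp (hmf.norm.div_const _))
  set h : ℝ → ℂ := fun x => deriv F θ x - q * (Real.log (‖f x‖ / ‖f‖) : ℂ) * f x with hh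
  have hhm : Measurable h := (Lp.stronglyMeasurable (deriv F θ)).measurable.sub
    ((hlog.const_mul _).mul hmf)
  have hM : 0 ≤ (r + ‖f‖) / (min θ (1 - θ) / 2) := by positivity
  have hs : Measurable fun x => conjSign (h x) := measurable_conjSign.comp hhm
  have hs1 : ∀ x, ‖conjSign (h x)‖ ≤ 1 := fun x => norm_conjSign_le _
  -- For a simple `φ ≤ |h| ^ q` with integral `a`, it suffices to show `a ≤ M a ^ (1 - θ)`. This is
  -- obtained by pairing the gap with an analytic family built from `φ` and the sign of `h`.
  obtain ⟨hL, hLn⟩ := memLp_of_simpleFunc_le hp₁ hp₂ hhm hM fun φ hφ => by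
    set a := ∑ c ∈ φ.range, (c : ℝ) * leb01.real (φ ⁻¹' {c}) with ha
    have ha0 : 0 ≤ a := Finset.sum_nonneg fun c _ => by positivity
    rcases ha0.eq_or_lt with ha0 | ha0
    · rw [← ha0]; positivity
    apply le_rpow_of_le_mul_rpow hp ha0
    have hfib : ∀ c, MeasurableSet (φ ⁻¹' {c}) := fun c => φ.measurableSet_preimage _
    set σ : NNReal → ℝ → ℂ := fun c => (φ ⁻¹' {c}).indicator fun x => conjSign (h x) with hσ
    have hσm : ∀ c, Measurable (σ c) := fun c => hs.indicator (hfib c)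
    have hσ1 : ∀ c x, ‖σ c x‖ ≤ 1 := fun c x => by
      rw [hσ, norm_indicator_eq_indicator_norm]
      exact Set.indicator_le' (fun x _ => hs1 x) (fun x _ => zero_le_one) x
    -- The value `0` contributes nothing to `a`, and it must be left out because `c ^ (1 - z)` is
    -- analytic in `z` only for `c ≠ 0`.
    set S := φ.range.erase 0 with hS
    have hSpos : ∀ c ∈ S, (0 : ℝ) < c := fun c hc =>
      NNReal.coe_pos.2 (pos_iff_ne_zero.2 (Finset.ne_of_mem_erase hc))
    have haS : a = ∑ c ∈ S, (c : ℝ) * leb01.real (φ ⁻¹' {c}) := by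
      rw [ha]
      refine (Finset.sum_subset (Finset.erase_subset _ _) fun c hc hc' => ?_).symm
      have : c = 0 := by
        by_contra hne
        exact hc' (Finset.mem_erase.2 ⟨hne, hc⟩)
      simp [this]
    have hcne : ∀ c ∈ S, ((c : ℝ) : ℂ) ≠ 0 := fun c hc => by exact_mod_cast (hSpos c hc).ne'
    have hpow : ∀ c ∈ S, ∀ z : ℂ, HasDerivAt (fun z : ℂ => ((c : ℝ) : ℂ) ^ (1 - z))
        (deriv (fun z : ℂ => ((c : ℝ) : ℂ) ^ (1 - z)) z) z := fun c hc z =>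
      ((differentiableAt_id.const_sub 1).const_cpow (Or.inl (hcne c hc))).hasDerivAt
    have hpown : ∀ c ∈ S, ∀ z : ℂ, ‖((c : ℝ) : ℂ) ^ (1 - z)‖ = (c : ℝ) ^ (1 - z.re) :=
      fun c hc z => by rw [Complex.norm_cpow_eq_rpow_re_of_pos (hSpos c hc)]; simp
    -- The test function `φ ^ (1 - z) · conjSign h` has `L_1` norm `a` on the line `Re z = 0` and is
    -- bounded by `1` on `Re z = 1`. This matches the `L_∞` and `L_1` control of the gap on these
    -- lines.
    set Φ : ℂ → ℂ := fun z => ∑ c ∈ S, ((c : ℝ) : ℂ) ^ (1 - z) * gap p F f (σ c) z with hΦ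
    have hgd : ∀ c, ∀ z ∈ openStrip, DifferentiableAt ℂ (gap p F f (σ c)) z := fun c z hz =>
      (gap_hasDerivAt hp₁ hp₂ hf hFd (hσm c) (hσ1 c) hz).differentiableAt
    have hint : ∀ z ∈ closedStrip,
        Integrable (fun x => ‖F z x‖ + ‖extremal q ‖f‖ (f x) z‖) leb01 := fun z hz =>
      (L1.integrable_coeFn (F z)).norm.add (integrable_extremal hp₁ hp₂ hf f hz).norm
    have hgap : ∀ c, ∀ z ∈ closedStrip, ‖gap p F f (σ c) z‖ ≤
        ∫ x in φ ⁻¹' {c}, (‖F z x‖ + ‖extremal q ‖f‖ (f x) z‖) ∂leb01 := fun c z hz =>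
      norm_gap_le hp₁ hp₂ hf hs (hfib c) hs1 hz
    have hΦc : ContinuousOn Φ closedStrip := by
      refine continuousOn_finsetSum _ fun c hc => ?_
      exact ContinuousOn.mul (fun z _ => (hpow c hc z).continuousAt.continuousWithinAt)
        (gap_continuousOn hp₁ hp₂ hf hFc (hσm c) (hσ1 c))
    have hΦd : DifferentiableOn ℂ Φ openStrip := by
      refine DifferentiableOn.fun_sum fun c hc z hz => ?_
      exact ((hpow c hc z).differentiableAt.mul (hgd c z hz)).differentiableWithinAt
    have hΦb : ∃ M, ∀ z ∈ closedStrip, ‖Φ z‖ ≤ M := by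
      refine ⟨∑ c ∈ S, (1 + (c : ℝ) ^ (1 : ℝ)) *
        (MF + ∫ x, ‖f‖ * (1 + (‖f x‖ / ‖f‖) ^ q) ∂leb01), fun z hz => ?_⟩
      refine (norm_sum_le _ _).trans (Finset.sum_le_sum fun c hc => ?_)
      rw [norm_mul, hpown c hc]
      have h1 := rpow_le_one_add (hSpos c hc) (s := 1 - z.re) (t := 1) (by linarith [hz.2])
        (by linarith [hz.1])
      refine mul_le_mul h1 ((hgap c z hz).trans ?_) (norm_nonneg _) (by positivity)
      refine (setIntegral_le_integral (hint z hz)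
        (Eventually.of_forall fun x => by dsimp only [Pi.zero_apply]; positivity)).trans ?_
      rw [integral_add (L1.integrable_coeFn (F z)).norm (integrable_extremal hp₁ hp₂ hf f hz).norm,
        ← L1.norm_eq_integral_norm]
      refine add_le_add (hMF z hz) ?_
      exact integral_mono (integrable_extremal hp₁ hp₂ hf f hz).norm
        (integrable_extremal_bound hp₁ hp₂ hf f)
        fun x => norm_extremal_le (by linarith) hf _ hz
    have hΦ0 : ∀ t : ℝ, ‖Φ (t * Complex.I)‖ ≤ (r + ‖f‖) * a := by
      intro t
      have hz : (t * Complex.I : ℂ) ∈ closedStrip := by simp [closedStrip]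
      refine (norm_sum_le _ _).trans ?_
      rw [haS, Finset.mul_sum]
      refine Finset.sum_le_sum fun c hc => ?_
      rw [norm_mul, hpown c hc]
      have h1 : ∫ x in φ ⁻¹' {c}, (‖F (t * Complex.I) x‖ +
          ‖extremal q ‖f‖ (f x) (t * Complex.I)‖) ∂leb01 ≤
          (r + ‖f‖) * leb01.real (φ ⁻¹' {c}) := by
        have h2 : ∫ x in φ ⁻¹' {c}, (r + ‖f‖) ∂leb01 = (r + ‖f‖) * leb01.real (φ ⁻¹' {c}) := by
          rw [setIntegral_const, smul_eq_mul, mul_comm]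
        rw [← h2]
        refine integral_mono_ae (hint _ hz).integrableOn (integrable_const _) ?_
        filter_upwards [ae_restrict_of_ae (hF0 t)] with x hx
        exact add_le_add hx (norm_extremal_zero_le hf _ t)
      have h2 := (hgap c _ hz).trans h1
      have h3 : (1 : ℝ) - (t * Complex.I : ℂ).re = 1 := by simp
      rw [h3, Real.rpow_one]
      calc (c : ℝ) * ‖gap p F f (σ c) (t * Complex.I)‖
          ≤ c * ((r + ‖f‖) * leb01.real (φ ⁻¹' {c})) := by gcongr
        _ = _ := by ring
    -- Here the powers have modulus one and the fibres of `φ` are disjoint, so the sum is at most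
    -- the `L_1` norm of `F` plus that of the extremal function, which is `‖f‖`.
    have hΦ1 : ∀ t : ℝ, ‖Φ (1 + t * Complex.I)‖ ≤ r + ‖f‖ := by
      intro t
      have hz : (1 + t * Complex.I : ℂ) ∈ closedStrip := by simp [closedStrip]
      have h3 : (1 : ℝ) - (1 + t * Complex.I : ℂ).re = 0 := by simp
      calc ‖Φ (1 + t * Complex.I)‖ ≤ ∑ c ∈ S, ∫ x in φ ⁻¹' {c}, (‖F (1 + t * Complex.I) x‖ +
            ‖extremal q ‖f‖ (f x) (1 + t * Complex.I)‖) ∂leb01 := by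
            refine (norm_sum_le _ _).trans (Finset.sum_le_sum fun c hc => ?_)
            rw [norm_mul, hpown c hc, h3, Real.rpow_zero, one_mul]
            exact hgap c _ hz
        _ = ∫ x in ⋃ c ∈ S, φ ⁻¹' {c}, (‖F (1 + t * Complex.I) x‖ +
            ‖extremal q ‖f‖ (f x) (1 + t * Complex.I)‖) ∂leb01 := by
            refine (integral_biUnion_finset S (fun c _ => hfib c) ?_
              fun c _ => (hint _ hz).integrableOn).symm
            intro c _ c' _ hne
            exact Disjoint.preimage _ (Set.disjoint_singleton.2 hne)
        _ ≤ ∫ x, (‖F (1 + t * Complex.I) x‖ +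
            ‖extremal q ‖f‖ (f x) (1 + t * Complex.I)‖) ∂leb01 :=
            setIntegral_le_integral (hint _ hz)
              (Eventually.of_forall fun x => by dsimp only [Pi.zero_apply]; positivity)
        _ = ‖F (1 + t * Complex.I)‖ + ‖f‖ := by
            rw [integral_add (L1.integrable_coeFn _).norm
              (integrable_extremal hp₁ hp₂ hf f hz).norm, ← L1.norm_eq_integral_norm,
              integral_norm_extremal_one hp₁ hp₂ hf]
        _ ≤ r + ‖f‖ := by gcongr; exact hF1 t
    have hΦθ : Φ θ = 0 := Finset.sum_eq_zero fun c _ => by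
      rw [gap_theta hp₁ hp₂ hθ, mul_zero]
    -- The derivatives of the powers drop out because every gap vanishes at `θ`; the sign `conjSign
    -- h` turns the derivative of the gap into the integral of `|h|` over the fibre.
    have hder : deriv Φ θ = ((∑ c ∈ S, (c : ℝ) ^ (1 - θ) *
        ∫ x in φ ⁻¹' {c}, ‖h x‖ ∂leb01 : ℝ) : ℂ) := by
      have h1 : ∀ c ∈ S, HasDerivAt (fun z => ((c : ℝ) : ℂ) ^ (1 - z) * gap p F f (σ c) z)
          (((c : ℝ) ^ (1 - θ) * ∫ x in φ ⁻¹' {c}, ‖h x‖ ∂leb01 : ℝ) : ℂ) θ := by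
        intro c hc
        have h2 := (hpow c hc θ).mul (gap_hasDerivAt hp₁ hp₂ hf hFd (hσm c) (hσ1 c) hθs)
        rw [gap_theta hp₁ hp₂ hθ, mul_zero, zero_add] at h2
        have e : ∫ x, σ c x * (deriv F θ x - p.toReal * (Real.log (‖f x‖ / ‖f‖) : ℂ) *
            extremal p.toReal ‖f‖ (f x) θ) ∂leb01 =
            ((∫ x in φ ⁻¹' {c}, ‖h x‖ ∂leb01 : ℝ) : ℂ) := by
          rw [← integral_indicator (hfib c), ← integral_complex_ofReal]
          refine integral_congr_ae (Eventually.of_forall fun x => ?_)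
          simp only [extremal_theta (show q ≠ 0 by linarith), hσ, θ, q]
          by_cases hx : x ∈ φ ⁻¹' {c}
          · rw [Set.indicator_of_mem hx, Set.indicator_of_mem hx, ← conjSign_mul]
          · rw [Set.indicator_of_notMem hx, Set.indicator_of_notMem hx]
            simp
        rw [e] at h2
        rw [Complex.ofReal_mul, Complex.ofReal_cpow c.coe_nonneg]
        push_cast
        exact h2
      have h2 := (HasDerivAt.fun_sum h1).deriv
      rw [Complex.ofReal_sum]
      exact h2
    have hmain := norm_deriv_le_of_strip hθ0 hθ1 ha0 hR hΦc hΦd hΦb hΦ0 hΦ1 hΦθ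
    refine le_trans ?_ hmain
    rw [hder, Complex.norm_real]
    refine le_trans ?_ (Real.le_norm_self _)
    rw [haS]
    refine Finset.sum_le_sum fun c hc => ?_
    -- On the fibre `φ = c` one has `c ≤ |h| ^ q`, hence `c ^ θ ≤ |h|` as `θ = 1 / q`. Summing with
    -- the weights `c ^ (1 - θ)` gives `a` as a lower bound for the derivative.
    have h1 : (c : ℝ) ^ θ * leb01.real (φ ⁻¹' {c}) ≤ ∫ x in φ ⁻¹' {c}, ‖h x‖ ∂leb01 := by
      have h2 : ∫ x in φ ⁻¹' {c}, (c : ℝ) ^ θ ∂leb01 = (c : ℝ) ^ θ * leb01.real (φ ⁻¹' {c}) := by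
        rw [setIntegral_const, smul_eq_mul, mul_comm]
      rw [← h2]
      have hhi : Integrable h leb01 := by
        have h3 := (hasDerivAt_extremal_pairing hp₁ hp₂ hf f (σ := fun _ => 1) measurable_const
          (by simp) hθs).1
        refine (L1.integrable_coeFn (deriv F θ)).sub (h3.congr (Eventually.of_forall fun x => ?_))
        simp only [extremal_theta (show q ≠ 0 by linarith), one_mul, θ, q]
      refine setIntegral_mono_on (integrable_const _) hhi.norm.integrableOn (hfib c) fun x hx => ?_
      have h3 := hφ x
      rw [show φ x = c from hx] at h3
      calc (c : ℝ) ^ θ ≤ (‖h x‖ ^ q) ^ θ := by gcongr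
        _ = ‖h x‖ := by
          rw [← Real.rpow_mul (norm_nonneg _), mul_one_div_cancel (by linarith), Real.rpow_one]
    calc (c : ℝ) * leb01.real (φ ⁻¹' {c})
        = (c : ℝ) ^ (1 - θ) * ((c : ℝ) ^ θ * leb01.real (φ ⁻¹' {c})) := by
          rw [← mul_assoc, ← Real.rpow_add (hSpos c hc)]; simp
      _ ≤ _ := by gcongr
  refine ⟨hL.toLp h, ?_, hLn⟩
  apply AEEqFun.ext
  filter_upwards [hL.coeFn_toLp, AEEqFun.coeFn_sub (toL0 1 (deriv F θ))
    ((q : ℂ) • kaltonPeck p f), AEEqFun.coeFn_smul (q : ℂ) (kaltonPeck p f), kaltonPeck_coe p f]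
    with x h1 h2 h3 h4
  rw [toL0_coe, h1, h2, Pi.sub_apply, h3, Pi.smul_apply, h4, toL0_coe, hh, smul_eq_mul]
  ring

/-- The differential of the scale of Lebesgue spaces is, up to a bounded map, the multiple `p 𝒦`
of the Kalton-Peck map. -/
theorem exists_scaleDifferential_sub_bound [Fact (1 ≤ p)] (hp₁ : 1 < p) (hp₂ : p ≠ ∞)
    {B : LpI p → ℂ → LpI 1}
    (hB : IsCalderonSelection p B) :
    (∀ (c : ℂ) (f : LpI p), scaleDifferential p B (c • f) = c • scaleDifferential p B f) ∧
      ∃ K : ℝ, 0 ≤ K ∧ ∀ f : LpI p,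
        NormLE (toL0 p) (scaleDifferential p B f - (p.toReal : ℂ) • kaltonPeck p f)
          (K * ‖f‖) := by
  have hp := one_lt_toReal hp₁ hp₂
  obtain ⟨h1, h2, C, hC⟩ := hB
  have hθ0 : 0 < 1 / p.toReal := by positivity
  have hθ1 : 1 / p.toReal < 1 := by rw [div_lt_one (by linarith)]; exact hp
  have hθs : ((1 / p.toReal : ℝ) : ℂ) ∈ openStrip :=
    ⟨by rw [Complex.ofReal_re]; exact hθ0, by rw [Complex.ofReal_re]; exact hθ1⟩
  have hhom : ∀ (c : ℂ) (f : LpI p),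
      scaleDifferential p B (c • f) = c • scaleDifferential p B f := by
    intro c f
    have he : B (c • f) =ᶠ[𝓝 ((1 / p.toReal : ℝ) : ℂ)] c • B f := by
      filter_upwards [isOpen_openStrip.mem_nhds hθs] with z hz
      exact h2 c f z (openStrip_subset_closedStrip hz)
    rw [scaleDifferential, scaleDifferential, he.deriv_eq, deriv_const_smul_field, map_smul]
  have hm : 0 < min (1 / p.toReal) (1 - 1 / p.toReal) := lt_min hθ0 (by linarith)
  -- `C ‖f‖` bounds the selection and the additional `‖f‖` bounds the extremal function.
  refine ⟨hhom, (|C| + 1) / (min (1 / p.toReal) (1 - 1 / p.toReal) / 2), by positivity,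
    fun f => ?_⟩
  rcases (norm_nonneg f).eq_or_lt with hf | hf
  · have hf0 : f = 0 := norm_eq_zero.1 hf.symm
    have e1 : scaleDifferential p B 0 = 0 := by
      have h := hhom 0 0
      rw [zero_smul] at h
      exact h.trans (zero_smul ℂ (scaleDifferential p B 0))
    have e2 : kaltonPeck p 0 = 0 := by
      have h := (kaltonPeck_isQuasiLinear p).1 0 0
      rw [zero_smul] at h
      exact h.trans (zero_smul ℂ (kaltonPeck p 0))
    refine ⟨0, ?_, by simp [hf0]⟩
    rw [hf0, e1, e2, map_zero, zero_sub]
    exact ((neg_eq_zero (α := L0)).2 (smul_zero (A := L0) (p.toReal : ℂ))).symm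
  · refine (normLE_deriv_sub_kaltonPeck hp₁ hp₂ (hC f) hf (h1 f)).mono ?_
    rw [div_mul_eq_mul_div, add_mul, one_mul]
    gcongr
    exact le_abs_self C

end

/-! ## Construction of isometries -/

section

variable {W : ℝ → ℂ} {Θ Θ' : ℝ → ℝ} {q : ℝ}

/-- Since `W` vanishes almost nowhere, Lebesgue measure is absolutely continuous with respect to the
weighted measure, whose image is Lebesgue measure by the change of variables `hcv`. -/
theorem quasiMeasurePreserving_of_map_eq (hW : Measurable W) (hΘ : Measurable Θ)
    (hW0 : ∀ᵐ x ∂leb01, W x ≠ 0)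
    (hcv : (leb01.withDensity fun x => ‖W x‖ₑ ^ q).map Θ = leb01) :
    Measure.QuasiMeasurePreserving Θ leb01 leb01 := by
  refine ⟨hΘ, ?_⟩
  have h : leb01 ≪ leb01.withDensity fun x => ‖W x‖ₑ ^ q := by
    refine withDensity_absolutelyContinuous' (hW.enorm.pow_const q).aemeasurable ?_
    filter_upwards [hW0] with x hx
    rw [Ne, ENNReal.rpow_eq_zero_iff]
    simp [hx]
  calc leb01.map Θ ≪ (leb01.withDensity fun x => ‖W x‖ₑ ^ q).map Θ := h.map hΘ
    _ = leb01 := hcv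

theorem lintegral_weighted_comp (hW : Measurable W) (hΘ : Measurable Θ) (hq : 0 < q)
    (hcv : (leb01.withDensity fun x => ‖W x‖ₑ ^ q).map Θ = leb01) {f : ℝ → ℂ}
    (hf : Measurable f) :
    ∫⁻ x, ‖W x * f (Θ x)‖ₑ ^ q ∂leb01 = ∫⁻ x, ‖f x‖ₑ ^ q ∂leb01 := by
  conv_rhs => rw [← hcv]
  rw [lintegral_map (hf.enorm.pow_const q) hΘ,
    lintegral_withDensity_eq_lintegral_mul _ (hW.enorm.pow_const q)
      (g := fun x => ‖f (Θ x)‖ₑ ^ q) ((hf.comp hΘ).enorm.pow_const q)]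
  refine lintegral_congr fun x => ?_
  rw [Pi.mul_apply, enorm_mul, ENNReal.mul_rpow_of_nonneg _ _ hq.le]

end

section

variable {p : ℝ≥0∞} {W : ℝ → ℂ} {Θ Θ' : ℝ → ℝ}

theorem eLpNorm_weighted_comp (hp₁ : 1 < p) (hp₂ : p ≠ ∞) (hW : Measurable W) (hΘ : Measurable Θ)
    (hcv : (leb01.withDensity fun x => ‖W x‖ₑ ^ p.toReal).map Θ = leb01) {f : ℝ → ℂ}
    (hf : Measurable f) : eLpNorm (fun x => W x * f (Θ x)) p leb01 = eLpNorm f p leb01 := by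
  have hp := one_lt_toReal hp₁ hp₂
  rw [eLpNorm_eq_lintegral_rpow_enorm_toReal (by positivity) hp₂,
    eLpNorm_eq_lintegral_rpow_enorm_toReal (by positivity) hp₂,
    lintegral_weighted_comp hW hΘ (by linarith) hcv hf]

/-- A weight and an essentially injective point map which are compatible with Lebesgue measure
define a surjective isometry of `L_p` preserving disjointness. -/
theorem exists_isometry [Fact (1 ≤ p)] (hp₁ : 1 < p) (hp₂ : p ≠ ∞)
    (hW : Measurable W) (hΘ : Measurable Θ)
    (hΘ' : Measurable Θ') (hinv : ∀ᵐ x ∂leb01, Θ' (Θ x) = x) (hW0 : ∀ᵐ x ∂leb01, W x ≠ 0)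
    (hcv : (leb01.withDensity fun x => ‖W x‖ₑ ^ p.toReal).map Θ = leb01) :
    ∃ T ∈ disjointnessPreserving p, IsWeightedComp T W Θ := by
  have hq := quasiMeasurePreserving_of_map_eq hW hΘ hW0 hcv
  have hm : ∀ f : LpI p, Measurable f := fun f => (Lp.stronglyMeasurable f).measurable
  have hmem : ∀ f : LpI p, MemLp (fun x => W x * f (Θ x)) p leb01 := fun f =>
    ⟨(hW.mul ((hm f).comp hΘ)).aestronglyMeasurable, by
      rw [eLpNorm_weighted_comp hp₁ hp₂ hW hΘ hcv (hm f)]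
      exact Lp.eLpNorm_lt_top f⟩
  let T₀ : LpI p →ₗ[ℂ] LpI p :=
    { toFun := fun f => (hmem f).toLp _
      map_add' := fun f g => by
        apply Lp.ext
        filter_upwards [(hmem (f + g)).coeFn_toLp, (hmem f).coeFn_toLp, (hmem g).coeFn_toLp,
          Lp.coeFn_add ((hmem f).toLp _) ((hmem g).toLp _), hq.ae (Lp.coeFn_add f g)]
          with x h1 h2 h3 h4 h5
        rw [h1, h4, Pi.add_apply, h2, h3, h5, Pi.add_apply, mul_add]
      map_smul' := fun c f => by
        apply Lp.ext
        filter_upwards [(hmem (c • f)).coeFn_toLp, (hmem f).coeFn_toLp,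
          Lp.coeFn_smul c ((hmem f).toLp _), hq.ae (Lp.coeFn_smul c f)] with x h1 h2 h4 h5
        rw [h1, RingHom.id_apply, h4, Pi.smul_apply, h2, h5, Pi.smul_apply, smul_eq_mul,
          smul_eq_mul]
        ring }
  have hT₀ : ∀ f : LpI p, ∀ᵐ x ∂leb01, T₀ f x = W x * f (Θ x) := fun f => (hmem f).coeFn_toLp
  let T₁ : LpI p →ₗᵢ[ℂ] LpI p := ⟨T₀, fun f => by
    change ‖(hmem f).toLp _‖ = ‖f‖
    rw [Lp.norm_toLp, eLpNorm_weighted_comp hp₁ hp₂ hW hΘ hcv (hm f), Lp.norm_def]⟩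
  have hsurj : Function.Surjective T₁ := by
    intro k
    -- The preimage of `k` is `(k / W) ∘ Θ'`; a left inverse of `Θ` suffices, because the formula is
    -- only evaluated along `Θ`.
    set f₀ : ℝ → ℂ := fun y => k (Θ' y) / W (Θ' y) with hf₀
    have hf₀m : Measurable f₀ := ((hm k).comp hΘ').div (hW.comp hΘ')
    have hk : (fun x => W x * f₀ (Θ x)) =ᵐ[leb01] k := by
      filter_upwards [hinv, hW0] with x h1 h2
      simp only [hf₀, h1]
      exact mul_div_cancel₀ _ h2
    have hmem₀ : MemLp f₀ p leb01 := ⟨hf₀m.aestronglyMeasurable, by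
      rw [← eLpNorm_weighted_comp hp₁ hp₂ hW hΘ hcv hf₀m, eLpNorm_congr_ae hk]
      exact Lp.eLpNorm_lt_top k⟩
    refine ⟨hmem₀.toLp f₀, ?_⟩
    apply Lp.ext
    filter_upwards [hT₀ (hmem₀.toLp f₀), hq.ae hmem₀.coeFn_toLp, hk] with x h1 h2 h3
    change T₀ (hmem₀.toLp f₀) x = k x
    rw [h1, h2, h3]
  refine ⟨LinearIsometryEquiv.ofSurjective T₁ hsurj, fun f g => ?_, hW, hq, hT₀⟩
  have hD : MeasurableSet {y | f y * g y = 0} :=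
    ((hm f).mul (hm g)) (measurableSet_singleton 0)
  change (∀ᵐ x ∂leb01, T₀ f x * T₀ g x = 0) ↔ ∀ᵐ x ∂leb01, f x * g x = 0
  constructor
  · intro h
    have h1 : ∀ᵐ x ∂leb01, f (Θ x) * g (Θ x) = 0 := by
      filter_upwards [h, hT₀ f, hT₀ g, hW0] with x h1 h2 h3 h4
      rw [h2, h3, mul_mul_mul_comm] at h1
      exact (mul_eq_zero.1 h1).resolve_left (mul_ne_zero h4 h4)
    -- A property of `Θ x` for almost every `x` holds almost everywhere, since Lebesgue measure is
    -- the image under `Θ` of a measure absolutely continuous with respect to it.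
    have h2 := (ae_map_iff hΘ.aemeasurable hD).2
      ((withDensity_absolutelyContinuous leb01 fun x => ‖W x‖ₑ ^ p.toReal).ae_le h1)
    rw [hcv] at h2
    exact h2
  · intro h
    filter_upwards [hq.ae h, hT₀ f, hT₀ g] with x h1 h2 h3
    rw [h2, h3, mul_mul_mul_comm, h1, mul_zero]

/-- Multiplication by a unimodular function. -/
theorem exists_isometry_unimodular [Fact (1 ≤ p)] (hp₁ : 1 < p) (hp₂ : p ≠ ∞) (hW : Measurable W)
    (hW1 : ∀ x, ‖W x‖ = 1) : ∃ T ∈ disjointnessPreserving p, IsWeightedComp T W id := by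
  refine exists_isometry hp₁ hp₂ hW measurable_id measurable_id
    (Eventually.of_forall fun x => rfl)
    (Eventually.of_forall fun x => norm_ne_zero_iff.1 (by rw [hW1]; exact one_ne_zero)) ?_
  have : (fun x => ‖W x‖ₑ ^ p.toReal) = 1 := by
    ext x
    rw [← ofReal_norm, hW1, ENNReal.ofReal_one, ENNReal.one_rpow, Pi.one_apply]
  rw [this, withDensity_one, Measure.map_id]

end

/-! ## Rearranging a measurable set into an interval -/

/-- The distribution function of Lebesgue measure on `A`. -/
def distrib01 (A : Set ℝ) (x : ℝ) : ℝ := volume.real (A ∩ Set.Iic x)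

/-- A left inverse of the distribution function. -/
def distribInv (A : Set ℝ) (c : ℝ) : ℝ :=
  open Classical in
  ⨆ q : ℚ, if distrib01 A q < c ∧ (q : ℝ) ≤ 1 then (q : ℝ) else 0

section

variable {A : Set ℝ}

theorem volume_inter_ne_top (hA : A ⊆ Set.Ioo 0 1) (B : Set ℝ) :
    volume (A ∩ B) ≠ ∞ :=
  ((measure_mono (Set.inter_subset_left.trans hA)).trans_lt (by simp)).ne

theorem distrib01_mono (hA : A ⊆ Set.Ioo 0 1) : Monotone (distrib01 A) := fun _ _ hxy =>
  measureReal_mono (Set.inter_subset_inter_right _ (Set.Iic_subset_Iic.2 hxy))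
    (volume_inter_ne_top hA _)

theorem distrib01_sub_le (hA : A ⊆ Set.Ioo 0 1) {x y : ℝ} (hxy : x ≤ y) :
    distrib01 A y - distrib01 A x ≤ y - x := by
  have h1 : A ∩ Set.Iic y ⊆ (A ∩ Set.Iic x) ∪ Set.Ioc x y := by
    rintro z ⟨hz, hz'⟩
    rcases le_or_gt z x with h | h
    · exact Or.inl ⟨hz, h⟩
    · exact Or.inr ⟨h, hz'⟩
  have h2 : distrib01 A y ≤ distrib01 A x + volume.real (Set.Ioc x y) :=
    (measureReal_mono h1 (measure_union_ne_top (volume_inter_ne_top hA _) (by simp))).trans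
      (measureReal_union_le _ _)
  rw [Real.volume_real_Ioc_of_le hxy] at h2
  linarith

theorem continuous_distrib01 (hA : A ⊆ Set.Ioo 0 1) : Continuous (distrib01 A) := by
  have : LipschitzWith 1 (distrib01 A) := by
    refine LipschitzWith.of_le_add fun x y => ?_
    rcases le_total x y with h | h
    · have := distrib01_mono hA h
      linarith [dist_nonneg (x := x) (y := y)]
    · have := distrib01_sub_le hA h
      rw [Real.dist_eq, abs_of_nonneg (by linarith)]
      linarith
  exact this.continuous

/-- The fibres of the distribution function are null. -/
theorem volume_distrib01_fibre (hA : A ⊆ Set.Ioo 0 1) (x : ℝ) :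
    volume (A ∩ {y | x < y ∧ distrib01 A y = distrib01 A x}) = 0 := by
  set E := {y | x < y ∧ distrib01 A y = distrib01 A x} with hE
  have hnull : ∀ y ∈ E, volume (A ∩ Set.Ioc x y) = 0 := by
    rintro y ⟨hxy, hy⟩
    have h1 := measure_inter_add_sdiff (μ := volume) (A ∩ Set.Iic y) (measurableSet_Iic (a := x))
    have e1 : A ∩ Set.Iic y ∩ Set.Iic x = A ∩ Set.Iic x := by
      rw [Set.inter_assoc, Set.Iic_inter_Iic, min_eq_right hxy.le]
    have e2 : (A ∩ Set.Iic y) \ Set.Iic x = A ∩ Set.Ioc x y := by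
      ext z
      simp only [Set.mem_sdiff, Set.mem_inter_iff, Set.mem_Iic, Set.mem_Ioc, not_le]
      tauto
    have e3 : volume (A ∩ Set.Iic y) = volume (A ∩ Set.Iic x) :=
      (measureReal_eq_measureReal_iff (volume_inter_ne_top hA _) (volume_inter_ne_top hA _)).1 hy
    rw [e1, e2, e3] at h1
    exact (ENNReal.add_right_inj (volume_inter_ne_top hA _)).1 (h1.trans (add_zero _).symm)
  -- The fibre is covered by countably many null sets with rational right endpoints, except possibly
  -- for its largest element.
  have hsub : A ∩ E ⊆ (⋃ q ∈ {q : ℚ | volume (A ∩ Set.Ioc x q) = 0}, A ∩ Set.Ioc x (q : ℝ)) ∪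
      {y | y ∈ E ∧ ∀ z ∈ E, z ≤ y} := by
    rintro y ⟨hyA, hyE⟩
    by_cases h : ∀ z ∈ E, z ≤ y
    · exact Or.inr ⟨hyE, h⟩
    · push Not at h
      obtain ⟨z, hz, hyz⟩ := h
      obtain ⟨q, hq, hq'⟩ := exists_rat_btwn hyz
      left
      simp only [Set.mem_iUnion]
      refine ⟨q, ?_, hyA, hyE.1, hq.le⟩
      exact measure_mono_null
        (Set.inter_subset_inter_right _ (Set.Ioc_subset_Ioc_right hq'.le)) (hnull z hz)
  refine measure_mono_null hsub (measure_union_null ?_ ?_)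
  · exact (measure_biUnion_null_iff (Set.to_countable _)).2 fun q hq => hq
  · refine Set.Subsingleton.measure_zero (fun y hy z hz => ?_) _
    exact le_antisymm (hz.2 y hy.1) (hy.2 z hz.1)

/-- A continuous distribution function transports its measure to Lebesgue measure. Half-lines
suffice for the comparison: if `c` is the value at `x`, the sublevel set of `c` in `A` is `A ∩ (-∞,
x]` up to a null fibre. -/
theorem map_distrib01 (hA : A ⊆ Set.Ioo 0 1) :
    (volume.restrict A).map (distrib01 A) = volume.restrict (Set.Ioo 0 (volume.real A)) := by
  have hfin : volume A ≠ ∞ := by simpa using volume_inter_ne_top hA Set.univ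
  have : IsFiniteMeasure (volume.restrict A) := ⟨by
    rw [Measure.restrict_apply_univ]; exact hfin.lt_top⟩
  have hmeas := (continuous_distrib01 hA).measurable
  refine Measure.ext_of_Iic _ _ fun c => ?_
  rw [Measure.map_apply hmeas measurableSet_Iic, Measure.restrict_apply (hmeas measurableSet_Iic),
    Measure.restrict_apply measurableSet_Iic]
  have h0 : distrib01 A 0 = 0 := by
    have : A ∩ Set.Iic 0 = ∅ := by
      ext z
      simp only [Set.mem_inter_iff, Set.mem_Iic, Set.mem_empty_iff_false, iff_false, not_and]
      intro hz; have := (hA hz).1; linarith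
    rw [distrib01, this, measureReal_empty]
  have h1 : distrib01 A 1 = volume.real A := by
    have : A ∩ Set.Iic 1 = A := Set.inter_eq_left.2 fun z hz => (hA hz).2.le
    rw [distrib01, this]
  have hle : ∀ x, distrib01 A x ≤ volume.real A := fun x =>
    measureReal_mono Set.inter_subset_left hfin
  rcases lt_or_ge c 0 with hc | hc
  · have e1 : distrib01 A ⁻¹' Set.Iic c ∩ A = ∅ := by
      ext z
      simp only [Set.mem_inter_iff, Set.mem_preimage, Set.mem_Iic, Set.mem_empty_iff_false,
        iff_false, not_and]
      intro hz
      have : 0 ≤ distrib01 A z := measureReal_nonneg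
      linarith
    have e2 : Set.Iic c ∩ Set.Ioo 0 (volume.real A) = ∅ := by
      ext z
      simp only [Set.mem_inter_iff, Set.mem_Iic, Set.mem_Ioo, Set.mem_empty_iff_false, iff_false]
      rintro ⟨a, b, -⟩
      linarith
    rw [e1, e2]
  rcases le_or_gt (volume.real A) c with hc' | hc'
  · have e1 : distrib01 A ⁻¹' Set.Iic c ∩ A = A :=
      Set.inter_eq_right.2 fun z _ => (hle z).trans hc'
    have e2 : Set.Iic c ∩ Set.Ioo 0 (volume.real A) = Set.Ioo 0 (volume.real A) :=
      Set.inter_eq_right.2 fun z hz => hz.2.le.trans hc'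
    rw [e1, e2, Real.volume_Ioo, sub_zero, ofReal_measureReal]
  · obtain ⟨x, hx, hxc⟩ := intermediate_value_Icc zero_le_one (continuous_distrib01 hA).continuousOn
      (show c ∈ Set.Icc (distrib01 A 0) (distrib01 A 1) by rw [h0, h1]; exact ⟨hc, hc'.le⟩)
    have e2 : Set.Iic c ∩ Set.Ioo 0 (volume.real A) = Set.Ioc 0 c := by
      ext z
      simp only [Set.mem_inter_iff, Set.mem_Iic, Set.mem_Ioo, Set.mem_Ioc]
      exact ⟨fun h => ⟨h.2.1, h.1⟩, fun h => ⟨h.2, h.1, h.2.trans_lt hc'⟩⟩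
    have e1 : distrib01 A ⁻¹' Set.Iic c ∩ A =
        (A ∩ Set.Iic x) ∪ (A ∩ {y | x < y ∧ distrib01 A y = distrib01 A x}) := by
      ext z
      simp only [Set.mem_inter_iff, Set.mem_preimage, Set.mem_Iic, Set.mem_union,
        Set.mem_ofPred_eq, hxc]
      constructor
      · rintro ⟨h1, h2⟩
        rcases le_or_gt z x with h | h
        · exact Or.inl ⟨h2, h⟩
        · exact Or.inr ⟨h2, h, le_antisymm h1 (hxc ▸ distrib01_mono hA h.le)⟩
      · rintro (⟨h1, h2⟩ | ⟨h1, h2, h3⟩)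
        · exact ⟨hxc ▸ distrib01_mono hA h2, h1⟩
        · exact ⟨h3.le, h1⟩
    have e3 : volume (A ∩ Set.Iic x) = ENNReal.ofReal c := by
      rw [← hxc, distrib01, ofReal_measureReal (volume_inter_ne_top hA _)]
    rw [e1, e2, Real.volume_Ioc, sub_zero, ← e3]
    refine le_antisymm ((measure_union_le _ _).trans ?_) (measure_mono Set.subset_union_left)
    rw [volume_distrib01_fibre hA x, add_zero]

theorem measurable_distribInv (A : Set ℝ) : Measurable (distribInv A) := by
  classical
  refine Measurable.iSup fun q => ?_
  refine Measurable.ite ?_ measurable_const measurable_const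
  exact measurableSet_Ioi.inter (MeasurableSet.const _)

/-- Off the countably many null fibres at rational points, a rational has a smaller distribution
value than `x` exactly when it is below `x`, so the supremum recovers `x`. The cut-off `q ≤ 1` is
harmless since `x < 1`. -/
theorem distribInv_distrib01 (hA : A ⊆ Set.Ioo 0 1) (hAm : MeasurableSet A) :
    ∀ᵐ x ∂volume.restrict A, distribInv A (distrib01 A x) = x := by
  have h : ∀ᵐ x ∂volume.restrict A, ∀ q : ℚ,
      ¬((q : ℝ) < x ∧ distrib01 A x = distrib01 A q) := by
    rw [ae_all_iff]
    intro q
    rw [ae_restrict_iff' hAm]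
    have := measure_eq_zero_iff_ae_notMem.1 (volume_distrib01_fibre hA (q : ℝ))
    filter_upwards [this] with x hx hxA hx'
    exact hx ⟨hxA, hx'⟩
  filter_upwards [h, ae_restrict_mem hAm] with x hx hxA
  have hval : ∀ q : ℚ, (distrib01 A q < distrib01 A x ∧ (q : ℝ) ≤ 1) ↔ (q : ℝ) < x := by
    intro q
    constructor
    · rintro ⟨h1, -⟩
      by_contra hlt
      exact absurd (distrib01_mono hA (not_lt.1 hlt)) (not_le.2 h1)
    · intro hq
      refine ⟨lt_of_le_of_ne (distrib01_mono hA hq.le) fun he => hx q ⟨hq, he.symm⟩, ?_⟩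
      have := (hA hxA).2
      linarith
  simp only [distribInv, hval]
  have hx0 := (hA hxA).1
  have hbd : ∀ q : ℚ, (if (q : ℝ) < x then (q : ℝ) else 0) ≤ x := by
    intro q
    split_ifs with h
    · exact h.le
    · exact hx0.le
  refine le_antisymm (ciSup_le hbd) ?_
  refine le_of_forall_lt fun c hc => ?_
  obtain ⟨q, hq, hq'⟩ := exists_rat_btwn hc
  refine lt_of_lt_of_le hq ?_
  refine le_trans ?_ (le_ciSup (f := fun q : ℚ => if (q : ℝ) < x then (q : ℝ) else 0)
    ⟨x, by rintro _ ⟨q, rfl⟩; exact hbd q⟩ q)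
  simp only [hq', if_true, le_refl]

end

section

variable {A : Set ℝ}

open Classical in
/-- The map rearranging `A` into an initial interval and its complement into a final one. -/
def rearrange (A : Set ℝ) (x : ℝ) : ℝ :=
  if x ∈ A then distrib01 A x else volume.real A + distrib01 (Set.Ioo 0 1 \ A) x

open Classical in
/-- A left inverse of `rearrange A`. -/
def rearrangeInv (A : Set ℝ) (y : ℝ) : ℝ :=
  if y < volume.real A then distribInv A y else distribInv (Set.Ioo 0 1 \ A) (y - volume.real A)

theorem measurable_rearrange (hA : A ⊆ Set.Ioo 0 1) (hAm : MeasurableSet A) :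
    Measurable (rearrange A) :=
  Measurable.ite hAm (continuous_distrib01 hA).measurable
    ((continuous_distrib01 Set.sdiff_subset).measurable.const_add _)

theorem measurable_rearrangeInv (A : Set ℝ) : Measurable (rearrangeInv A) :=
  Measurable.ite measurableSet_Iio (measurable_distribInv A)
    ((measurable_distribInv _).comp (measurable_id.sub_const _))

theorem leb01_eq_add (hA : A ⊆ Set.Ioo 0 1) (hAm : MeasurableSet A) :
    leb01 = volume.restrict A + volume.restrict (Set.Ioo 0 1 \ A) := by
  rw [← Measure.restrict_union Set.disjoint_sdiff_right (measurableSet_Ioo.diff hAm),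
    Set.union_sdiff_cancel hA]

theorem distrib01_mem_ae (hA : A ⊆ Set.Ioo 0 1) :
    ∀ᵐ x ∂volume.restrict A, distrib01 A x ∈ Set.Ioo 0 (volume.real A) := by
  have h : ∀ᵐ y ∂(volume.restrict A).map (distrib01 A), y ∈ Set.Ioo 0 (volume.real A) := by
    rw [map_distrib01 hA]
    exact ae_restrict_mem measurableSet_Ioo
  exact (ae_map_iff (continuous_distrib01 hA).aemeasurable measurableSet_Ioo).1 h

theorem rearrangeInv_rearrange (hA : A ⊆ Set.Ioo 0 1) (hAm : MeasurableSet A) :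
    ∀ᵐ x ∂leb01, rearrangeInv A (rearrange A x) = x := by
  rw [leb01_eq_add hA hAm, ae_add_measure_iff]
  constructor
  · filter_upwards [ae_restrict_mem hAm, distrib01_mem_ae hA, distribInv_distrib01 hA hAm]
      with x h1 h2 h3
    rw [rearrange, if_pos h1, rearrangeInv, if_pos h2.2, h3]
  · have hm := measurableSet_Ioo.diff hAm (s₁ := Set.Ioo (0 : ℝ) 1)
    filter_upwards [ae_restrict_mem hm, distribInv_distrib01 Set.sdiff_subset hm] with x h1 h3
    have h2 : 0 ≤ distrib01 (Set.Ioo 0 1 \ A) x := measureReal_nonneg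
    rw [rearrange, if_neg h1.2, rearrangeInv, if_neg (by linarith), add_sub_cancel_left, h3]

theorem map_rearrange (hA : A ⊆ Set.Ioo 0 1) (hAm : MeasurableSet A) :
    leb01.map (rearrange A) = leb01 := by
  have hΘ := measurable_rearrange hA hAm
  have hm := measurableSet_Ioo.diff hAm (s₁ := Set.Ioo (0 : ℝ) 1)
  have hfin : volume A ≠ ∞ := by simpa using volume_inter_ne_top hA Set.univ
  set m := volume.real A with hmdef
  have hm1 : m ≤ 1 := by
    have := measureReal_mono hA (μ := volume) (by simp)
    rwa [Real.volume_real_Ioo_of_le zero_le_one, sub_zero] at this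
  have hm0 : 0 ≤ m := measureReal_nonneg
  have hm' : volume.real (Set.Ioo 0 1 \ A) = 1 - m := by
    rw [measureReal_sdiff hA hAm (h₁ := by simp), Real.volume_real_Ioo_of_le zero_le_one, sub_zero]
  have e1 : (volume.restrict A).map (rearrange A) = volume.restrict (Set.Ioo 0 m) := by
    rw [← map_distrib01 hA]
    refine Measure.map_congr ?_
    filter_upwards [ae_restrict_mem hAm] with x hx
    rw [rearrange, if_pos hx]
  have e2 : (volume.restrict (Set.Ioo 0 1 \ A)).map (rearrange A) =
      volume.restrict (Set.Ioo m 1) := by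
    have h1 : (volume.restrict (Set.Ioo 0 1 \ A)).map (rearrange A) =
        (volume.restrict (Set.Ioo 0 1 \ A)).map
          ((fun y => m + y) ∘ distrib01 (Set.Ioo 0 1 \ A)) := by
      refine Measure.map_congr ?_
      filter_upwards [ae_restrict_mem hm] with x hx
      rw [rearrange, if_neg hx.2]
      rfl
    rw [h1, ← Measure.map_map (measurable_const_add m)
      (continuous_distrib01 Set.sdiff_subset).measurable, map_distrib01 Set.sdiff_subset, hm']
    ext S hS
    rw [Measure.map_apply (measurable_const_add m) hS,
      Measure.restrict_apply ((measurable_const_add m) hS), Measure.restrict_apply hS,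
      ← measure_preimage_add volume m (S ∩ Set.Ioo m 1)]
    congr 1
    ext y
    simp only [Set.mem_inter_iff, Set.mem_preimage, Set.mem_Ioo]
    refine and_congr_right fun _ => ?_
    constructor <;> rintro ⟨a, b⟩ <;> constructor <;> linarith
  conv_lhs => rw [leb01_eq_add hA hAm]
  rw [Measure.map_add _ _ hΘ, e1, e2]
  have hd : Disjoint (Set.Ioo 0 m) (Set.Ioo m 1) := by
    rw [Set.disjoint_left]
    rintro y ⟨_, h1⟩ ⟨h2, _⟩
    linarith
  rw [← Measure.restrict_union hd measurableSet_Ioo]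
  refine Measure.restrict_congr_set ?_
  have hne : ∀ᵐ y : ℝ ∂volume, y ≠ m := by
    rw [ae_iff]
    simp
  filter_upwards [hne] with y hy
  apply propext
  change y ∈ Set.Ioo 0 m ∪ Set.Ioo m 1 ↔ y ∈ Set.Ioo 0 1
  simp only [Set.mem_union, Set.mem_Ioo]
  constructor
  · rintro (⟨a, b⟩ | ⟨a, b⟩) <;> constructor <;> linarith
  · rintro ⟨a, b⟩
    rcases lt_or_gt_of_ne hy with h | h
    · exact Or.inl ⟨a, h⟩
    · exact Or.inr ⟨h, b⟩

/-- Some isometry maps the indicator of an interval to the indicator of `A`. -/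
theorem exists_isometry_indLp {p : ℝ≥0∞} [Fact (1 ≤ p)] (hp₁ : 1 < p) (hp₂ : p ≠ ∞)
    (hA : A ⊆ Set.Ioo 0 1) (hAm : MeasurableSet A) :
    ∃ T ∈ disjointnessPreserving p,
      T (indLp p (measurableSet_Ioo (a := 0) (b := volume.real A))) = indLp p hAm := by
  obtain ⟨T, hT, hW, hq, hTf⟩ := exists_isometry hp₁ hp₂ (W := fun _ => 1) measurable_const
    (measurable_rearrange hA hAm) (measurable_rearrangeInv A) (rearrangeInv_rearrange hA hAm)
    (by simp) (by simpa using map_rearrange hA hAm)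
  refine ⟨T, hT, ?_⟩
  apply Lp.ext
  have key : ∀ᵐ x ∂leb01, rearrange A x ∈ Set.Ioo 0 (volume.real A) ↔ x ∈ A := by
    rw [leb01_eq_add hA hAm, ae_add_measure_iff]
    constructor
    · filter_upwards [ae_restrict_mem hAm, distrib01_mem_ae hA] with x h1 h2
      rw [rearrange, if_pos h1]
      exact iff_of_true h2 h1
    · filter_upwards [ae_restrict_mem (measurableSet_Ioo.diff hAm)] with x h1
      have h2 : 0 ≤ distrib01 (Set.Ioo 0 1 \ A) x := measureReal_nonneg
      rw [rearrange, if_neg h1.2]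
      exact iff_of_false (fun h => by linarith [h.2]) h1.2
  filter_upwards [hTf (indLp p (measurableSet_Ioo (a := 0) (b := volume.real A))),
    hq.ae (indLp_ae p (measurableSet_Ioo (a := 0) (b := volume.real A))), indLp_ae p hAm, key]
    with x h1 h2 h3 h4
  rw [h1, h2, h3, one_mul]
  by_cases hx : x ∈ A
  · rw [Set.indicator_of_mem hx, Set.indicator_of_mem (h4.2 hx)]
  · rw [Set.indicator_of_notMem hx, Set.indicator_of_notMem fun h => hx (h4.1 h)]

end

/-! ## Exchanging two intervals -/

section

variable {s b t : ℝ}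

open Classical in
/-- The affine exchange of the intervals `(0, s)` and `(b, b + t)`. -/
def swapMap (s b t x : ℝ) : ℝ :=
  if x ∈ Set.Ioo 0 s then b + t / s * x else
    if x ∈ Set.Ioo b (b + t) then s / t * (x - b) else x

open Classical in
/-- The weight of the isometry of `L_q` exchanging the intervals `(0, s)` and `(b, b + t)`. -/
def swapWeight (q s b t x : ℝ) : ℝ :=
  if x ∈ Set.Ioo 0 s then (t / s) ^ (1 / q) else
    if x ∈ Set.Ioo b (b + t) then (s / t) ^ (1 / q) else 1

theorem measurable_swapMap (s b t : ℝ) : Measurable (swapMap s b t) := by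
  unfold swapMap
  exact Measurable.ite measurableSet_Ioo (by fun_prop)
    (Measurable.ite measurableSet_Ioo (by fun_prop) measurable_id)

theorem measurable_swapWeight (q s b t : ℝ) : Measurable (swapWeight q s b t) := by
  unfold swapWeight
  exact Measurable.ite measurableSet_Ioo measurable_const
    (Measurable.ite measurableSet_Ioo measurable_const measurable_const)

theorem swapMap_left {x : ℝ} (hx : x ∈ Set.Ioo 0 s) : swapMap s b t x = b + t / s * x :=
  if_pos hx

theorem swap_notMem (hsb : s ≤ b) {x : ℝ} (hx : x ∈ Set.Ioo b (b + t)) : x ∉ Set.Ioo 0 s :=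
  fun h => by linarith [h.2, hx.1]

theorem swapMap_right (hsb : s ≤ b) {x : ℝ} (hx : x ∈ Set.Ioo b (b + t)) :
    swapMap s b t x = s / t * (x - b) := by
  rw [swapMap, if_neg (swap_notMem hsb hx), if_pos hx]

theorem swapWeight_right (q : ℝ) (hsb : s ≤ b) {x : ℝ} (hx : x ∈ Set.Ioo b (b + t)) :
    swapWeight q s b t x = (s / t) ^ (1 / q) := by
  rw [swapWeight, if_neg (swap_notMem hsb hx), if_pos hx]

theorem swap_mem_right (hs : 0 < s) (ht : 0 < t) {x : ℝ} (hx : x ∈ Set.Ioo 0 s) :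
    b + t / s * x ∈ Set.Ioo b (b + t) := by
  have h1 : 0 < t / s * x := mul_pos (div_pos ht hs) hx.1
  have h2 : t / s * x < t := by
    rw [div_mul_eq_mul_div, div_lt_iff₀ hs]
    exact mul_lt_mul_of_pos_left hx.2 ht
  constructor <;> linarith

theorem swap_mem_left (hs : 0 < s) (ht : 0 < t) {x : ℝ} (hx : x ∈ Set.Ioo b (b + t)) :
    s / t * (x - b) ∈ Set.Ioo 0 s := by
  have hx1 : 0 < x - b := by linarith [hx.1]
  refine ⟨mul_pos (div_pos hs ht) hx1, ?_⟩
  rw [div_mul_eq_mul_div, div_lt_iff₀ ht]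
  exact mul_lt_mul_of_pos_left (by linarith [hx.2]) hs

theorem swapMap_swapMap (hs : 0 < s) (ht : 0 < t) (hsb : s ≤ b) (x : ℝ) :
    swapMap s b t (swapMap s b t x) = x := by
  by_cases h1 : x ∈ Set.Ioo 0 s
  · rw [swapMap_left h1, swapMap_right hsb (swap_mem_right hs ht h1)]
    field_simp
    ring
  by_cases h2 : x ∈ Set.Ioo b (b + t)
  · rw [swapMap_right hsb h2, swapMap_left (swap_mem_left hs ht h2)]
    field_simp
    ring
  · have : swapMap s b t x = x := by rw [swapMap, if_neg h1, if_neg h2]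
    rw [this, this]

/-- The image of Lebesgue measure under an affine map between intervals. -/
theorem map_affine {a s c t : ℝ} (hs : 0 < s) (ht : 0 < t) {Θ : ℝ → ℝ} (hΘ : Measurable Θ)
    (h : ∀ x ∈ Set.Ioo a (a + s), Θ x = c + t / s * (x - a)) :
    (ENNReal.ofReal (t / s) • volume.restrict (Set.Ioo a (a + s))).map Θ =
      volume.restrict (Set.Ioo c (c + t)) := by
  have hk : t / s ≠ 0 := by positivity
  ext S hS
  rw [Measure.map_apply hΘ hS, Measure.smul_apply, Measure.restrict_apply (hΘ hS),
    Measure.restrict_apply hS, smul_eq_mul]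
  have e : Θ ⁻¹' S ∩ Set.Ioo a (a + s) =
      (fun x => x + -a) ⁻¹' ((fun x => t / s * x) ⁻¹' ((fun x => c + x) ⁻¹'
        (S ∩ Set.Ioo c (c + t)))) := by
    ext x
    simp only [Set.mem_inter_iff, Set.mem_preimage, ← sub_eq_add_neg]
    have hiff : x ∈ Set.Ioo a (a + s) ↔ c + t / s * (x - a) ∈ Set.Ioo c (c + t) := by
      simp only [Set.mem_Ioo, lt_add_iff_pos_right, add_lt_add_iff_left]
      rw [div_mul_eq_mul_div, div_lt_iff₀ hs, mul_lt_mul_iff_right₀ ht,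
        lt_div_iff₀ hs, zero_mul, mul_pos_iff_of_pos_left ht, sub_pos, sub_lt_iff_lt_add']
    rw [← hiff]
    refine and_congr_left fun hx => ?_
    rw [h x hx]
  rw [e, measure_preimage_add_right, Real.volume_preimage_mul_left hk, measure_preimage_add,
    ← mul_assoc, ← ENNReal.ofReal_mul (by positivity), abs_of_pos (by positivity),
    mul_inv_cancel₀ hk, ENNReal.ofReal_one, one_mul]

theorem withDensity_eq_smul {α : Type*} [MeasurableSpace α] {μ : Measure α} {f : α → ℝ≥0∞}
    {c : ℝ≥0∞} (h : ∀ᵐ x ∂μ, f x = c) : μ.withDensity f = c • μ := by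
  rw [← withDensity_const]
  exact withDensity_congr_ae h

/-- The weight raised to the power `q` is the Jacobian of the exchange: `t / s` on the first
interval, `s / t` on the second, and `1` elsewhere, where nothing moves. -/
theorem map_swapMap {q : ℝ} (hq : 0 < q) (hs : 0 < s) (ht : 0 < t) (hsb : s ≤ b)
    (hb : b + t ≤ 1) :
    (leb01.withDensity fun x => ‖(swapWeight q s b t x : ℂ)‖ₑ ^ q).map (swapMap s b t) =
      leb01 := by
  have hm := measurable_swapMap s b t
  have hsub : Set.Ioo 0 s ∪ Set.Ioo b (b + t) ⊆ Set.Ioo 0 1 := by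
    rintro x (⟨h1, h2⟩ | ⟨h1, h2⟩) <;> constructor <;> linarith
  have hd : Disjoint (Set.Ioo 0 s) (Set.Ioo b (b + t)) := by
    rw [Set.disjoint_right]
    exact fun x hx => swap_notMem hsb hx
  have hum : MeasurableSet (Set.Ioo 0 s ∪ Set.Ioo b (b + t)) :=
    measurableSet_Ioo.union measurableSet_Ioo
  obtain ⟨R, hR⟩ : ∃ R, R = Set.Ioo (0 : ℝ) 1 \ (Set.Ioo 0 s ∪ Set.Ioo b (b + t)) := ⟨_, rfl⟩
  have hRm : MeasurableSet R := hR ▸ measurableSet_Ioo.diff hum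
  have hR1 : ∀ x ∈ R, x ∉ Set.Ioo 0 s := fun x hx h => (hR ▸ hx).2 (Or.inl h)
  have hR2 : ∀ x ∈ R, x ∉ Set.Ioo b (b + t) := fun x hx h => (hR ▸ hx).2 (Or.inr h)
  have hleb : leb01 = volume.restrict (Set.Ioo 0 s) + volume.restrict (Set.Ioo b (b + t)) +
      volume.restrict R := by
    rw [leb01_eq_add hsub hum, Measure.restrict_union hd measurableSet_Ioo, hR]
  have hpow : ∀ u : ℝ, 0 < u → ‖((u ^ (1 / q) : ℝ) : ℂ)‖ₑ ^ q = ENNReal.ofReal u := by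
    intro u hu
    rw [← ofReal_norm, Complex.norm_real, Real.norm_of_nonneg (by positivity),
      ENNReal.ofReal_rpow_of_nonneg (by positivity) hq.le, ← Real.rpow_mul hu.le,
      one_div_mul_cancel hq.ne', Real.rpow_one]
  have hdens : leb01.withDensity (fun x => ‖(swapWeight q s b t x : ℂ)‖ₑ ^ q) =
      ENNReal.ofReal (t / s) • volume.restrict (Set.Ioo 0 s) +
      ENNReal.ofReal (s / t) • volume.restrict (Set.Ioo b (b + t)) + volume.restrict R := by
    rw [hleb, withDensity_add_measure, withDensity_add_measure,
      withDensity_eq_smul (μ := volume.restrict (Set.Ioo 0 s)) (c := ENNReal.ofReal (t / s)),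
      withDensity_eq_smul (μ := volume.restrict (Set.Ioo b (b + t)))
        (c := ENNReal.ofReal (s / t)),
      withDensity_eq_smul (μ := volume.restrict R) (c := 1), one_smul]
    · filter_upwards [ae_restrict_mem hRm] with x hx
      rw [swapWeight, if_neg (hR1 x hx), if_neg (hR2 x hx)]
      simp
    · filter_upwards [ae_restrict_mem measurableSet_Ioo] with x hx
      rw [swapWeight_right q hsb hx, hpow _ (by positivity)]
    · filter_upwards [ae_restrict_mem measurableSet_Ioo] with x hx
      rw [swapWeight, if_pos hx, hpow _ (by positivity)]
  rw [hdens, Measure.map_add _ _ hm, Measure.map_add _ _ hm]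
  have e1 := map_affine (a := 0) (c := b) hs ht hm fun x hx => by
    rw [zero_add] at hx
    rw [swapMap_left hx, sub_zero]
  have e2 := map_affine (a := b) (c := 0) ht hs hm fun x hx => by
    rw [swapMap_right hsb hx, zero_add]
  rw [zero_add] at e1 e2
  have e3 : (volume.restrict R).map (swapMap s b t) = volume.restrict R := by
    conv_rhs => rw [← Measure.map_id (μ := volume.restrict R)]
    refine Measure.map_congr ?_
    filter_upwards [ae_restrict_mem hRm] with x hx
    rw [swapMap, if_neg (hR1 x hx), if_neg (hR2 x hx), id]
  rw [e1, e2, e3]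
  conv_rhs => rw [hleb]
  rw [add_comm (volume.restrict (Set.Ioo b (b + t)))]

/-- The isometry exchanging two intervals. -/
theorem exists_isometry_swap {p : ℝ≥0∞} [Fact (1 ≤ p)] (hp₁ : 1 < p) (hp₂ : p ≠ ∞)
    (hs : 0 < s) (ht : 0 < t) (hsb : s ≤ b) (hb : b + t ≤ 1) :
    ∃ T ∈ disjointnessPreserving p,
      IsWeightedComp T (fun x => (swapWeight p.toReal s b t x : ℂ)) (swapMap s b t) ∧
      T (indLp p (measurableSet_Ioo (a := 0) (b := s))) =
        (((s / t) ^ (1 / p.toReal) : ℝ) : ℂ) •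
          indLp p (measurableSet_Ioo (a := b) (b := b + t)) := by
  have hp := one_lt_toReal hp₁ hp₂
  obtain ⟨T, hT, hTW⟩ := exists_isometry hp₁ hp₂
    (Complex.measurable_ofReal.comp (measurable_swapWeight p.toReal s b t))
    (measurable_swapMap s b t) (measurable_swapMap s b t)
    (Eventually.of_forall (swapMap_swapMap hs ht hsb))
    (Eventually.of_forall fun x => by
      simp only [Function.comp_apply, ne_eq, Complex.ofReal_eq_zero]
      unfold swapWeight
      split_ifs <;> positivity)
    (map_swapMap (by linarith) hs ht hsb hb)
  refine ⟨T, hT, hTW, ?_⟩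
  obtain ⟨-, hq, hTf⟩ := hTW
  apply Lp.ext
  filter_upwards [hTf (indLp p (measurableSet_Ioo (a := 0) (b := s))),
    hq.ae (indLp_ae p (measurableSet_Ioo (a := 0) (b := s))),
    Lp.coeFn_smul (((s / t) ^ (1 / p.toReal) : ℝ) : ℂ)
      (indLp p (measurableSet_Ioo (a := b) (b := b + t))),
    indLp_ae p (measurableSet_Ioo (a := b) (b := b + t)), ae_restrict_mem measurableSet_Ioo]
    with x h1 h2 h3 h4 h5
  rw [h1, h2, h3, Pi.smul_apply, h4, smul_eq_mul, Function.comp_apply]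
  by_cases hx : x ∈ Set.Ioo b (b + t)
  · rw [swapWeight_right _ hsb hx, swapMap_right hsb hx, Set.indicator_of_mem hx,
      Set.indicator_of_mem (swap_mem_left hs ht hx)]
  · rw [Set.indicator_of_notMem hx, mul_zero, Set.indicator_of_notMem, mul_zero]
    by_cases hx' : x ∈ Set.Ioo 0 s
    · rw [swapMap_left hx']
      exact swap_notMem hsb (swap_mem_right hs ht hx')
    · rwa [swapMap, if_neg hx', if_neg hx]

end

/-! ## Invariant subspaces are `L_∞`-modules -/

/-- A point of the closed disc is the midpoint of a chord of the unit circle perpendicular to its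
radius. -/
theorem exp_add_arccos_eq (a : ℂ) (ha : ‖a‖ ≤ 1) :
    Complex.exp ((a.arg + Real.arccos ‖a‖ : ℝ) * Complex.I) +
      Complex.exp ((a.arg - Real.arccos ‖a‖ : ℝ) * Complex.I) = 2 * a := by
  have h1 : Complex.exp ((a.arg + Real.arccos ‖a‖ : ℝ) * Complex.I) =
      Complex.exp (a.arg * Complex.I) * Complex.exp (Real.arccos ‖a‖ * Complex.I) := by
    rw [← Complex.exp_add]; push_cast; ring_nf
  have h2 : Complex.exp ((a.arg - Real.arccos ‖a‖ : ℝ) * Complex.I) =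
      Complex.exp (a.arg * Complex.I) * Complex.exp (-Real.arccos ‖a‖ * Complex.I) := by
    rw [← Complex.exp_add]; push_cast; ring_nf
  have h3 : Complex.exp (Real.arccos ‖a‖ * Complex.I) +
      Complex.exp (-Real.arccos ‖a‖ * Complex.I) = 2 * (‖a‖ : ℂ) := by
    rw [← Complex.two_cos, ← Complex.ofReal_cos,
      Real.cos_arccos (by linarith [norm_nonneg a]) ha]
  have h4 := Complex.norm_mul_exp_arg_mul_I a
  rw [h1, h2, ← mul_add, h3]
  linear_combination 2 * h4

section Module

variable {p : ℝ≥0∞} [Fact (1 ≤ p)] {Y₀ : Submodule ℂ (LpI p)}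

/-- Multiplication by `a` is the mean of two multiplications by unimodular functions, and these
belong to the group. -/
theorem mem_of_bounded_mul (hp₁ : 1 < p) (hp₂ : p ≠ ∞)
    (hY : ∀ T ∈ disjointnessPreserving p, ∀ y ∈ Y₀, T y ∈ Y₀) {y : LpI p} (hy : y ∈ Y₀)
    {a : ℝ → ℂ} (ha : Measurable a) (ha1 : ∀ x, ‖a x‖ ≤ 1) {k : LpI p}
    (hk : ∀ᵐ x ∂leb01, k x = a x * y x) : k ∈ Y₀ := by
  have harg : Measurable fun x => (a x).arg := Complex.measurable_arg.comp ha
  have hcos : Measurable fun x => Real.arccos ‖a x‖ := Real.measurable_arccos.comp ha.norm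
  have hexp : ∀ r : ℝ → ℝ, Measurable r → Measurable fun x => Complex.exp (r x * Complex.I) :=
    fun r hr => Complex.measurable_exp.comp ((Complex.measurable_ofReal.comp hr).mul_const _)
  obtain ⟨T, hT, -, -, hT'⟩ := exists_isometry_unimodular hp₁ hp₂ (hexp _ (harg.add hcos))
    (fun x => Complex.norm_exp_ofReal_mul_I _)
  obtain ⟨S, hS, -, -, hS'⟩ := exists_isometry_unimodular hp₁ hp₂ (hexp _ (harg.sub hcos))
    (fun x => Complex.norm_exp_ofReal_mul_I _)
  have e : k = (2⁻¹ : ℂ) • (T y + S y) := by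
    apply Lp.ext
    filter_upwards [hk, hT' y, hS' y, Lp.coeFn_smul (2⁻¹ : ℂ) (T y + S y),
      Lp.coeFn_add (T y) (S y)] with x h1 h2 h3 h4 h5
    rw [h1, h4, Pi.smul_apply, h5, Pi.add_apply, h2, h3, smul_eq_mul, id, ← add_mul, ← mul_assoc]
    have := exp_add_arccos_eq (a x) (ha1 x)
    rw [Pi.add_apply, Pi.sub_apply, this]
    ring
  rw [e]
  exact Y₀.smul_mem _ (Y₀.add_mem (hY T hT y hy) (hY S hS y hy))

theorem indLp_mem_of_subset (hp₁ : 1 < p) (hp₂ : p ≠ ∞)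
    (hY : ∀ T ∈ disjointnessPreserving p, ∀ y ∈ Y₀, T y ∈ Y₀) {A B : Set ℝ}
    (hA : MeasurableSet A) (hB : MeasurableSet B) (hBY : indLp p hB ∈ Y₀) (hAB : A ⊆ B) :
    indLp p hA ∈ Y₀ := by
  refine mem_of_bounded_mul hp₁ hp₂ hY hBY (a := A.indicator fun _ => 1)
    (measurable_const.indicator hA) (fun x => ?_) ?_
  · by_cases hx : x ∈ A <;> simp [hx]
  · filter_upwards [indLp_ae p hA, indLp_ae p hB] with x h1 h2
    rw [h1, h2]
    by_cases hx : x ∈ A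
    · simp [hx, hAB hx]
    · simp [hx]

theorem indLp_univ_ne_zero (hp₂ : p ≠ ∞) : indLp p MeasurableSet.univ ≠ 0 := by
  intro h
  have h1 := map_indLp_univ_ne_zero (p := p) hp₂ (T := 1) (disjointnessPreserving p).one_mem
  have h2 : (1 : IsomLp p) (indLp p MeasurableSet.univ) = 0 := h
  rw [h2] at h1
  have h3 : ∀ᵐ x ∂leb01, False := by
    filter_upwards [h1, Lp.coeFn_zero ℂ p leb01] with x h1 h2
    exact h1 h2
  rw [ae_iff] at h3
  simp at h3

/-- A dense invariant subspace contains the indicator of some interval. -/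
theorem exists_indLp_Ioo_mem (hp₁ : 1 < p) (hp₂ : p ≠ ∞)
    (hY : ∀ T ∈ disjointnessPreserving p, ∀ y ∈ Y₀, T y ∈ Y₀) (hd : Dense (Y₀ : Set (LpI p))) :
    ∃ m : ℝ, 0 < m ∧ m ≤ 1 ∧ indLp p (measurableSet_Ioo (a := 0) (b := m)) ∈ Y₀ := by
  obtain ⟨y, hy, hy0⟩ : ∃ y ∈ Y₀, y ≠ 0 := by
    by_contra h
    push Not at h
    have h1 : (Y₀ : Set (LpI p)) ⊆ {0} := fun y hy => h y hy
    have h2 := hd.closure_eq ▸ closure_mono h1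
    rw [closure_singleton] at h2
    exact indLp_univ_ne_zero hp₂ (h2 (Set.mem_univ _))
  have hym : Measurable y := (Lp.stronglyMeasurable y).measurable
  obtain ⟨n, hn⟩ : ∃ n : ℕ, leb01 {x | ((n : ℝ) + 1)⁻¹ ≤ ‖y x‖} ≠ 0 := by
    by_contra h
    push Not at h
    apply hy0
    apply Lp.ext
    filter_upwards [ae_all_iff.2 fun n => measure_eq_zero_iff_ae_notMem.1 (h n),
      Lp.coeFn_zero ℂ p leb01] with x h1 h2
    rw [h2]
    by_contra hne
    obtain ⟨n, hn⟩ := exists_nat_one_div_lt (norm_pos_iff.2 hne)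
    rw [one_div] at hn
    exact h1 n hn.le
  set ε : ℝ := ((n : ℝ) + 1)⁻¹ with hε
  have hε0 : 0 < ε := by positivity
  have hSm : MeasurableSet {x | ε ≤ ‖y x‖} := measurableSet_le measurable_const hym.norm
  set A := {x | ε ≤ ‖y x‖} ∩ Set.Ioo 0 1 with hA
  have hAm : MeasurableSet A := hSm.inter measurableSet_Ioo
  have hAsub : A ⊆ Set.Ioo 0 1 := Set.inter_subset_right
  have hAfin : volume A ≠ ∞ := by simpa using volume_inter_ne_top hAsub Set.univ
  have hpos : 0 < volume.real A := by
    rw [Measure.restrict_apply hSm] at hn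
    exact ENNReal.toReal_pos hn hAfin
  have hle : volume.real A ≤ 1 := by
    have := measureReal_mono hAsub (μ := volume) (h₂ := by simp)
    rwa [Real.volume_real_Ioo_of_le zero_le_one, sub_zero] at this
  have hAY : indLp p hAm ∈ Y₀ := by
    have h1 : (ε : ℂ) • indLp p hAm ∈ Y₀ := by
      -- On `A` the function `y` is at least `ε` in modulus, so `ε / y` is an admissible multiplier
      -- there.
      refine mem_of_bounded_mul hp₁ hp₂ hY hy (a := A.indicator fun x => ε / y x)
        ((measurable_const.div hym).indicator hAm) (fun x => ?_) ?_
      · by_cases hx : x ∈ A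
        · rw [Set.indicator_of_mem hx, norm_div, Complex.norm_real, Real.norm_of_nonneg hε0.le]
          exact div_le_one_of_le₀ hx.1 (norm_nonneg _)
        · rw [Set.indicator_of_notMem hx, norm_zero]
          exact zero_le_one
      · filter_upwards [indLp_ae p hAm, Lp.coeFn_smul (ε : ℂ) (indLp p hAm)] with x h1 h2
        rw [h2, Pi.smul_apply, h1]
        by_cases hx : x ∈ A
        · have hne : y x ≠ 0 := norm_pos_iff.1 (hε0.trans_le hx.1)
          rw [Set.indicator_of_mem hx, Set.indicator_of_mem hx, div_mul_cancel₀ _ hne,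
            smul_eq_mul, mul_one]
        · rw [Set.indicator_of_notMem hx, Set.indicator_of_notMem hx, smul_zero, zero_mul]
    have h2 := Y₀.smul_mem (ε : ℂ)⁻¹ h1
    rwa [smul_smul, inv_mul_cancel₀ (by exact_mod_cast hε0.ne'), one_smul] at h2
  -- Undoing the measure preserving rearrangement turns `A` into an interval of the same measure.
  obtain ⟨T, hT, hTA⟩ := exists_isometry_indLp hp₁ hp₂ hAsub hAm
  refine ⟨volume.real A, hpos, hle, ?_⟩
  have h := hY T⁻¹ (inv_mem hT) _ hAY
  rw [← hTA] at h
  have e : T⁻¹ (T (indLp p (measurableSet_Ioo (a := 0) (b := volume.real A)))) =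
      indLp p (measurableSet_Ioo (a := 0) (b := volume.real A)) := T.symm_apply_apply _
  rwa [e] at h

end Module

/-! ## Elementary estimates -/

section

variable {p : ℝ≥0∞}

/-- Hölder's inequality: an `L_p` error at most `K` times the norm of the indicator of `A` has mean
modulus at most `K` on `A`. Mean errors on sets of different size can then be added, which is how
the estimates below are combined. -/
theorem lintegral_enorm_le_of_Lp [Fact (1 ≤ p)] (hp₁ : 1 < p) (hp₂ : p ≠ ∞) (f : LpI p)
    {A : Set ℝ} {K : ℝ} (h : ‖f‖ ≤ K * leb01.real A ^ (1 / p.toReal)) :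
    ∫⁻ x in A, ‖f x‖ₑ ∂leb01 ≤ ENNReal.ofReal (K * leb01.real A) := by
  have hp := one_lt_toReal hp₁ hp₂
  have h1 := eLpNorm_le_eLpNorm_mul_rpow_measure_univ (μ := leb01.restrict A) hp₁.le
    (f := f) (Lp.aestronglyMeasurable f).restrict
  rw [eLpNorm_one_eq_lintegral_enorm, Measure.restrict_apply_univ, ENNReal.toReal_one] at h1
  refine h1.trans ?_
  have h2 : eLpNorm f p (leb01.restrict A) ≤ ENNReal.ofReal ‖f‖ := by
    rw [Lp.norm_def, ENNReal.ofReal_toReal (Lp.eLpNorm_ne_top f)]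
    exact eLpNorm_mono_measure _ Measure.restrict_le_self
  have hexp : 0 ≤ 1 / 1 - 1 / p.toReal := by
    rw [sub_nonneg, div_one]
    exact (div_le_one (by linarith)).2 hp.le
  have h3 : leb01 A ^ (1 / 1 - 1 / p.toReal) =
      ENNReal.ofReal (leb01.real A ^ (1 / 1 - 1 / p.toReal)) := by
    rw [← ENNReal.ofReal_rpow_of_nonneg measureReal_nonneg hexp, ofReal_measureReal]
  rw [h3]
  refine (mul_le_mul_left h2 _).trans ?_
  rw [← ENNReal.ofReal_mul (norm_nonneg _)]
  refine ENNReal.ofReal_le_ofReal ?_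
  rcases (measureReal_nonneg (μ := leb01) (s := A)).eq_or_lt with h0 | h0
  · rw [← h0] at h ⊢
    rw [Real.zero_rpow (by positivity), mul_zero] at h
    rw [le_antisymm h (norm_nonneg _)]
    simp
  · calc ‖f‖ * leb01.real A ^ (1 / 1 - 1 / p.toReal)
        ≤ K * leb01.real A ^ (1 / p.toReal) * leb01.real A ^ (1 / 1 - 1 / p.toReal) := by gcongr
      _ = K * leb01.real A := by
        rw [mul_assoc, ← Real.rpow_add h0]
        simp

theorem norm_indLp (hp₁ : 1 < p) (hp₂ : p ≠ ∞) {A : Set ℝ} (hA : MeasurableSet A) :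
    ‖indLp p hA‖ = leb01.real A ^ (1 / p.toReal) := by
  rw [norm_indicatorConstLp (by positivity) hp₂, norm_one, one_mul]

theorem leb01_real_Ioo {a b : ℝ} (ha : 0 ≤ a) (hab : a ≤ b) (hb : b ≤ 1) :
    leb01.real (Set.Ioo a b) = b - a := by
  rw [measureReal_restrict_apply measurableSet_Ioo, Set.inter_eq_left.2
    (Set.Ioo_subset_Ioo ha hb), Real.volume_real_Ioo_of_le hab]

end

/-- Two equidistributed functions with integrable difference have the same mean. -/
theorem integral_sub_eq_zero_of_map_eq {μ : Measure ℝ} [IsFiniteMeasure μ] {ρ ρ' : ℝ → ℝ}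
    (hρ : Measurable ρ) (hρ' : Measurable ρ') (h : μ.map ρ = μ.map ρ') {g : ℝ → ℝ}
    (hg : Measurable g) (hi : Integrable (fun x => g (ρ x) - g (ρ' x)) μ) :
    ∫ x, (g (ρ x) - g (ρ' x)) ∂μ = 0 := by
  -- Neither function need be integrable on its own. Truncations are, and have equal means; being
  -- 1-Lipschitz, their differences are dominated by the integrable difference.
  set clamp : ℕ → ℝ → ℝ := fun n t => max (-(n : ℝ)) (min n t) with hclamp
  have hcm : ∀ n, Measurable (clamp n) := fun n => by fun_prop
  have hlip : ∀ n s t, |clamp n s - clamp n t| ≤ |s - t| := fun n s t => by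
    refine (abs_max_sub_max_le_max _ _ _ _).trans ?_
    rw [sub_self, abs_zero]
    refine max_le (abs_nonneg _) ((abs_min_sub_min_le_max _ _ _ _).trans ?_)
    rw [sub_self, abs_zero]
    exact max_le (abs_nonneg _) le_rfl
  have hbd : ∀ n t, |clamp n t| ≤ n := fun n t => by
    have hn : (0 : ℝ) ≤ n := Nat.cast_nonneg n
    exact abs_le.2 ⟨le_max_left _ _, max_le (by linarith) (min_le_left _ _)⟩
  have hint : ∀ n (σ : ℝ → ℝ), Measurable σ → Integrable (fun x => clamp n (g (σ x))) μ :=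
    fun n σ hσ => Integrable.of_bound
      ((hcm n).comp (hg.comp hσ)).aestronglyMeasurable n (Eventually.of_forall fun x => hbd n _)
  have hzero : ∀ n, ∫ x, (clamp n (g (ρ x)) - clamp n (g (ρ' x))) ∂μ = 0 := fun n => by
    have e : ∀ σ : ℝ → ℝ, Measurable σ →
        ∫ x, clamp n (g (σ x)) ∂μ = ∫ y, clamp n (g y) ∂(μ.map σ) := fun σ hσ =>
      (integral_map hσ.aemeasurable ((hcm n).comp hg).aestronglyMeasurable).symm
    rw [integral_sub (hint n ρ hρ) (hint n ρ' hρ'), e ρ hρ, e ρ' hρ', h, sub_self]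
  have hlim : ∀ t : ℝ, Tendsto (fun n => clamp n t) atTop (𝓝 t) := fun t => by
    obtain ⟨N, hN⟩ := exists_nat_ge |t|
    refine tendsto_const_nhds.congr' ?_
    filter_upwards [eventually_ge_atTop N] with n hn
    have h1 : |t| ≤ n := hN.trans (by exact_mod_cast hn)
    rw [abs_le] at h1
    rw [hclamp]
    simp only [min_eq_right h1.2, max_eq_right h1.1]
  have htend := tendsto_integral_of_dominated_convergence (μ := μ)
    (F := fun n x => clamp n (g (ρ x)) - clamp n (g (ρ' x)))
    (f := fun x => g (ρ x) - g (ρ' x)) (fun x => |g (ρ x) - g (ρ' x)|)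
    (fun n => ((hint n ρ hρ).sub (hint n ρ' hρ')).aestronglyMeasurable) hi.abs
    (fun n => Eventually.of_forall fun x => hlip n _ _)
    (Eventually.of_forall fun x => (hlim _).sub (hlim _))
  simp only [hzero] at htend
  exact (tendsto_nhds_unique htend tendsto_const_nhds)

/-! ## The Kalton-Peck map is not a linear perturbation of a centralizer -/

/-- The indicator function of an interval. -/
abbrev indIoo (p : ℝ≥0∞) (a b : ℝ) : LpI p := indLp p (measurableSet_Ioo (a := a) (b := b))

/-- Subdivision of an interval. -/
theorem restrict_Ioo_eq_sum {δ : ℝ} (hδ : 0 < δ) (n : ℕ) :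
    volume.restrict (Set.Ioo δ (δ + n * δ)) =
      ∑ j ∈ Finset.range n, volume.restrict (Set.Ioo ((j + 1) * δ) ((j + 1) * δ + δ)) := by
  induction n with
  | zero => simp
  | succ n ih =>
    rw [Finset.sum_range_succ, ← ih]
    have e1 : (n + 1 : ℝ) * δ = δ + n * δ := by ring
    have hn : (0 : ℝ) ≤ n * δ := by positivity
    rw [e1]
    have hd : Disjoint (Set.Ioo δ (δ + n * δ)) (Set.Ioo (δ + n * δ) (δ + n * δ + δ)) := by
      rw [Set.disjoint_left]
      rintro x ⟨_, h⟩ ⟨h', _⟩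
      linarith
    rw [← Measure.restrict_union hd measurableSet_Ioo]
    refine Measure.restrict_congr_set ?_
    have hne : ∀ᵐ y : ℝ ∂volume, y ≠ δ + n * δ := by
      rw [ae_iff]
      simp
    filter_upwards [hne] with y hy
    apply propext
    change y ∈ Set.Ioo δ (δ + (n + 1 : ℕ) * δ) ↔
      y ∈ Set.Ioo δ (δ + n * δ) ∪ Set.Ioo (δ + n * δ) (δ + n * δ + δ)
    simp only [Set.mem_union, Set.mem_Ioo]
    push_cast
    constructor
    · rintro ⟨a, b⟩
      rcases lt_or_gt_of_ne hy with h | h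
      · exact Or.inl ⟨a, h⟩
      · exact Or.inr ⟨h, by linarith⟩
    · rintro (⟨a, b⟩ | ⟨a, b⟩) <;> constructor <;> linarith

theorem floor_of_mem {δ : ℝ} (hδ : 0 < δ) {j : ℕ} {x : ℝ}
    (hx : x ∈ Set.Ioo ((j + 1) * δ) ((j + 1) * δ + δ)) : ⌊x / δ⌋₊ = j + 1 := by
  have hx0 : 0 ≤ x := le_trans (by positivity) hx.1.le
  rw [Nat.floor_eq_iff (by positivity), le_div_iff₀ hδ, div_lt_iff₀ hδ]
  push_cast
  constructor
  · exact hx.1.le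
  · linarith [hx.2]

theorem indIoo_eq_sum (p : ℝ≥0∞) {δ : ℝ} (hδ : 0 < δ) (n : ℕ) :
    indIoo p δ (δ + n * δ) =
      ∑ j ∈ Finset.range n, indIoo p ((j + 1) * δ) ((j + 1) * δ + δ) := by
  induction n with
  | zero =>
    rw [Finset.sum_range_zero]
    exact indLp_eq_zero p _ (by simp)
  | succ n ih =>
    rw [Finset.sum_range_succ, ← ih]
    have e1 : (n + 1 : ℝ) * δ = δ + n * δ := by ring
    have hn : (0 : ℝ) ≤ n * δ := by positivity
    have hd : Disjoint (Set.Ioo δ (δ + n * δ)) (Set.Ioo ((n + 1) * δ) ((n + 1) * δ + δ)) := by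
      rw [Set.disjoint_left, e1]
      rintro x ⟨_, h⟩ ⟨h', _⟩
      linarith
    refine indLp_add p _ _ _ hd ?_
    have hne : ∀ᵐ y : ℝ ∂leb01, y ≠ δ + n * δ := by
      refine ae_restrict_of_ae ?_
      rw [ae_iff]
      simp
    filter_upwards [hne] with y hy
    simp only [Set.mem_union, Set.mem_Ioo, e1]
    push_cast
    constructor
    · rintro ⟨a, b⟩
      rcases lt_or_gt_of_ne hy with h | h
      · exact Or.inl ⟨a, h⟩
      · exact Or.inr ⟨h, by linarith⟩
    · rintro (⟨a, b⟩ | ⟨a, b⟩) <;> constructor <;> linarith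

/-! ### Exchange and averaging estimates for a hypothetical linear perturbation -/

section Perturbation

variable {p : ℝ≥0∞} [Fact (1 ≤ p)] {Y₀ : Submodule ℂ (LpI p)} {L : Y₀ →ₗ[ℂ] L0} {C : ℝ}

/-- The commutators of the weighted composition isometries with `L` differ from those given by the
Kalton-Peck map by maps of norm at most `C`. -/
def HasBoundedCommutators (L : Y₀ →ₗ[ℂ] L0) (C : ℝ) : Prop :=
  ∀ T ∈ disjointnessPreserving p, ∀ W Θ, IsWeightedComp T W Θ →
    ∀ (y : Y₀) (hTy : T y ∈ Y₀), ∃ e : LpI p, ‖e‖ ≤ C * ‖(y : LpI p)‖ ∧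
      ∀ᵐ x ∂leb01, e x = W x * L y (Θ x) - L ⟨T y, hTy⟩ x - (Real.log ‖W x‖ : ℂ) * T y x

theorem L0_smul_ae (c : ℂ) (k : L0) : ∀ᵐ x ∂leb01, (c • k : L0) x = c * k x :=
  AEEqFun.coeFn_smul c k

/-- The exchange isometry sends the first indicator to `c` times the second, with weight `c = (s /
t) ^ (1 / p)` on the second interval. Dividing the commutator error by `c` leaves the constant `log
c`, which is the only trace of the Kalton-Peck map; the norms of the indicators absorb the factor `1
/ c`. -/
theorem exists_swap_estimate (hp₁ : 1 < p) (hp₂ : p ≠ ∞)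
    (hL : HasBoundedCommutators L C) {s b t : ℝ} (hs : 0 < s) (ht : 0 < t) (hsb : s ≤ b)
    (hb : b + t ≤ 1) (h1 : indIoo p 0 s ∈ Y₀) (h2 : indIoo p b (b + t) ∈ Y₀) :
    ∃ e : LpI p, ∫⁻ x in Set.Ioo b (b + t), ‖e x‖ₑ ∂leb01 ≤ ENNReal.ofReal (C * t) ∧
      ∀ᵐ x ∂leb01, x ∈ Set.Ioo b (b + t) →
        e x = L ⟨_, h1⟩ (s / t * (x - b)) - L ⟨_, h2⟩ x
          - (1 / p.toReal * Real.log (s / t) : ℝ) := by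
  have hp := one_lt_toReal hp₁ hp₂
  obtain ⟨T, hT, hTW, hT1⟩ := exists_isometry_swap hp₁ hp₂ hs ht hsb hb
  set c : ℝ := (s / t) ^ (1 / p.toReal) with hc
  have hst : 0 < s / t := by positivity
  have hc0 : 0 < c := by positivity
  have hcC : (c : ℂ) ≠ 0 := by exact_mod_cast hc0.ne'
  have hTy : T (indIoo p 0 s) ∈ Y₀ := by
    rw [hT1]; exact Y₀.smul_mem _ h2
  obtain ⟨e, he, hex⟩ := hL T hT _ _ hTW ⟨_, h1⟩ hTy
  have hLT : L ⟨T (indIoo p 0 s), hTy⟩ = (c : ℂ) • L ⟨_, h2⟩ := by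
    rw [← map_smul]
    congr 1
    exact Subtype.ext hT1
  refine ⟨(c : ℂ)⁻¹ • e, ?_, ?_⟩
  · have hreal : leb01.real (Set.Ioo b (b + t)) = t := by
      rw [leb01_real_Ioo (by linarith) (by linarith) hb]; ring
    have := lintegral_enorm_le_of_Lp hp₁ hp₂ ((c : ℂ)⁻¹ • e) (A := Set.Ioo b (b + t)) (K := C) ?_
    · rwa [hreal] at this
    · rw [hreal, norm_smul, norm_inv, Complex.norm_real, Real.norm_of_nonneg hc0.le,
        inv_mul_le_iff₀ hc0]
      refine he.trans (le_of_eq ?_)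
      rw [norm_indLp hp₁ hp₂, leb01_real_Ioo le_rfl hs.le (by linarith), sub_zero,
        hc, Real.div_rpow hs.le ht.le]
      have : t ^ (1 / p.toReal) ≠ 0 := by positivity
      field_simp
  · rw [hLT] at hex
    have hT1' : ∀ᵐ x ∂leb01, T (indIoo p 0 s) x = c * indIoo p b (b + t) x := by
      rw [hT1]
      exact Lp.coeFn_smul _ _
    filter_upwards [hex, Lp.coeFn_smul (c : ℂ)⁻¹ e, L0_smul_ae (c : ℂ) (L ⟨_, h2⟩), hT1',
      indLp_ae p (measurableSet_Ioo (a := b) (b := b + t))] with x a1 a2 a3 a4 a5 hx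
    rw [a2, Pi.smul_apply, a1, a3, a4, a5, Set.indicator_of_mem hx, swapWeight_right _ hsb hx,
      swapMap_right hsb hx, smul_eq_mul, ← hc, Complex.norm_real, Real.norm_of_nonneg hc0.le, hc,
      Real.log_rpow hst, ← hc]
    push_cast
    field_simp

/-- Averaging over the powers of a unimodular function. -/
theorem exists_average_estimate (hp₁ : 1 < p) (hp₂ : p ≠ ∞)
    (hY : ∀ T ∈ disjointnessPreserving p, ∀ y ∈ Y₀, T y ∈ Y₀)
    (hL : HasBoundedCommutators L C) {δ : ℝ} (hδ : 0 < δ) (n : ℕ) (hn : δ + n * δ ≤ 1)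
    (hB : indIoo p δ (δ + n * δ) ∈ Y₀)
    (w : ℕ → Y₀) (hw : ∀ j < n, (w j : LpI p) = indIoo p ((j + 1) * δ) ((j + 1) * δ + δ)) :
    ∃ e : LpI p, ∫⁻ x in Set.Ioo δ (δ + n * δ), ‖e x‖ₑ ∂leb01 ≤ ENNReal.ofReal (C * (n * δ)) ∧
      ∀ j < n, ∀ᵐ x ∂leb01, x ∈ Set.Ioo ((j + 1) * δ) ((j + 1) * δ + δ) →
        L (w j) x = L ⟨_, hB⟩ x + e x := by
  -- On the piece with index `j` the integer part of `x / δ` is `j + 1`, so the exponents run from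
  -- `1` to `n`; an `N`-th root of unity with `N = n + 1` separates them.
  set N := n + 1 with hN
  set ω : ℂ := Complex.exp (2 * Real.pi * Complex.I / N) with hω
  have hprim : IsPrimitiveRoot ω N := by
    have := Complex.isPrimitiveRoot_exp N (by omega)
    exact this
  have hω1 : ‖ω‖ = 1 := hprim.norm'_eq_one (by omega)
  have hω0 : ω ≠ 0 := norm_ne_zero_iff.1 (by rw [hω1]; exact one_ne_zero)
  set u : ℝ → ℂ := fun x => ω ^ ⌊x / δ⌋₊ with hu
  have hum : Measurable u := (measurable_from_top (f := fun k : ℕ => ω ^ k)).comp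
    (Nat.measurable_floor.comp (measurable_id.div_const δ))
  have hu1 : ∀ x, ‖u x‖ = 1 := fun x => by rw [hu, norm_pow, hω1, one_pow]
  have hu0 : ∀ x, u x ≠ 0 := fun x => norm_ne_zero_iff.1 (by rw [hu1]; exact one_ne_zero)
  have huk1 : ∀ (k : ℕ) x, ‖u x ^ k‖ = 1 := fun k x => by rw [norm_pow, hu1, one_pow]
  have hT := fun k : ℕ => exists_isometry_unimodular hp₁ hp₂ (hum.pow_const k) (huk1 k)
  choose T hTd hTW using hT
  have hTB : ∀ k, T k (indIoo p δ (δ + n * δ)) = ∑ i ∈ Finset.range n,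
      (ω ^ (i + 1)) ^ k • indIoo p ((i + 1) * δ) ((i + 1) * δ + δ) := by
    intro k
    rw [indIoo_eq_sum p hδ, map_sum]
    refine Finset.sum_congr rfl fun i _ => ?_
    apply Lp.ext
    filter_upwards [(hTW k).2.2 (indIoo p ((i + 1) * δ) ((i + 1) * δ + δ)),
      Lp.coeFn_smul ((ω ^ (i + 1)) ^ k) (indIoo p ((i + 1) * δ) ((i + 1) * δ + δ)),
      indLp_ae p (measurableSet_Ioo (a := (i + 1) * δ) (b := (i + 1) * δ + δ))] with x h1 h2 h3
    rw [h1, h2, Pi.smul_apply, id, h3, smul_eq_mul]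
    by_cases hx : x ∈ Set.Ioo ((i + 1) * δ) ((i + 1) * δ + δ)
    · rw [hu]
      simp only [floor_of_mem hδ hx]
    · rw [Set.indicator_of_notMem hx, mul_zero, mul_zero]
  have hmem : ∀ k, T k (indIoo p δ (δ + n * δ)) ∈ Y₀ := fun k => hY _ (hTd k) _ hB
  have hLB : ∀ k, L ⟨_, hmem k⟩ = ∑ i ∈ Finset.range n, (ω ^ (i + 1)) ^ k • L (w i) := by
    intro k
    simp only [← map_smul]
    rw [← map_sum]
    congr 1
    apply Subtype.ext
    rw [Submodule.coe_sum]
    refine (hTB k).trans (Finset.sum_congr rfl fun i hi => ?_)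
    rw [Submodule.coe_smul, hw i (Finset.mem_range.1 hi)]
  have hLBx : ∀ k, ∀ᵐ x ∂leb01, L ⟨_, hmem k⟩ x =
      ∑ i ∈ Finset.range n, (ω ^ (i + 1)) ^ k * L (w i) x := by
    intro k
    rw [hLB k]
    filter_upwards [AEEqFun.coeFn_finsetSum (Finset.range n)
      (fun i => (ω ^ (i + 1)) ^ k • L (w i)), ae_all_iff.2 fun i : ℕ =>
        L0_smul_ae ((ω ^ (i + 1)) ^ k) (L (w i))] with x h1 h2
    rw [h1, Finset.sum_apply]
    exact Finset.sum_congr rfl fun i _ => h2 i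
  have he := fun k : ℕ => hL (T k) (hTd k) _ _ (hTW k) ⟨_, hB⟩ (hmem k)
  choose e hen hex using he
  -- Applying `T k` inverse divides the error by `u ^ k` without changing its norm, so the
  -- normalized errors can be averaged at no cost.
  have hsymm : ∀ k, ∀ᵐ x ∂leb01, e k x = u x ^ k * (T k).symm (e k) x := by
    intro k
    have := (hTW k).2.2 ((T k).symm (e k))
    rw [(T k).apply_symm_apply] at this
    exact this
  have hNC : (N : ℂ) ≠ 0 := by exact_mod_cast (by omega : N ≠ 0)
  have hNR : (0 : ℝ) < N := by exact_mod_cast (by omega : 0 < N)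
  refine ⟨-((N : ℂ)⁻¹ • ∑ k ∈ Finset.range N, (T k).symm (e k)), ?_, ?_⟩
  · have hreal : leb01.real (Set.Ioo δ (δ + n * δ)) = n * δ := by
      rw [leb01_real_Ioo hδ.le (by linarith [show (0 : ℝ) ≤ n * δ by positivity]) hn]; ring
    have := lintegral_enorm_le_of_Lp hp₁ hp₂
      (-((N : ℂ)⁻¹ • ∑ k ∈ Finset.range N, (T k).symm (e k)))
      (A := Set.Ioo δ (δ + n * δ)) (K := C) ?_
    · rwa [hreal] at this
    · rw [norm_neg, norm_smul, norm_inv, Complex.norm_natCast, inv_mul_le_iff₀ hNR]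
      refine (norm_sum_le _ _).trans ?_
      refine (Finset.sum_le_card_nsmul _ _ (C * ‖indIoo p δ (δ + n * δ)‖) fun k _ => ?_).trans ?_
      · rw [LinearIsometryEquiv.norm_map]
        exact hen k
      · rw [Finset.card_range, nsmul_eq_mul, norm_indLp hp₁ hp₂]
  · intro j hjn
    filter_upwards [ae_all_iff.2 hex, ae_all_iff.2 hLBx, ae_all_iff.2 hsymm,
      Lp.coeFn_neg ((N : ℂ)⁻¹ • ∑ k ∈ Finset.range N, (T k).symm (e k)),
      Lp.coeFn_smul (N : ℂ)⁻¹ (∑ k ∈ Finset.range N, (T k).symm (e k)),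
      Lp.coeFn_finsetSum (Finset.range N) fun k => (T k).symm (e k)] with x a1 a2 a3 a4 a5 a6 hx
    have hux : u x = ω ^ (j + 1) := by
      rw [hu]
      simp only [floor_of_mem hδ hx]
    have hk : ∀ k, (T k).symm (e k) x = L ⟨_, hB⟩ x -
        ∑ i ∈ Finset.range n, (ω ^ (i + 1) / ω ^ (j + 1)) ^ k * L (w i) x := by
      intro k
      have h1 := a1 k
      rw [a3 k, a2 k, huk1, Real.log_one, Complex.ofReal_zero, zero_mul, sub_zero, id] at h1
      have h2 : u x ^ k ≠ 0 := pow_ne_zero _ (hu0 x)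
      apply mul_left_cancel₀ h2
      rw [h1, mul_sub, Finset.mul_sum]
      congr 1
      refine Finset.sum_congr rfl fun i _ => ?_
      rw [← mul_assoc, ← mul_pow, hux, mul_div_cancel₀ _ (pow_ne_zero _ hω0)]
    -- Orthogonality of characters: for `i ≠ j` the ratio is an `N`-th root of unity other than `1`,
    -- so only the piece containing `x` survives the average.
    have hgeom : ∀ i ∈ Finset.range n,
        ∑ k ∈ Finset.range N, (ω ^ (i + 1) / ω ^ (j + 1)) ^ k * L (w i) x =
          if i = j then N * L (w j) x else 0 := by
      intro i hi
      rw [← Finset.sum_mul]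
      split_ifs with hij
      · subst hij
        rw [div_self (pow_ne_zero _ hω0)]
        simp
      · have hne : ω ^ (i + 1) / ω ^ (j + 1) ≠ 1 := by
          rw [Ne, div_eq_one_iff_eq (pow_ne_zero _ hω0)]
          intro h
          have := hprim.pow_inj (by have := Finset.mem_range.1 hi; omega) (by omega) h
          omega
        have hpow : ∀ k : ℕ, (ω ^ k) ^ N = 1 := fun k => by
          rw [← pow_mul, mul_comm, pow_mul, hprim.pow_eq_one, one_pow]
        rw [geom_sum_eq hne, div_pow, hpow, hpow]
        simp
    have hsum : ∑ k ∈ Finset.range N, (T k).symm (e k) x =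
        N * L ⟨_, hB⟩ x - N * L (w j) x := by
      simp only [hk]
      rw [Finset.sum_sub_distrib, Finset.sum_comm, Finset.sum_congr rfl hgeom,
        Finset.sum_ite_eq' (Finset.range n) j, if_pos (Finset.mem_range.2 hjn)]
      simp
    rw [a4, Pi.neg_apply, a5, Pi.smul_apply, a6, Finset.sum_apply, hsum, smul_eq_mul, ← mul_sub,
      inv_mul_cancel_left₀ hNC]
    ring

end Perturbation

/-- Stretching an interval and cutting it into pieces distribute it in the same way. -/
theorem map_stretch_eq_map_cut {δ : ℝ} (hδ : 0 < δ) {n : ℕ} (hn : 0 < n) :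
    (volume.restrict (Set.Ioo δ (δ + n * δ))).map (fun x => δ / (n * δ) * (x - δ)) =
      (volume.restrict (Set.Ioo δ (δ + n * δ))).map (fun x => x - ⌊x / δ⌋₊ * δ) := by
  have hn0 : (0 : ℝ) < n := by exact_mod_cast hn
  have hP : Measurable fun x : ℝ => δ / (n * δ) * (x - δ) := by fun_prop
  have hQ : Measurable fun x : ℝ => x - ⌊x / δ⌋₊ * δ :=
    measurable_id.sub (((measurable_from_top (f := fun k : ℕ => (k : ℝ))).comp
      (Nat.measurable_floor.comp (measurable_id.div_const δ))).mul_const δ)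
  have e1 := map_affine (a := δ) (c := 0) (by positivity : 0 < n * δ) hδ hP
    fun x _ => by rw [zero_add]
  have e2 : ∀ j : ℕ, (volume.restrict (Set.Ioo ((j + 1) * δ) ((j + 1) * δ + δ))).map
      (fun x => x - ⌊x / δ⌋₊ * δ) = volume.restrict (Set.Ioo 0 (0 + δ)) := by
    intro j
    have := map_affine (a := (j + 1) * δ) (c := 0) hδ hδ hQ fun x hx => by
      rw [floor_of_mem hδ hx, div_self hδ.ne']
      push_cast
      ring
    rwa [div_self hδ.ne', ENNReal.ofReal_one, one_smul] at this
  -- Cutting translates each piece onto `(0, δ)`, stacking `n` copies of Lebesgue measure;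
  -- stretching has the same image because it contracts lengths by the factor `n`.
  have e3 : ∀ k : ℕ, (∑ j ∈ Finset.range k,
      volume.restrict (Set.Ioo ((j + 1) * δ) ((j + 1) * δ + δ))).map
      (fun x => x - ⌊x / δ⌋₊ * δ) = (k : ℝ≥0∞) • volume.restrict (Set.Ioo 0 (0 + δ)) := by
    intro k
    induction k with
    | zero => simp
    | succ k ih =>
      rw [Finset.sum_range_succ, Measure.map_add _ _ hQ, ih, e2]
      push_cast
      rw [add_smul, one_smul]
  conv_rhs => rw [restrict_Ioo_eq_sum hδ]
  rw [e3, ← e1, Measure.map_smul, smul_smul]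
  have : (n : ℝ≥0∞) * ENNReal.ofReal (δ / (n * δ)) = 1 := by
    rw [← ENNReal.ofReal_natCast, ← ENNReal.ofReal_mul hn0.le]
    have : (n : ℝ) * (δ / (n * δ)) = 1 := by field_simp
    rw [this, ENNReal.ofReal_one]
  rw [this, one_smul]

section Perturbation

variable {p : ℝ≥0∞} [Fact (1 ≤ p)] {Y₀ : Submodule ℂ (LpI p)} {L : Y₀ →ₗ[ℂ] L0} {C : ℝ}

/-- Two routes lead from the first interval to its translates: exchange it with all of `B`, or with
each piece of `B`. They differ by the constant `(1/p) log n`, whereas the averaging argument says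
that they agree up to bounded error. The three errors account for the factor `3`. -/
theorem log_le_of_hasBoundedCommutators (hp₁ : 1 < p) (hp₂ : p ≠ ∞) (hC : 0 ≤ C)
    (hY : ∀ T ∈ disjointnessPreserving p, ∀ y ∈ Y₀, T y ∈ Y₀)
    (hL : HasBoundedCommutators L C) {δ : ℝ} (hδ : 0 < δ) {n : ℕ} (hn : 0 < n)
    (hδ1 : δ + n * δ ≤ 1) (hmem : indIoo p 0 (δ + n * δ) ∈ Y₀) :
    1 / p.toReal * Real.log n ≤ 3 * C := by
  have hn0 : (0 : ℝ) < n := by exact_mod_cast hn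
  have hnδ : 0 < n * δ := by positivity
  have hsub : ∀ {a b : ℝ}, 0 ≤ a → b ≤ δ + n * δ → indIoo p a b ∈ Y₀ := fun ha hb =>
    indLp_mem_of_subset hp₁ hp₂ hY _ _ hmem (Set.Ioo_subset_Ioo ha hb)
  have hle : ∀ j < n, ((j : ℝ) + 1) * δ + δ ≤ δ + n * δ := fun j hj => by
    have : (j : ℝ) + 1 ≤ n := by exact_mod_cast hj
    nlinarith
  have h1 : indIoo p 0 δ ∈ Y₀ := hsub le_rfl (by linarith)
  have hB : indIoo p δ (δ + n * δ) ∈ Y₀ := hsub hδ.le le_rfl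
  have hj : ∀ j < n, indIoo p ((j + 1) * δ) ((j + 1) * δ + δ) ∈ Y₀ := fun j hj =>
    hsub (by positivity) (hle j hj)
  set w : ℕ → Y₀ := fun j => if h : j < n then ⟨_, hj j h⟩ else 0 with hw_def
  have hw : ∀ j < n, (w j : LpI p) = indIoo p ((j + 1) * δ) ((j + 1) * δ + δ) := fun j hj => by
    simp only [hw_def, dif_pos hj]
  obtain ⟨ε, hε, hεx⟩ := exists_average_estimate hp₁ hp₂ hY hL hδ n hδ1 hB w hw
  obtain ⟨e, he, hex⟩ := exists_swap_estimate hp₁ hp₂ hL hδ hnδ le_rfl hδ1 h1 hB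
  have hf : ∀ j < n, ∃ f : LpI p,
      ∫⁻ x in Set.Ioo ((j + 1) * δ) ((j + 1) * δ + δ), ‖f x‖ₑ ∂leb01 ≤ ENNReal.ofReal (C * δ) ∧
      ∀ᵐ x ∂leb01, x ∈ Set.Ioo ((j + 1) * δ) ((j + 1) * δ + δ) →
        f x = L ⟨_, h1⟩ (x - (j + 1) * δ) - L (w j) x := fun j hjn => by
    have hδj : δ ≤ (j + 1) * δ := by
      nlinarith [show (0 : ℝ) ≤ j * δ by positivity]
    obtain ⟨f, hf, hfx⟩ := exists_swap_estimate hp₁ hp₂ hL hδ hδ hδj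
      ((hle j hjn).trans hδ1) h1 (hj j hjn)
    refine ⟨f, hf, ?_⟩
    filter_upwards [hfx] with x hx hxj
    have hwj : w j = ⟨_, hj j hjn⟩ := Subtype.ext (hw j hjn)
    rw [hx hxj, hwj, div_self hδ.ne', Real.log_one]
    simp
  set v : L0 := L ⟨_, h1⟩
  have hvm : Measurable v := (AEEqFun.stronglyMeasurable _).measurable
  set B := Set.Ioo δ (δ + n * δ) with hBdef
  set κ : ℝ := 1 / p.toReal * Real.log n with hκ
  set D : ℝ → ℂ := fun x => v (δ / (n * δ) * (x - δ)) - v (x - ⌊x / δ⌋₊ * δ) + κ with hD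
  have hB1 : B ⊆ Set.Ioo 0 1 := Set.Ioo_subset_Ioo hδ.le hδ1
  have hres : ∀ {S : Set ℝ}, S ⊆ Set.Ioo 0 1 → leb01.restrict S = volume.restrict S := fun h =>
    Measure.restrict_restrict_of_subset h
  have hBj1 : ∀ j < n, Set.Ioo ((j + 1) * δ) ((j + 1) * δ + δ) ⊆ Set.Ioo 0 1 := fun j hj =>
    Set.Ioo_subset_Ioo (by positivity) ((hle j hj).trans hδ1)
  have hsum : ∀ F : ℝ → ℝ≥0∞, ∫⁻ x in B, F x = ∑ j ∈ Finset.range n,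
      ∫⁻ x in Set.Ioo ((j + 1) * δ) ((j + 1) * δ + δ), F x := fun F => by
    rw [hBdef, restrict_Ioo_eq_sum hδ, lintegral_finsetSum_measure]
  have hlog : Real.log (δ / (n * δ)) = -Real.log n := by
    rw [← Real.log_inv]
    congr 1
    field_simp
  have hmeas : ∀ f : LpI p, Measurable fun x => ‖f x‖ₑ := fun f =>
    (Lp.stronglyMeasurable f).measurable.enorm
  have hDB : ∫⁻ x in B, ‖D x‖ₑ ≤ ENNReal.ofReal (3 * C * (n * δ)) := by
    have hpiece : ∀ j ∈ Finset.range n,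
        ∫⁻ x in Set.Ioo ((j + 1) * δ) ((j + 1) * δ + δ), ‖D x‖ₑ ≤
          (∫⁻ x in Set.Ioo ((j + 1) * δ) ((j + 1) * δ + δ), (‖e x‖ₑ + ‖ε x‖ₑ)) +
            ENNReal.ofReal (C * δ) := by
      intro j hjr
      have hjn := Finset.mem_range.1 hjr
      obtain ⟨f, hf, hfx⟩ := hf j hjn
      rw [hres (hBj1 j hjn)] at hf
      refine le_trans ?_ (add_le_add le_rfl hf)
      rw [← lintegral_add_right _ (hmeas f)]
      refine lintegral_mono_ae ?_
      rw [← hres (hBj1 j hjn)]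
      filter_upwards [ae_restrict_of_ae hex, ae_restrict_of_ae hfx, ae_restrict_of_ae (hεx j hjn),
        ae_restrict_mem measurableSet_Ioo] with x a1 a2 a3 hx
      have hxB : x ∈ B := by
        refine ⟨lt_of_le_of_lt ?_ hx.1, hx.2.trans_le (hle j hjn)⟩
        nlinarith [show (0 : ℝ) ≤ j * δ by positivity]
      -- `L 1_B` and the image of the indicator of the piece cancel between the three estimates,
      -- leaving only values of `v`; `κ` appears with a plus sign since the stretched interval is
      -- `n` times shorter than `B`.
      have : D x = e x - f x - ε x := by
        rw [a1 hxB, a2 hx, a3 hx, hD, hlog]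
        simp only [floor_of_mem hδ hx, hκ]
        push_cast
        ring
      rw [this, add_right_comm]
      exact enorm_sub_le.trans (add_le_add enorm_sub_le le_rfl)
    rw [hsum]
    refine (Finset.sum_le_sum hpiece).trans ?_
    rw [Finset.sum_add_distrib, ← hsum, lintegral_add_left (hmeas e)]
    rw [hres hB1] at he hε
    rw [Finset.sum_const, Finset.card_range, nsmul_eq_mul, ← ENNReal.ofReal_natCast,
      ← ENNReal.ofReal_mul hn0.le]
    refine (add_le_add (add_le_add he hε) le_rfl).trans ?_
    rw [← ENNReal.ofReal_add (by positivity) (by positivity),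
      ← ENNReal.ofReal_add (by positivity) (by positivity)]
    exact ENNReal.ofReal_le_ofReal (by nlinarith)
  have hPm : Measurable fun x : ℝ => δ / (n * δ) * (x - δ) := by fun_prop
  have hQm : Measurable fun x : ℝ => x - ⌊x / δ⌋₊ * δ :=
    measurable_id.sub (((measurable_from_top (f := fun k : ℕ => (k : ℝ))).comp
      (Nat.measurable_floor.comp (measurable_id.div_const δ))).mul_const δ)
  have hDm : Measurable D := ((hvm.comp hPm).sub (hvm.comp hQm)).add_const _
  have hDi : Integrable D (volume.restrict B) :=
    ⟨hDm.aestronglyMeasurable, hDB.trans_lt ENNReal.ofReal_lt_top⟩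
  have hre : Integrable (fun x => (D x).re) (volume.restrict B) := hDi.re
  have heq : (fun x => (v (δ / (n * δ) * (x - δ))).re - (v (x - ⌊x / δ⌋₊ * δ)).re) =
      fun x => (D x).re - κ := by
    ext x
    simp [hD]
  -- Nothing is known about the integrability of `v`. Only the difference of its two compositions is
  -- integrable, being `D` minus a constant, and equidistribution makes its real part have mean
  -- zero.
  have hzero := integral_sub_eq_zero_of_map_eq hPm hQm (map_stretch_eq_map_cut hδ hn)
    (g := fun t => (v t).re) (Complex.measurable_re.comp hvm) (by
      rw [heq]
      exact hre.sub (integrable_const κ))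
  rw [heq, integral_sub hre (integrable_const κ), integral_const, measureReal_restrict_apply_univ,
    Real.volume_real_Ioo_of_le (by linarith), smul_eq_mul, sub_eq_zero] at hzero
  have hnorm : ∫ x in B, (D x).re ≤ 3 * C * (n * δ) := by
    calc ∫ x in B, (D x).re ≤ ∫ x in B, ‖D x‖ :=
          integral_mono hre hDi.norm fun x => Complex.re_le_norm _
      _ = (∫⁻ x in B, ‖D x‖ₑ).toReal := by
          rw [integral_norm_eq_lintegral_enorm hDi.1]
      _ ≤ 3 * C * (n * δ) := ENNReal.toReal_le_of_le_ofReal (by positivity) hDB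
  rw [hzero] at hnorm
  have : n * δ * κ ≤ n * δ * (3 * C) := by linarith
  exact le_of_mul_le_mul_left this hnδ

theorem not_hasBoundedCommutators (hp₁ : 1 < p) (hp₂ : p ≠ ∞) (hC : 0 ≤ C)
    (hY : ∀ T ∈ disjointnessPreserving p, ∀ y ∈ Y₀, T y ∈ Y₀) (hd : Dense (Y₀ : Set (LpI p))) :
    ¬ HasBoundedCommutators L C := by
  intro hL
  have hp := one_lt_toReal hp₁ hp₂
  obtain ⟨m, hm0, hm1, hm⟩ := exists_indLp_Ioo_mem hp₁ hp₂ hY hd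
  -- Chosen so that `log n > 3 p C`. The constant `C` does not depend on the subdivision, so `(0,
  -- m)` may be cut into `n + 1` equal pieces for this `n`.
  obtain ⟨n, hn⟩ := exists_nat_gt (Real.exp (p.toReal * (3 * C)))
  have hn0 : (0 : ℝ) < n := (Real.exp_pos _).trans hn
  have hδ : m / (n + 1) + n * (m / (n + 1)) = m := by field_simp; ring
  have h := log_le_of_hasBoundedCommutators hp₁ hp₂ hC hY hL (δ := m / (n + 1)) (by positivity)
    (n := n) (by exact_mod_cast hn0) (by rw [hδ]; exact hm1) (by rw [indIoo, hδ]; exact hm)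
  have h2 : p.toReal * (3 * C) < Real.log n := (Real.lt_log_iff_exp_lt hn0).2 hn
  rw [one_div, inv_mul_le_iff₀ (by linarith)] at h
  linarith

/-- The commutator of the sum is that of `L` plus that of the Kalton-Peck map, and the latter is the
explicit term `-log |W| · T y`. -/
theorem hasBoundedCommutators_of_isCentralizer
    {G : Subgroup (IsomLp p)} (hG : G = disjointnessPreserving p) {U : G →* Module.End ℂ L0}
    (hU : ∀ g : G, IsContinuousExtension (g : IsomLp p) (U g))
    (hY₀ : ∀ g : G, ∀ y ∈ Y₀, naturalAction G g y ∈ Y₀)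
    (h : IsCentralizer (toL0 p) U (restrictAction (naturalAction G) Y₀ hY₀)
      (fun y : Y₀ => kaltonPeck p (y : LpI p) + L y)) :
    ∃ C : ℝ, 0 ≤ C ∧ HasBoundedCommutators L C := by
  subst hG
  obtain ⟨C, hC⟩ := h.2
  refine ⟨max C 0, le_max_right _ _, fun T hT W Θ hW y hTy => ?_⟩
  obtain ⟨e, he, hen⟩ := hC ⟨T, hT⟩ y
  refine ⟨e, hen.trans (mul_le_mul_of_nonneg_right (le_max_left _ _) (norm_nonneg _)), ?_⟩
  set V := U ⟨T, hT⟩ with hV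
  have hVT : IsContinuousExtension T V := hU ⟨T, hT⟩
  have hVW : V = weightedComp W hW.1 Θ hW.2.1 := hVT.unique hW.isContinuousExtension
  have hval : (e : L0) = (V (kaltonPeck p y) - kaltonPeck p (T y)) +
      (V (L y) - L ⟨T y, hTy⟩) := by
    change toL0 p e = _
    rw [he]
    change V (kaltonPeck p y + L y) - (kaltonPeck p (T y) + L ⟨T y, hTy⟩) = _
    rw [map_add]
    abel
  have h1 := weightedComp_ae W hW.1 Θ hW.2.1 (L y)
  rw [← hVW] at h1
  filter_upwards [h1, hW.commutator_ae hVT y,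
    AEEqFun.coeFn_add (V (kaltonPeck p y) - kaltonPeck p (T y)) (V (L y) - L ⟨T y, hTy⟩),
    AEEqFun.coeFn_sub (V (L y)) (L ⟨T y, hTy⟩)] with x a1 a2 a3 a4
  rw [hval, a3, Pi.add_apply, a2, a4, Pi.sub_apply, a1]
  ring

end Perturbation

end

theorem theorem4p6 (p : ℝ≥0∞) [Fact (1 ≤ p)] (hp₁ : 1 < p) (hp₂ : p ≠ ∞)
    (G : Subgroup (IsomLp p))
    (hG : (p ≠ 2 ∧ G = ⊤) ∨ (p = 2 ∧ G = disjointnessPreserving p)) :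
    ∃ (U : G →* Module.End ℂ L0) (d : G → (LpI p →ₗ[ℂ] L0)),
      -- `U` is the only extension of the natural action to `L₀` by continuous operators
      (∀ (g : G) (V : Module.End ℂ L0), IsContinuousExtension (g : IsomLp p) V ↔ V = U g) ∧
      -- the commutators `[g, 𝒦]` are linear, `d g = -[g, 𝒦]`
      (∀ (g : G) (f : LpI p),
        d g f = -actionCommutator U (naturalAction G) (kaltonPeck p) g f) ∧
      -- compatibility with the Kalton-Peck map
      IsCompatibleVia (toL0 p) U (naturalAction G) (kaltonPeck p) d ∧
      -- compatibility with the differential of the scale of Lebesgue spaces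
      (∀ B : LpI p → ℂ → LpI 1, IsCalderonSelection p B →
        IsCompatible (toL0 p) U (naturalAction G) (scaleDifferential p B)) ∧
      -- extension to a bounded action on the Kalton-Peck space
      (∃ Λ : G →* Module.End ℂ (KaltonPeckSpace p),
        (∀ (g : G) (z : KaltonPeckSpace p),
          (Λ g z : L0 × LpI p) =
            (U g (z : L0 × LpI p).1 + d g (z : L0 × LpI p).2,
              naturalAction G g (z : L0 × LpI p).2)) ∧
        ∃ C : ℝ, ∀ (g : G) (z : KaltonPeckSpace p),
          twistedNorm (toL0 p) (kaltonPeck p) (Λ g z : L0 × LpI p) ≤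
            C * twistedNorm (toL0 p) (kaltonPeck p) (z : L0 × LpI p)) ∧
      -- on no dense invariant subspace is it a linear perturbation of a centralizer
      (∀ (Y₀ : Submodule ℂ (LpI p)), Dense (Y₀ : Set (LpI p)) →
        ∀ hY₀ : ∀ g : G, ∀ y ∈ Y₀, naturalAction G g y ∈ Y₀,
          ¬ IsLinearPerturbationOfCentralizer (toL0 p) U (restrictAction (naturalAction G) Y₀ hY₀)
            (fun y : Y₀ => kaltonPeck p (y : LpI p))) := by
  -- Both cases concern the same group: for `p ≠ 2` preservation of disjointness is automatic, and
  -- for `p = 2` it is imposed.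
  have hGd : G = disjointnessPreserving p := by
    rcases hG with ⟨h2, h⟩ | ⟨_, h⟩
    · rw [h, disjointnessPreserving_eq_top hp₁ hp₂ h2]
    · exact h
  obtain ⟨U, hU⟩ := exists_extendedAction hp₂ hGd.le
  obtain ⟨d, hd⟩ := exists_derivation hp₂ hGd.le U hU
  have hu : ∀ (g : G) (f : LpI p), U g (toL0 p f) = toL0 p ((g : IsomLp p) f) :=
    fun g f => (hU g).1 f
  have hun : ∀ (g : G) (f : LpI p), ‖(g : IsomLp p) f‖ ≤ ‖f‖ :=
    fun g f => ((g : IsomLp p).norm_map f).le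
  have hv : ∀ (g : G) (f : LpI p), ‖naturalAction G g f‖ ≤ ‖f‖ := hun
  refine ⟨U, d, fun g V => ⟨fun hV => hV.unique (hU g), fun hV => hV ▸ hU g⟩, hd,
    isCompatibleVia_of_eq_neg_commutator (kaltonPeck_isQuasiLinear p) hd, fun B hB => ?_, ?_,
    fun Y₀ hdense hY₀ => ?_⟩
  · obtain ⟨hhom, K, hK, hb⟩ := exists_scaleDifferential_sub_bound hp₁ hp₂ hB
    exact isCompatible_of_bounded_perturbation hu hun hv (kaltonPeck_isQuasiLinear p) hd hhom
      (p.toReal : ℂ) hK hb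
  · obtain ⟨Λ, h1, h2⟩ := exists_triangularAction (toL0_injective p) hu hun hv
      (kaltonPeck_isQuasiLinear p) hd
    exact ⟨Λ, h1, 1, h2⟩
  · rintro ⟨L, hL⟩
    obtain ⟨C, hC, hLC⟩ := hasBoundedCommutators_of_isCentralizer hGd hU hY₀ hL
    exact not_hasBoundedCommutators hp₁ hp₂ hC (fun T hT => hY₀ ⟨T, hGd ▸ hT⟩) hdense hLC
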